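/- Let $N\ge 1$ and $\sigma>0$. Let $M=\mathrm H(N)$ be the space of $N\times N$ Hermitian positive-definite matrices, with the Riemannian metric $\langle u,v\rangle_x=\mathrm{tr}(x^{-1}u\,x^{-1}v)$, its Riemannian volume $\mathrm{vol}$, and its Riemannian distance $d$, given by $d^2(x,y)=\sum_{i}(\log\lambda_i)^2$ where $\lambda_1,\dots,\lambda_N$ are the eigenvalues of $y^{-1}x$. For $\bar y\in M$, let $$Z_M(\sigma)=\int_M \exp\left[-\frac{d^2(x,\bar y)}{2\sigma^2}\right]\mathrm{vol}(dx)$$ be the normalising factor of the Gaussian distribution on $M$. Let $M^*=U(N)$ be the unitary group, with the bi-invariant metric $\langle u,v\rangle_x=-\mathrm{tr}(x^{-1}u\,x^{-1}v)$ and its Riemannian volume $\mathrm{vol}$. Let $\vartheta(e^{i\varphi}|s)=\sum_{m\in\mathbb Z}\exp(-m^2 s+2mi\varphi)$ be Jacobi's theta function. For $x=k\,\mathrm{diag}(e^{i\theta_1},\dots,e^{i\theta_N})\,k^\dagger\in U(N)$, with $k\in U(N)$, let $$\Theta(x|\sigma^2)=k\,\mathrm{diag}\Big(\vartheta\big(e^{i\theta_1/2}\big|\tfrac{\sigma^2}{2}\big),\dots,\vartheta\big(e^{i\theta_N/2}\big|\tfrac{\sigma^2}{2}\big)\Big)k^\dagger=\sum_{m\in\mathbb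 Z}e^{-m^2\sigma^2/2}\,x^m .$$ For $\bar x,x\in U(N)$, let $$f_*(x|\bar x,\sigma)=\det\left[(2\pi\sigma^2)^{1/2}\,\Theta(x\bar x^\dagger|\sigma^2)\right],\qquad Z_{M^*}(\sigma)=\int_{M^*}f_*(x|\bar x,\sigma)\,\mathrm{vol}(dx).$$ Then $f_*$ is real and positive and integrable, $Z_{M^*}(\sigma)$ is positive and does not depend on $\bar x$, and $f_*(x|\bar x,\sigma)/Z_{M^*}(\sigma)$ is the density, with respect to $\mathrm{vol}(dx)$, of a probability distribution on $U(N)$ (the $\Theta$ distribution $\Theta(\bar x,\sigma)$). Moreover the integral $Z_M(\sigma)$ is finite and, whatever $\bar y\in M$ and $\bar x\in M^*$, $$\frac{Z_M(\sigma)}{Z_{M^*}(\sigma)}=(2\pi)^{-N}\exp\left[\left(\frac{N^3-N}{6}\right)\sigma^2\right].$$ Equivalently, let $Z^\circ_{M^*}(\sigma)$ be the normalising constant obtained when the factor $(2\pi\sigma^2)^{1/2}$ in $f_*$ is replaced by $(2\pi\sigma^2)^{1/2}/(2\pi)$ (this gives the same $\Theta$ distribution). Then $$\frac{Z_M(\sigma)}{Z^\circ_{M^*}(\sigma)}=\exp\left[\left(\frac{N^3-N}{6}\right)\sigma^2\right].$$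 -/

import Mathlib

open scoped Matrix Real ComplexOrder

open MeasureTheory

noncomputable section

namespace ThetaDual

/-- The space of `N × N` complex matrices. -/
abbrev Mat (N : ℕ) : Type := Matrix (Fin N) (Fin N) ℂ

/-- The unitary group `U(N)`. -/
abbrev UN (N : ℕ) : Type := Matrix.unitaryGroup (Fin N) ℂ

/-- The Borel (product) σ-algebra on matrices; `U(N)` inherits it as a subtype. -/
instance instMeasurableSpaceMat (N : ℕ) : MeasurableSpace (Mat N) :=
  inferInstanceAs (MeasurableSpace (Fin N → Fin N → ℂ))

instance instBorelSpaceMat (N : ℕ) : BorelSpace (Mat N) :=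
  inferInstanceAs (BorelSpace (Fin N → Fin N → ℂ))

/-! ### Riemannian volume in a chart -/

/-- Coordinates on the real vector space of Hermitian matrices: `N²` real numbers. -/
abbrev Coord (N : ℕ) : Type := Fin N × Fin N → ℝ

/-- The Hermitian matrix with coordinates `t`: the diagonal entries are `t (i, i)`, and the
entry at `i < j` is `t (i, j) + √(-1) t (j, i)`. -/
def herm (N : ℕ) (t : Coord N) : Mat N :=
  Matrix.of fun i j =>
    if i = j then (t (i, i) : ℂ)
    else if i < j then (t (i, j) : ℂ) + Complex.I * (t (j, i) : ℂ)
    else (t (j, i) : ℂ) - Complex.I * (t (i, j) : ℂ)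

/-- The coordinate tangent vector `∂φ/∂tₚ` of a parametrisation `φ` by matrices (entrywise partial
derivative). -/
def coordVector (N : ℕ) (φ : Coord N → Mat N) (t : Coord N) (p : Fin N × Fin N) : Mat N :=
  Matrix.of fun i j => lineDeriv ℝ (fun s => φ s i j) t (Pi.single p 1)

/-- The Riemannian volume density `√(det (g(∂φ/∂tₚ, ∂φ/∂t_q)))` in the chart `φ`. Here `g x u v`
is the metric at the point `x`, on tangent vectors `u` and `v`. -/
def volumeDensity (N : ℕ) (g : Mat N → Mat N → Mat N → ℝ) (φ : Coord N → Mat N)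
    (t : Coord N) : ℝ :=
  √(Matrix.of fun p q : Fin N × Fin N =>
    g (φ t) (coordVector N φ t p) (coordVector N φ t q)).det

/-! ### The space `H(N)` of Hermitian positive-definite matrices -/

/-- The affine-invariant metric `⟨u, v⟩_x = tr (x⁻¹ u x⁻¹ v)` of `H(N)`. -/
def metricH (N : ℕ) (x u v : Mat N) : ℝ := (x⁻¹ * u * (x⁻¹ * v)).trace.re

/-- The Riemannian volume of `H(N)`, as a measure on matrices carried by `H(N)`, which is the open
set of positive-definite matrices in the space of Hermitian matrices. -/
def volH (N : ℕ) : Measure (Mat N) :=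
  ((volume.restrict {t : Coord N | (herm N t).PosDef}).withDensity
    fun t => ENNReal.ofReal (volumeDensity N (metricH N) (herm N) t)).map (herm N)

/-- The squared Riemannian distance of the affine-invariant metric,
`d²(x, y) = ∑ᵢ (log λᵢ)²`, where the `λᵢ` are the eigenvalues (with multiplicity) of `y⁻¹ x`;
equivalently `d(x, y)` is the Frobenius norm of `log (y^{-1/2} x y^{-1/2})`. -/
def distSqH (N : ℕ) (x y : Mat N) : ℝ :=
  ((y⁻¹ * x).charpoly.roots.map fun z => Real.log z.re ^ 2).sum

/-- The Gaussian density profile `exp (-d²(x, x̄) / (2σ²))` on `H(N)`. -/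
def gaussProfile (N : ℕ) (σ : ℝ) (xbar x : Mat N) : ℝ :=
  Real.exp (-distSqH N x xbar / (2 * σ ^ 2))

/-- The normalising factor `Z_M` of the Gaussian distribution on `M = H(N)`. -/
def gaussNorm (N : ℕ) (σ : ℝ) (xbar : Mat N) : ℝ :=
  ∫ x, gaussProfile N σ xbar x ∂(volH N)

/-! ### The unitary group `U(N)` -/

/-- The bi-invariant metric `⟨u, v⟩_x = -tr (x⁻¹ u x⁻¹ v)` of `U(N)`. -/
def metricU (N : ℕ) (x u v : Mat N) : ℝ := -(x⁻¹ * u * (x⁻¹ * v)).trace.re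

/-- The Cayley chart of `U(N)` in terms of Hermitian matrices `a`, namely
`a ↦ (1 + √(-1) a) (1 - √(-1) a)⁻¹`. It is a diffeomorphism onto `{x ∈ U(N) | det (1 + x) ≠ 0}`. -/
def cayley (N : ℕ) (t : Coord N) : Mat N :=
  (1 + Complex.I • herm N t) * (1 - Complex.I • herm N t)⁻¹

theorem herm_conjTranspose (N : ℕ) (t : Coord N) : (herm N t)ᴴ = herm N t := by
  ext i j
  simp only [herm, Matrix.conjTranspose_apply, Matrix.of_apply]
  rcases lt_trichotomy i j with h | h | h
  · simp [h.ne, h.ne', h, h.not_gt]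
  · subst h; simp
  · simp [h.ne, h.ne', h, h.not_gt, sub_eq_add_neg]

theorem cayley_aux {N : ℕ} (a : Mat N) (ha : aᴴ = a) : IsUnit (1 - Complex.I • a).det := by
  rw [isUnit_iff_ne_zero]
  intro h0
  obtain ⟨v, hv, hv0⟩ := Matrix.exists_mulVec_eq_zero_iff.mpr h0
  have h1 : v = Complex.I • (a *ᵥ v) := by
    rw [Matrix.sub_mulVec, Matrix.one_mulVec, Matrix.smul_mulVec, sub_eq_zero] at hv0
    exact hv0
  have h2 : star v ⬝ᵥ v = Complex.I * (star v ⬝ᵥ (a *ᵥ v)) := by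
    rw [← smul_eq_mul, ← dotProduct_smul, ← h1]
  have h3 : (star v ⬝ᵥ (a *ᵥ v)).im = 0 := by
    have hh : a.IsHermitian := ha
    have := hh.im_star_dotProduct_mulVec_self v
    simpa using this
  have h4 : 0 < star v ⬝ᵥ v := Matrix.dotProduct_star_self_pos_iff.mpr hv
  have h5 : (star v ⬝ᵥ v).re = 0 := by
    rw [h2, Complex.mul_re]; simp [h3]
  have h6 := (Complex.lt_def.mp h4).1
  simp [h5] at h6

theorem cayley_mem (N : ℕ) (t : Coord N) : cayley N t ∈ Matrix.unitaryGroup (Fin N) ℂ := by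
  rw [Matrix.mem_unitaryGroup_iff']
  set a := herm N t with ha
  have haH : aᴴ = a := herm_conjTranspose N t
  have hu := cayley_aux a haH
  have hu' : IsUnit (1 + Complex.I • a).det := by
    have := cayley_aux (-a) (by rw [Matrix.conjTranspose_neg, haH])
    simpa using this
  have hs : star (cayley N t) = (1 + Complex.I • a)⁻¹ * (1 - Complex.I • a) := by
    rw [Matrix.star_eq_conjTranspose, cayley, ← ha, Matrix.conjTranspose_mul,
      Matrix.conjTranspose_nonsing_inv]
    simp [haH, sub_eq_add_neg]
  have hc : (1 - Complex.I • a) * (1 + Complex.I • a)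
      = (1 + Complex.I • a) * (1 - Complex.I • a) := by
    have h2 : Commute (1 : Mat N) (Complex.I • a) := Commute.one_left _
    exact (((Commute.one_left _).add_right h2).sub_left
      ((Commute.one_right _).add_right (Commute.refl _))).eq
  rw [hs, cayley, ← ha, Matrix.mul_assoc, ← Matrix.mul_assoc (1 - Complex.I • a), hc,
    Matrix.mul_assoc, Matrix.mul_nonsing_inv _ hu, Matrix.mul_one, Matrix.nonsing_inv_mul _ hu']

/-- The Cayley chart, with values in `U(N)`. -/
def cayleyU (N : ℕ) (t : Coord N) : UN N := ⟨cayley N t, cayley_mem N t⟩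

/-- The Riemannian volume of `U(N)`. The complement of the image of the Cayley chart,
`{x ∈ U(N) | det (1 + x) = 0}`, is negligible, so the volume is given in this single chart. -/
def volU (N : ℕ) : Measure (UN N) :=
  (volume.withDensity
    fun t => ENNReal.ofReal (volumeDensity N (metricU N) (cayley N) t)).map (cayleyU N)

/-! ### Theta functions and `Θ` distributions -/

/-- Jacobi's function `ϑ(e^{√(-1) φ} | s) = ∑ₘ exp (-m² s + 2 m √(-1) φ)`, summed over the
integers. -/
def jacobiTheta (φ s : ℝ) : ℂ :=
  ∑' m : ℤ, Complex.exp (-(m : ℂ) ^ 2 * s + 2 * m * Complex.I * φ)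

/-- The matrix theta function `Θ(x | s)`, the sum over the integers of `exp (-m² s / 2) xᵐ`. By
`matrixTheta_conj` it applies `e^{√(-1) θ} ↦ ϑ(e^{√(-1) θ/2} | s / 2)` to each eigenvalue of
`x ∈ U(N)`. -/
def matrixTheta (N : ℕ) (s : ℝ) (x : UN N) : Mat N :=
  ∑' m : ℤ, Complex.exp (-(m : ℂ) ^ 2 * (s / 2 : ℝ)) • ((x ^ m : UN N) : Mat N)

theorem hasSum_jacobiTheta (φ : ℝ) {s : ℝ} (hs : 0 < s) :
    HasSum (fun m : ℤ => Complex.exp (-(m : ℂ) ^ 2 * s + 2 * m * Complex.I * φ))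
      (jacobiTheta φ s) := by
  refine Summable.hasSum ?_
  have hτ : 0 < (Complex.I * (s / π : ℝ) : ℂ).im := by
    simp only [Complex.mul_im, Complex.I_re, Complex.I_im, Complex.ofReal_re, Complex.ofReal_im]
    have := div_pos hs Real.pi_pos
    linarith
  have h := (hasSum_jacobiTheta₂_term (φ / π : ℂ) hτ).summable
  refine h.congr fun m => ?_
  have hp : (π : ℂ) ≠ 0 := by exact_mod_cast Real.pi_ne_zero
  unfold jacobiTheta₂_term
  congr 1
  push_cast
  field_simp
  linear_combination (m : ℂ) ^ 2 * s * Complex.I_sq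

/-- If `x = k diag(e^{√(-1) θᵢ}) k†` with `k ∈ U(N)`, then
`Θ(x | s) = k diag(ϑ(e^{√(-1) θᵢ / 2} | s / 2)) k†`. -/
theorem matrixTheta_conj (N : ℕ) {s : ℝ} (hs : 0 < s) (k x : UN N) (θ : Fin N → ℝ)
    (hx : (x : Mat N) = (k : Mat N) *
      Matrix.diagonal (fun i => Complex.exp (Complex.I * θ i)) * (k : Mat N)ᴴ) :
    matrixTheta N s x = (k : Mat N) *
      Matrix.diagonal (fun i => jacobiTheta (θ i / 2) (s / 2)) * (k : Mat N)ᴴ := by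
  have hk : (k : Mat N)ᴴ * (k : Mat N) = 1 := Matrix.mem_unitaryGroup_iff'.mp k.2
  have hk' : (k : Mat N) * (k : Mat N)ᴴ = 1 := Matrix.mem_unitaryGroup_iff.mp k.2
  let D : ℤ → Mat N := fun m => Matrix.diagonal fun i => Complex.exp (m * (Complex.I * θ i))
  have hD : ∀ m n, D m * D n = D (m + n) := by
    intro m n
    simp only [D, Matrix.diagonal_mul_diagonal]
    congr 1; ext i
    rw [← Complex.exp_add]; push_cast; ring_nf
  have hD0 : D 0 = 1 := by simp [D]
  have hx1 : (x : Mat N) = (k : Mat N) * D 1 * (k : Mat N)ᴴ := by simp [D, hx]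
  have hxi : ((x⁻¹ : UN N) : Mat N) = (k : Mat N) * D (-1) * (k : Mat N)ᴴ := by
    have h1 : ((x⁻¹ : UN N) : Mat N) * (x : Mat N) = 1 := by simp
    have h2 : (x : Mat N) * ((k : Mat N) * D (-1) * (k : Mat N)ᴴ) = 1 := by
      rw [hx1]
      calc _ = (k : Mat N) * (D 1 * ((k : Mat N)ᴴ * (k : Mat N)) * D (-1)) * (k : Mat N)ᴴ := by
            simp only [Matrix.mul_assoc]
        _ = 1 := by rw [hk, Matrix.mul_one, hD]; simp [hD0, hk']
    exact left_inv_eq_right_inv h1 h2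
  have hpow : ∀ m : ℤ, ((x ^ m : UN N) : Mat N) = (k : Mat N) * D m * (k : Mat N)ᴴ := by
    intro m
    induction m using Int.induction_on with
    | zero => simp [hD0, hk']
    | succ n ih =>
      rw [zpow_add_one, Submonoid.coe_mul, ih, hx1]
      calc _ = (k : Mat N) * (D n * ((k : Mat N)ᴴ * (k : Mat N)) * D 1) * (k : Mat N)ᴴ := by
            simp only [Matrix.mul_assoc]
        _ = _ := by rw [hk, Matrix.mul_one, hD]
    | pred n ih =>
      rw [zpow_sub_one, Submonoid.coe_mul, ih, hxi]
      calc _ = (k : Mat N) * (D (-n) * ((k : Mat N)ᴴ * (k : Mat N)) * D (-1)) * (k : Mat N)ᴴ := by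
            simp only [Matrix.mul_assoc]
        _ = _ := by rw [hk, Matrix.mul_one, hD]; rfl
  have hdiag : HasSum (fun m : ℤ => Complex.exp (-(m : ℂ) ^ 2 * (s / 2 : ℝ)) • D m)
      (Matrix.diagonal (fun i => jacobiTheta (θ i / 2) (s / 2))) := by
    refine Pi.hasSum.mpr fun i => Pi.hasSum.mpr fun j => ?_
    by_cases hij : i = j
    · subst hij
      simp only [D, Matrix.smul_apply, Matrix.diagonal_apply_eq, smul_eq_mul]
      refine (hasSum_jacobiTheta (θ i / 2) (half_pos hs)).congr_fun ?_
      intro m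
      rw [← Complex.exp_add]; push_cast; ring_nf
    · simp only [D, Matrix.smul_apply, Matrix.diagonal_apply_ne _ hij, smul_zero]
      exact hasSum_zero
  have h := (hdiag.mul_left (k : Mat N)).mul_right (k : Mat N)ᴴ
  unfold matrixTheta
  rw [← h.tsum_eq]
  refine tsum_congr fun m => ?_
  rw [hpow, Matrix.mul_smul, Matrix.smul_mul]

/-- The determinant `det [c Θ(x x̄† | σ²)]`, where the constant `c` fixes the normalisation. -/
def thetaDet (N : ℕ) (c σ : ℝ) (xbar x : UN N) : ℂ :=
  ((c : ℂ) • matrixTheta N (σ ^ 2) (x * star xbar)).det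

/-- The function `f_*(x | x̄, σ) = det [c Θ(x x̄† | σ²)]`, which is real. -/
def thetaProfile (N : ℕ) (c σ : ℝ) (xbar x : UN N) : ℝ := (thetaDet N c σ xbar x).re

/-- The normalising constant `Z_{M*}`, the integral of `f_*` over `M* = U(N)`. -/
def thetaNorm (N : ℕ) (c σ : ℝ) (xbar : UN N) : ℝ :=
  ∫ x, thetaProfile N c σ xbar x ∂(volU N)

/-- The `Θ` distribution `Θ(x̄, σ)` on `U(N)`: its density for the Riemannian volume is
`f_* / Z_{M*}`. -/
def thetaDistribution (N : ℕ) (c σ : ℝ) (xbar : UN N) : Measure (UN N) :=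
  (volU N).withDensity
    fun x => ENNReal.ofReal ((thetaNorm N c σ xbar)⁻¹ * thetaProfile N c σ xbar x)

end ThetaDual

end

open ThetaDual

noncomputable section

namespace ThetaDual

/-! Both normalising factors become integrals of class functions over the same real vector space of
Hermitian matrices. In linear coordinates, the volume of `H(N)` has density proportional to `|det
x|⁻ᴺ` on the positive cone (`volumeDensity_herm`). In the Cayley chart `X = 2Y - 1`, with resolvent
`Y = (1 - i a)⁻¹`, the volume of `U(N)` has density proportional to `|det Y|²ᴺ`
(`volumeDensity_cayley`). Invariance of the two volumes, under congruences and under right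
translations, moves both centres to the identity (`measurePreserving_cong_densH`,
`lintegral_volU_mul_right`).

Weyl's integration formula (`exists_weyl_integration`) then reduces both integrals to eigenvalues.
Its constant is never computed: it is the same for the two integrals, so it is enough that it is
neither zero nor infinite. In eigenvalue coordinates each integrand is a squared Vandermonde
determinant times a product of one-variable weights, with the same prefactor on both sides
(`weylDensity_mul_gaussDens`, `weylDensity_mul_densU_mul_thetaProfile`).

Andréief's identity (`integral_det_mul_det`) turns each eigenvalue integral into `N!` times the
determinant of a moment matrix. The log-normal weight of `H(N)` has moments `√(2πs) exp(s (j + k - N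
+ 1)² / 2)`, and the theta weight of `U(N)` has Fourier coefficients `2π exp(-s (j - k)² / 2)`,
where `s = σ²`. Half the sum of `(j + k - N + 1)²` and `(j - k)²` is a function of `j` plus a
function of `k`. The two matrices therefore differ by multiplication on both sides by one positive
diagonal matrix (`det_gramH`), whose squared determinant is `exp((N³ - N) s / 6)`. Everything else
cancels except powers of `2π` and of the chosen normalisation. -/

variable {N : ℕ}

/-! ### Hermitian coordinates, congruences and their determinants -/

theorem herm_add (s t : Coord N) : herm N (s + t) = herm N s + herm N t := by
  ext i j
  simp only [herm, Matrix.of_apply, Matrix.add_apply, Pi.add_apply]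
  split_ifs <;> push_cast <;> ring

theorem herm_smul (c : ℝ) (t : Coord N) : herm N (c • t) = c • herm N t := by
  ext i j
  simp only [herm, Matrix.of_apply, Matrix.smul_apply, Pi.smul_apply, smul_eq_mul,
    Complex.real_smul]
  split_ifs <;> push_cast <;> ring

/-- `herm` as a linear map. -/
def hermL (N : ℕ) : Coord N →ₗ[ℝ] Mat N where
  toFun := herm N
  map_add' := herm_add
  map_smul' := herm_smul

/-- The coordinates of a Hermitian matrix. -/
def toCoord (N : ℕ) : Mat N →ₗ[ℝ] Coord N where
  toFun x p := if p.1 ≤ p.2 then (x p.1 p.2).re else (x p.2 p.1).im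
  map_add' x y := by
    ext p
    simp only [Matrix.add_apply, Pi.add_apply]
    split_ifs <;> simp
  map_smul' c x := by
    ext p
    simp only [Matrix.smul_apply, Pi.smul_apply, RingHom.id_apply, smul_eq_mul]
    split_ifs <;> simp

theorem toCoord_apply (x : Mat N) (p : Fin N × Fin N) :
    toCoord N x p = if p.1 ≤ p.2 then (x p.1 p.2).re else (x p.2 p.1).im := rfl

@[simp] theorem toCoord_herm (t : Coord N) : toCoord N (herm N t) = t := by
  ext ⟨i, j⟩
  rw [toCoord_apply]
  rcases lt_trichotomy i j with h | h | h
  · simp [herm, h.ne, h.le, h]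
  · subst h; simp [herm]
  · simp [herm, h.ne, h.not_ge, h]

theorem herm_toCoord {x : Mat N} (hx : xᴴ = x) : herm N (toCoord N x) = x := by
  have hs : ∀ i j, x i j = star (x j i) := fun i j => by
    conv_lhs => rw [← hx]
    rfl
  ext i j
  simp only [herm, Matrix.of_apply, toCoord_apply]
  rcases lt_trichotomy i j with h | h | h
  · simp [h.ne, h.le, h, h.not_ge]
    rw [mul_comm, Complex.re_add_im]
  · subst h
    simp
    have := congrArg Complex.im (hs i i)
    simp at this
    apply Complex.ext
    · simp
    · simp; linarith
  · simp [h.ne', h.le, h.not_ge, h.not_gt]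
    rw [hs i j]
    apply Complex.ext <;> simp

theorem herm_injective : Function.Injective (herm N) :=
  Function.LeftInverse.injective toCoord_herm

/-- The congruence `h ↦ g h g†` in coordinates. -/
def cong (g : Mat N) : Coord N →ₗ[ℝ] Coord N :=
  (toCoord N).comp (((LinearMap.mulRight ℝ gᴴ).comp (LinearMap.mulLeft ℝ g)).comp (hermL N))

theorem cong_apply (g : Mat N) (t : Coord N) : cong g t = toCoord N (g * herm N t * gᴴ) := rfl

theorem herm_cong (g : Mat N) (t : Coord N) : herm N (cong g t) = g * herm N t * gᴴ := by
  rw [cong_apply, herm_toCoord]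
  simp [herm_conjTranspose, Matrix.mul_assoc]

theorem cong_mul (g h : Mat N) : cong (g * h) = (cong g).comp (cong h) := by
  ext1 t
  refine LinearMap.ext fun t => herm_injective ?_
  simp [herm_cong, Matrix.mul_assoc]

theorem cong_one : cong (1 : Mat N) = LinearMap.id := by
  refine LinearMap.ext fun t => herm_injective ?_
  simp [herm_cong]

/-- The weights of the coordinates in the trace form. -/
def wt (p : Fin N × Fin N) : ℝ := if p.1 = p.2 then 1 else 2

/-- An off-diagonal pair of indices enters the trace in both orders, and the cross terms between
real and imaginary coordinates are purely imaginary. This makes the form diagonal, with weights 1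
and 2. -/
theorem trace_herm_mul (s t : Coord N) :
    (herm N s * herm N t).trace.re = ∑ p, wt p * (s p * t p) := by
  have h1 : ∀ i j, (herm N s i j * herm N t j i).re =
      if i = j then s (i, j) * t (i, j) else s (i, j) * t (i, j) + s (j, i) * t (j, i) := by
    intro i j
    simp only [herm, Matrix.of_apply]
    rcases lt_trichotomy i j with h | h | h
    · simp [h.ne, h.ne', h, h.not_gt]
    · subst h; simp
    · simp [h.ne, h.ne', h, h.not_gt]; ring
  simp only [Matrix.trace, Matrix.diag, Matrix.mul_apply, Complex.re_sum, h1]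
  rw [Fintype.sum_prod_type]
  have h2 : ∀ i j, (if i = j then s (i, j) * t (i, j) else
      s (i, j) * t (i, j) + s (j, i) * t (j, i)) = s (i, j) * t (i, j) +
      (if i = j then 0 else s (j, i) * t (j, i)) := by
    intro i j; split_ifs <;> simp
  have h3 : ∀ i j, wt (i, j) * (s (i, j) * t (i, j)) = s (i, j) * t (i, j) +
      (if i = j then 0 else s (i, j) * t (i, j)) := by
    intro i j; simp only [wt]; split_ifs <;> ring
  simp only [h2, h3, Finset.sum_add_distrib]
  congr 1
  rw [Finset.sum_comm]
  refine Finset.sum_congr rfl fun i _ => Finset.sum_congr rfl fun j _ => ?_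
  simp only [eq_comm]

theorem wt_pos (p : Fin N × Fin N) : 0 < wt p := by
  unfold wt; split_ifs <;> norm_num

/-- The determinant of the trace form in coordinates. -/
def detWt (N : ℕ) : ℝ := ∏ p : Fin N × Fin N, wt p

theorem detWt_pos : 0 < detWt N := Finset.prod_pos fun p _ => wt_pos p

/-- The Gram determinant of the trace form pulled back by a linear map. -/
theorem det_gram (A : Coord N →ₗ[ℝ] Coord N) :
    (Matrix.of fun p q : Fin N × Fin N =>
      (herm N (A (Pi.single p 1)) * herm N (A (Pi.single q 1))).trace.re).det =
      LinearMap.det A ^ 2 * detWt N := by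
  have : (Matrix.of fun p q : Fin N × Fin N =>
      (herm N (A (Pi.single p 1)) * herm N (A (Pi.single q 1))).trace.re) =
      (LinearMap.toMatrix' A)ᵀ * Matrix.diagonal wt * LinearMap.toMatrix' A := by
    ext p q
    rw [Matrix.of_apply, trace_herm_mul, Matrix.mul_apply]
    refine Finset.sum_congr rfl fun r _ => ?_
    rw [Matrix.mul_diagonal, Matrix.transpose_apply, LinearMap.toMatrix'_apply,
      LinearMap.toMatrix'_apply]
    ring
  rw [this, Matrix.det_mul, Matrix.det_mul, Matrix.det_transpose, Matrix.det_diagonal,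
    LinearMap.det_toMatrix', detWt]
  ring

/-- Unitary congruences preserve the nondegenerate trace form, so comparing Gram determinants with
those of the identity forces the squared determinant to be 1. -/
theorem abs_det_cong_unitary {g : Mat N} (hg : g ∈ Matrix.unitaryGroup (Fin N) ℂ) :
    |LinearMap.det (cong g)| = 1 := by
  have h1 := det_gram (cong g)
  have h2 := det_gram (LinearMap.id : Coord N →ₗ[ℝ] Coord N)
  have h3 : gᴴ * g = 1 := Matrix.mem_unitaryGroup_iff'.mp hg
  have : ∀ s t : Coord N, (herm N (cong g s) * herm N (cong g t)).trace =
      (herm N s * herm N t).trace := by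
    intro s t
    rw [herm_cong, herm_cong]
    calc _ = (g * (herm N s * (gᴴ * g) * herm N t) * gᴴ).trace := by
          simp only [Matrix.mul_assoc]
      _ = _ := by rw [h3, Matrix.mul_one, Matrix.trace_mul_comm, ← Matrix.mul_assoc, h3,
                    Matrix.one_mul]
  simp only [this] at h1
  simp only [LinearMap.id_apply, LinearMap.det_id] at h2
  rw [h2] at h1
  have h4 := mul_right_cancel₀ detWt_pos.ne' h1
  rw [← sq_eq_sq₀ (abs_nonneg _) zero_le_one, sq_abs]
  exact h4.symm

theorem det_cong_diagonal (e : Fin N → ℝ) :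
    LinearMap.det (cong (Matrix.diagonal fun i => (e i : ℂ))) = (∏ i, e i) ^ (2 * N) := by
  have : LinearMap.toMatrix' (cong (Matrix.diagonal fun i => (e i : ℂ))) =
      Matrix.diagonal fun p : Fin N × Fin N => e p.1 * e p.2 := by
    ext p q
    rw [LinearMap.toMatrix'_apply, cong_apply, toCoord_apply]
    have h : ∀ (t : Coord N) i j, ((Matrix.diagonal fun i => (e i : ℂ)) * herm N t *
        (Matrix.diagonal fun i => (e i : ℂ))ᴴ) i j = ((e i * e j : ℝ) : ℂ) * herm N t i j := by
      intro t i j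
      rw [Matrix.diagonal_conjTranspose, Matrix.mul_diagonal, Matrix.diagonal_mul]
      simp; ring
    have h5 := congrFun (toCoord_herm (N := N) (Pi.single q 1)) p
    rw [toCoord_apply, Pi.single_apply] at h5
    simp only [h, Complex.re_ofReal_mul, Complex.im_ofReal_mul]
    rw [Matrix.diagonal_apply]
    split_ifs at h5 ⊢ with h1 h2 h2
    · rw [h5, mul_one]
    · rw [h5, mul_zero]
    · rw [h5]; ring
    · rw [h5, mul_zero]
  rw [← LinearMap.det_toMatrix', this, Matrix.det_diagonal, Fintype.prod_prod_type]
  simp only [Finset.prod_mul_distrib, Finset.prod_const, Finset.card_univ, Fintype.card_fin]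
  rw [Finset.prod_pow]
  ring

/-- Singular value decomposition `g = u E k†`: the unitary factors contribute 1, and `E` scales the
coordinate `(i, j)` by `eᵢ eⱼ`, so that each singular value occurs `2N` times. -/
theorem abs_det_cong {g : Mat N} (hg : g.det ≠ 0) :
    |LinearMap.det (cong g)| = ‖g.det‖ ^ (2 * N) := by
  have hpd : (gᴴ * g).PosDef := by
    refine Matrix.PosDef.conjTranspose_mul_self g ?_
    exact Matrix.mulVec_injective_of_isUnit ((Matrix.isUnit_iff_isUnit_det g).2 hg.isUnit)
  set k : UN N := hpd.1.eigenvectorUnitary with hk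
  set d := hpd.1.eigenvalues with hd
  have hdpos : ∀ i, 0 < d i := hpd.eigenvalues_pos
  set e : Fin N → ℝ := fun i => √(d i) with he
  have hepos : ∀ i, 0 < e i := fun i => Real.sqrt_pos.2 (hdpos i)
  have hk1 : (k : Mat N)ᴴ * (k : Mat N) = 1 := Matrix.mem_unitaryGroup_iff'.mp k.2
  have hk2 : (k : Mat N) * (k : Mat N)ᴴ = 1 := Matrix.mem_unitaryGroup_iff.mp k.2
  have hsp : gᴴ * g = (k : Mat N) * Matrix.diagonal (fun i => (d i : ℂ)) * (k : Mat N)ᴴ := by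
    have := hpd.1.spectral_theorem
    rw [Unitary.conjStarAlgAut_apply] at this
    exact this
  set E : Mat N := Matrix.diagonal fun i => (e i : ℂ) with hE
  set E' : Mat N := Matrix.diagonal fun i => ((e i)⁻¹ : ℂ) with hE'
  have hEE : E' * E = 1 := by
    rw [hE, hE', Matrix.diagonal_mul_diagonal, ← Matrix.diagonal_one]
    congr 1; ext i
    rw [inv_mul_cancel₀]; exact_mod_cast (hepos i).ne'
  have hE'h : E'ᴴ = E' := by
    rw [hE', Matrix.diagonal_conjTranspose]; congr 1; ext i; simp
  -- The left unitary factor is `g k E⁻¹`: its Gram matrix is `E⁻¹ (k† g† g k) E⁻¹`, and the middle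
  -- factor is `E²`.
  have hu : (g * k * E') ∈ Matrix.unitaryGroup (Fin N) ℂ := by
    rw [Matrix.mem_unitaryGroup_iff', Matrix.star_eq_conjTranspose, Matrix.conjTranspose_mul,
      Matrix.conjTranspose_mul, hE'h]
    calc _ = E' * ((k : Mat N)ᴴ * (gᴴ * g) * k) * E' := by simp only [Matrix.mul_assoc]
      _ = E' * (((k : Mat N)ᴴ * k) * Matrix.diagonal (fun i => (d i : ℂ)) *
            ((k : Mat N)ᴴ * k)) * E' := by rw [hsp]; simp only [Matrix.mul_assoc]
      _ = 1 := by
        rw [hk1, Matrix.one_mul, Matrix.mul_one, hE', Matrix.diagonal_mul_diagonal,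
          Matrix.diagonal_mul_diagonal, ← Matrix.diagonal_one]
        congr 1; ext i
        have h1 : (e i : ℂ) * e i = d i := by
          rw [← Complex.ofReal_mul, he, Real.mul_self_sqrt (hdpos i).le]
        have h2 : (e i : ℂ) ≠ 0 := by exact_mod_cast (hepos i).ne'
        rw [← h1]; field_simp
  have hg2 : g = (g * k * E') * (E * (k : Mat N)ᴴ) := by
    calc g = g * (k * (k : Mat N)ᴴ) := by rw [hk2, Matrix.mul_one]
      _ = g * k * (E' * E) * (k : Mat N)ᴴ := by rw [hEE]; simp only [Matrix.mul_assoc, Matrix.one_mul]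
      _ = _ := by simp only [Matrix.mul_assoc]
  have hkm : (k : Mat N)ᴴ ∈ Matrix.unitaryGroup (Fin N) ℂ := (star k).2
  have hdetu : ∀ {x : Mat N}, x ∈ Matrix.unitaryGroup (Fin N) ℂ → ‖x.det‖ = 1 := fun hx =>
    CStarRing.norm_of_mem_unitary (Matrix.det_of_mem_unitary hx)
  generalize (g * k * E') = u at hu hg2
  have h1 : |LinearMap.det (cong g)| = (∏ i, e i) ^ (2 * N) := by
    rw [hg2, cong_mul u, cong_mul, LinearMap.det_comp, LinearMap.det_comp, abs_mul, abs_mul,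
      abs_det_cong_unitary hu, abs_det_cong_unitary hkm, one_mul, mul_one, det_cong_diagonal,
      abs_of_nonneg (pow_nonneg (Finset.prod_nonneg fun i _ => (hepos i).le) _)]
  have h2 : ‖g.det‖ = ∏ i, e i := by
    rw [hg2, Matrix.det_mul u, Matrix.det_mul, norm_mul, norm_mul, hdetu hu, hdetu hkm, one_mul,
      mul_one, hE, Matrix.det_diagonal, norm_prod]
    refine Finset.prod_congr rfl fun i _ => ?_
    rw [Complex.norm_real, Real.norm_of_nonneg (hepos i).le]
  rw [h1, h2]

/-! ### Zero sets of polynomials are negligible -/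

/-- A subset of `ℝⁿ` on which a function vanishes that is polynomial on the lines through a point
where it does not vanish is negligible. -/
theorem volume_zeros_eq_zero {ι : Type*} [Fintype ι] (f : (ι → ℝ) → ℂ) (hf : Continuous f)
    (v0 : ι → ℝ) (h0 : f v0 ≠ 0)
    (hp : ∀ v : ι → ℝ, ∃ q : Polynomial ℂ, ∀ s : ℝ, f (v0 + s • v) = q.eval (s : ℂ)) :
    volume {x | f x = 0} = 0 := by
  have hz : MeasurableSet {x | f x = 0} := (isClosed_singleton.preimage hf).measurableSet
  have key : ∀ R : ℝ, volume ({v | f (v0 + v) = 0} ∩ Metric.ball 0 R) = 0 := by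
    intro R
    set Z : Set (ι → ℝ) := {v | f (v0 + v) = 0} ∩ Metric.ball 0 R
    have hZm : MeasurableSet Z :=
      ((isClosed_singleton.preimage (hf.comp (by fun_prop : Continuous fun v => v0 + v))
        ).measurableSet).inter measurableSet_ball
    -- With `v0` as origin, consider the dilates `r n • Z` by infinitely many distinct factors in
    -- `[1, 2]`. Each has at least the volume of `Z`, but a given point lies in only finitely many
    -- of them, because its ray meets the zero set at finitely many parameters. Dominated
    -- convergence sends their volumes to 0.
    set r : ℕ → ℝ := fun n => 1 + 1 / ((n : ℝ) + 1) with hr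
    have hr1 : ∀ n, 1 ≤ r n := fun n => by
      have : 0 ≤ 1 / ((n : ℝ) + 1) := by positivity
      simp only [hr]; linarith
    have hr2 : ∀ n, r n ≤ 2 := fun n => by
      have : 1 / ((n : ℝ) + 1) ≤ 1 := by
        rw [div_le_one (by positivity)]; linarith [(Nat.cast_nonneg n : (0:ℝ) ≤ n)]
      simp only [hr]; linarith
    have hrinj : Function.Injective r := fun a b hab => by
      simp only [hr, add_right_inj, one_div, inv_inj, add_left_inj, Nat.cast_inj] at hab
      exact hab
    set A : ℕ → Set (ι → ℝ) := fun n => (fun v => (r n)⁻¹ • v) ⁻¹' Z with hA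
    have hAm : ∀ n, MeasurableSet (A n) := fun n => (measurable_const_smul _) hZm
    have hle : ∀ n, (volume : Measure (ι → ℝ)) Z ≤ (volume : Measure (ι → ℝ)) (A n) := fun n => by
      have hrn : (r n)⁻¹ ≠ 0 := inv_ne_zero (by linarith [hr1 n])
      rw [hA, Measure.addHaar_preimage_smul (volume : Measure (ι → ℝ)) hrn, inv_pow, inv_inv, abs_of_nonneg
        (by have := hr1 n; positivity)]
      refine le_mul_of_one_le_left' ?_
      rw [ENNReal.one_le_ofReal]
      exact one_le_pow₀ (hr1 n)
    have hlim : Filter.Tendsto (fun n => ∫⁻ x, (A n).indicator 1 x ∂(volume : Measure (ι → ℝ)))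
        Filter.atTop (nhds (∫⁻ _ : ι → ℝ, 0)) := by
      refine tendsto_lintegral_of_dominated_convergence
        ((Metric.ball (0 : ι → ℝ) (2 * R)).indicator 1)
        (fun n => measurable_one.indicator (hAm n)) (fun n => ae_of_all _ fun x => ?_) ?_
        (ae_of_all _ fun x => ?_)
      · refine Set.indicator_le_indicator_of_subset ?_ (fun _ => zero_le) x
        intro y hy
        have h1 : ‖(r n)⁻¹ • y‖ < R := by simpa using hy.2
        have h2 := hr1 n
        rw [norm_smul, norm_inv, Real.norm_of_nonneg (by linarith),
          inv_mul_lt_iff₀ (by linarith)] at h1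
        have h3 : 0 ≤ R := by
          by_contra hR
          nlinarith [norm_nonneg y]
        simp only [Metric.mem_ball, dist_zero_right]
        nlinarith [hr2 n]
      · rw [lintegral_indicator_one measurableSet_ball]
        exact measure_ball_lt_top.ne
      · obtain ⟨q, hq⟩ := hp x
        -- At parameter 0 the polynomial takes the value `f v0`, which is nonzero.
        have hq0 : q ≠ 0 := by
          rintro rfl
          have := hq 0
          simp at this
          exact h0 this
        have hfin : {n | x ∈ A n}.Finite := by
          have : {n | x ∈ A n} ⊆ (fun n => (((r n)⁻¹ : ℝ) : ℂ)) ⁻¹' {z | q.IsRoot z} := by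
            intro n hn
            have h1 : f (v0 + (r n)⁻¹ • x) = 0 := hn.1
            rw [hq] at h1
            exact h1
          refine (Set.Finite.preimage ?_ (Polynomial.finite_setOfPred_isRoot hq0)).subset this
          intro a _ b _ hab
          exact hrinj (inv_injective (Complex.ofReal_injective hab))
        have hev : ∀ᶠ n in Filter.atTop, x ∉ A n := by
          rw [← Nat.cofinite_eq_atTop]
          exact hfin.eventually_cofinite_notMem
        refine tendsto_const_nhds.congr' ?_
        filter_upwards [hev] with n hn
        rw [Set.indicator_of_notMem hn]
    simp only [lintegral_indicator_one (hAm _), lintegral_zero] at hlim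
    exact le_antisymm (ge_of_tendsto' hlim hle) zero_le
  have : {x | f x = 0} = (fun x => -v0 + x) ⁻¹' {v | f (v0 + v) = 0} := by
    ext x; simp
  rw [this, measure_preimage_add]
  have h2 : {v | f (v0 + v) = 0} = ⋃ n : ℕ, {v | f (v0 + v) = 0} ∩ Metric.ball 0 n := by
    rw [← Set.inter_iUnion, Metric.iUnion_ball_nat, Set.inter_univ]
  rw [h2, measure_iUnion_null_iff]
  exact fun n => key n

theorem exists_unitary_diagonalization {x : Mat N} (hx : xᴴ = x) :
    ∃ (k : UN N) (d : Fin N → ℝ),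
      x = (k : Mat N) * Matrix.diagonal (fun i => (d i : ℂ)) * (k : Mat N)ᴴ := by
  have hx' : x.IsHermitian := hx
  refine ⟨hx'.eigenvectorUnitary, hx'.eigenvalues, ?_⟩
  have := hx'.spectral_theorem
  rw [Unitary.conjStarAlgAut_apply] at this
  exact this

theorem coe_conjTranspose_mul_self (k : UN N) : (k : Mat N)ᴴ * (k : Mat N) = 1 :=
  Matrix.mem_unitaryGroup_iff'.mp k.2

theorem coe_mul_conjTranspose_self (k : UN N) : (k : Mat N) * (k : Mat N)ᴴ = 1 :=
  Matrix.mem_unitaryGroup_iff.mp k.2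

theorem norm_det_unitary (k : UN N) : ‖(k : Mat N).det‖ = 1 :=
  CStarRing.norm_of_mem_unitary (Matrix.det_of_mem_unitary k.2)

theorem posDef_conj_diagonal_iff (k : UN N) (d : Fin N → ℝ) :
    ((k : Mat N) * Matrix.diagonal (fun i => (d i : ℂ)) * (k : Mat N)ᴴ).PosDef ↔ ∀ i, 0 < d i := by
  have hu : IsUnit (k : Mat N) :=
    ⟨⟨k, (k : Mat N)ᴴ, coe_mul_conjTranspose_self k, coe_conjTranspose_mul_self k⟩, rfl⟩
  have := Matrix.IsUnit.posDef_star_right_conjugate_iff (x := Matrix.diagonal (fun i => (d i : ℂ))) hu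
  rw [Matrix.star_eq_conjTranspose] at this
  rw [this, Matrix.posDef_diagonal_iff]
  simp

theorem exists_eq_conjTranspose_mul_self {x : Mat N} (hx : x.PosDef) : ∃ g : Mat N, x = gᴴ * g := by
  obtain ⟨k, d, h⟩ := exists_unitary_diagonalization hx.1
  have hd := (posDef_conj_diagonal_iff k d).1 (h ▸ hx)
  refine ⟨Matrix.diagonal (fun i => ((√(d i) : ℝ) : ℂ)) * (k : Mat N)ᴴ, ?_⟩
  rw [Matrix.conjTranspose_mul, Matrix.conjTranspose_conjTranspose,
    Matrix.diagonal_conjTranspose, h]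
  rw [Matrix.mul_assoc, Matrix.mul_assoc, ← Matrix.mul_assoc (Matrix.diagonal _),
    Matrix.diagonal_mul_diagonal, ]
  congr 3; ext i
  simp only [Pi.star_apply, RCLike.star_def, Complex.conj_ofReal]
  rw [← Complex.ofReal_mul, Real.mul_self_sqrt (hd i).le]

/-! ### The Cayley transform and the two Riemannian densities -/

/-- The resolvent `(1 - √(-1) a)⁻¹` of the Hermitian matrix with coordinates `t`. -/
def resolv (N : ℕ) (t : Coord N) : Mat N := (1 - Complex.I • herm N t)⁻¹

theorem isUnit_one_sub (t : Coord N) : IsUnit (1 - Complex.I • herm N t).det :=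
  cayley_aux _ (herm_conjTranspose N t)

theorem resolv_mul (t : Coord N) : resolv N t * (1 - Complex.I • herm N t) = 1 :=
  Matrix.nonsing_inv_mul _ (isUnit_one_sub t)

theorem mul_resolv (t : Coord N) : (1 - Complex.I • herm N t) * resolv N t = 1 :=
  Matrix.mul_nonsing_inv _ (isUnit_one_sub t)

/-- Being affine in the resolvent, the Cayley transform inherits its derivative and its adjoint
relations. -/
theorem cayley_eq (t : Coord N) : cayley N t = (2 : ℝ) • resolv N t - 1 := by
  have h : (1 + Complex.I • herm N t) = (2 : ℝ) • (1 : Mat N) - (1 - Complex.I • herm N t) := by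
    rw [two_smul]; abel
  rw [cayley, h, Matrix.sub_mul]
  change _ - (1 - Complex.I • herm N t) * resolv N t = _
  rw [mul_resolv, Matrix.smul_mul, Matrix.one_mul]
  rfl

theorem det_resolv_ne_zero (t : Coord N) : (resolv N t).det ≠ 0 := by
  intro h
  have := congrArg Matrix.det (resolv_mul t)
  rw [Matrix.det_mul, h, zero_mul, Matrix.det_one] at this
  exact zero_ne_one this

section Calculus
open scoped Matrix.Norms.Operator

theorem hasStrictFDerivAt_herm (t : Coord N) :
    HasStrictFDerivAt (herm N) (LinearMap.toContinuousLinearMap (hermL N)) t :=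
  (LinearMap.toContinuousLinearMap (hermL N)).hasStrictFDerivAt

/-- The linear map `t ↦ a h b`, where `h` is the Hermitian matrix with coordinates `t`. -/
def sandwich (a b : Mat N) : Coord N →L[ℝ] Mat N :=
  LinearMap.toContinuousLinearMap
    ((LinearMap.mulLeft ℝ a).comp ((LinearMap.mulRight ℝ b).comp (hermL N)))

theorem hasStrictFDerivAt_resolv (t : Coord N) :
    HasStrictFDerivAt (resolv N) (sandwich (Complex.I • resolv N t) (resolv N t)) t := by
  have h1 : HasStrictFDerivAt (fun t => 1 - Complex.I • herm N t)
      (-(Complex.I • LinearMap.toContinuousLinearMap (hermL N))) t :=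
    ((hasStrictFDerivAt_herm t).const_smul Complex.I).const_sub 1
  obtain ⟨u, hu⟩ := (Matrix.isUnit_iff_isUnit_det _).2 (isUnit_one_sub t)
  have h2 := hasStrictFDerivAt_ringInverse (𝕜 := ℝ) u
  rw [hu] at h2
  have h3 := h2.comp t h1
  have h4 : ((u⁻¹ : (Mat N)ˣ) : Mat N) = resolv N t := by
    rw [resolv, ← hu, Matrix.coe_units_inv]
  have h5 : resolv N = Ring.inverse ∘ fun t => 1 - Complex.I • herm N t := by
    ext1 t; rw [resolv, Matrix.nonsing_inv_eq_ringInverse]; rfl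
  have h6 : sandwich (Complex.I • resolv N t) (resolv N t) =
      (-((ContinuousLinearMap.mulLeftRight ℝ (Mat N)) ↑u⁻¹) ↑u⁻¹).comp
        (-(Complex.I • LinearMap.toContinuousLinearMap (hermL N))) := by
    refine ContinuousLinearMap.ext fun s => ?_
    change (Complex.I • resolv N t) * (herm N s * resolv N t) =
      -(((u⁻¹ : (Mat N)ˣ) : Mat N) * (-(Complex.I • herm N s)) * ((u⁻¹ : (Mat N)ˣ) : Mat N))
    simp only [h4, Matrix.mul_neg, Matrix.neg_mul, neg_neg, Matrix.mul_smul, Matrix.smul_mul,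
      Matrix.mul_assoc]
  rw [h6, h5]
  exact h3

theorem hasStrictFDerivAt_cayley (t : Coord N) :
    HasStrictFDerivAt (cayley N)
      (sandwich ((2 : ℝ) • Complex.I • resolv N t) (resolv N t)) t := by
  have h1 := ((hasStrictFDerivAt_resolv t).const_smul (2 : ℝ)).sub_const 1
  have h5 : cayley N = fun t => (2 : ℝ) • resolv N t - 1 := by
    ext1 t; exact cayley_eq t
  rw [h5]
  refine h1.congr_fderiv (ContinuousLinearMap.ext fun s => ?_)
  change (2 : ℝ) • ((Complex.I • resolv N t) * (herm N s * resolv N t)) =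
    ((2 : ℝ) • Complex.I • resolv N t) * (herm N s * resolv N t)
  simp only [Matrix.smul_mul]

theorem coordVector_of_hasFDerivAt {φ : Coord N → Mat N} {φ' : Coord N →L[ℝ] Mat N} {t : Coord N}
    (h : HasFDerivAt φ φ' t) (p : Fin N × Fin N) :
    coordVector N φ t p = φ' (Pi.single p 1) := by
  ext i j
  rw [coordVector, Matrix.of_apply]
  have h1 := ((LinearMap.toContinuousLinearMap (Matrix.entryLinearMap ℝ ℂ i j)).hasFDerivAt
    (x := φ t)).comp t h
  exact (h1.hasLineDerivAt (Pi.single p 1)).lineDeriv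

/-- Write `x⁻¹ = g† g`. By cyclicity of the trace the metric is the trace form pulled back by the
congruence of `g`, whose determinant is `|det g|²ᴺ = |det x|⁻ᴺ` in absolute value. -/
theorem volumeDensity_herm {t : Coord N} (ht : (herm N t).PosDef) :
    volumeDensity N (metricH N) (herm N) t = √(detWt N) * (‖(herm N t).det‖ ^ N)⁻¹ := by
  have h1 : ∀ p, coordVector N (herm N) t p = herm N (Pi.single p 1) := fun p => by
    rw [coordVector_of_hasFDerivAt (hasStrictFDerivAt_herm t).hasFDerivAt]; rfl
  obtain ⟨g, hg⟩ := exists_eq_conjTranspose_mul_self ht.inv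
  have h2 : (herm N t).det ≠ 0 := ht.det_pos.ne'
  have h3 : ‖g.det‖ ^ 2 = ‖(herm N t).det‖⁻¹ := by
    have := congrArg (fun x => ‖Matrix.det x‖) hg
    simp only [Matrix.det_mul, Matrix.det_conjTranspose, norm_mul, norm_star,
      Matrix.det_nonsing_inv, Ring.inverse_eq_inv', norm_inv] at this
    rw [sq, this]
  have h4 : g.det ≠ 0 := by
    intro h
    rw [h] at h3
    simp at h3
    exact h2 (norm_eq_zero.1 h3.symm)
  have h5 : (Matrix.of fun p q : Fin N × Fin N => metricH N (herm N t)
      (coordVector N (herm N) t p) (coordVector N (herm N) t q)) =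
      Matrix.of fun p q : Fin N × Fin N =>
      (herm N (cong g (Pi.single p 1)) * herm N (cong g (Pi.single q 1))).trace.re := by
    ext p q
    simp only [Matrix.of_apply, h1, metricH, hg, herm_cong]
    congr 1
    calc _ = (gᴴ * (g * herm N (Pi.single p 1) * (gᴴ * g) * herm N (Pi.single q 1))).trace := by
          simp only [Matrix.mul_assoc]
      _ = _ := by rw [Matrix.trace_mul_comm]; simp only [Matrix.mul_assoc]
  rw [volumeDensity, h5, det_gram, mul_comm, Real.sqrt_mul detWt_pos.le, Real.sqrt_sq_eq_abs,
    abs_det_cong h4, pow_mul, h3, inv_pow]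

/-- Here `dX = 2i Y dH Y` and `X⁻¹ Y = Y†`, so `X⁻¹ dX` is `i` times the Hermitian matrix `2 Y† dH
Y`. The sign in the metric cancels `i²`, and the factor 2 acts on a space of real dimension `N²`. -/
theorem volumeDensity_cayley (t : Coord N) :
    volumeDensity N (metricU N) (cayley N) t =
      √(detWt N) * (2 ^ (N * N) * ‖(resolv N t).det‖ ^ (2 * N)) := by
  set Y := resolv N t with hY
  have h1 : ∀ p, coordVector N (cayley N) t p =
      ((2 : ℝ) • Complex.I • Y) * (herm N (Pi.single p 1) * Y) := fun p => by
    rw [coordVector_of_hasFDerivAt (hasStrictFDerivAt_cayley t).hasFDerivAt]; rfl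
  have hYh : Yᴴ = (1 + Complex.I • herm N t)⁻¹ := by
    rw [hY, resolv, Matrix.conjTranspose_nonsing_inv]
    simp [herm_conjTranspose, sub_eq_add_neg]
  have hu' : IsUnit (1 + Complex.I • herm N t).det := by
    have := cayley_aux (-herm N t) (by rw [Matrix.conjTranspose_neg, herm_conjTranspose])
    simpa using this
  have hinv : (cayley N t)⁻¹ * Y = Yᴴ := by
    rw [cayley, Matrix.mul_inv_rev, Matrix.nonsing_inv_nonsing_inv _ (isUnit_one_sub t), hYh,
      hY, resolv]
    have hc : Commute (1 + Complex.I • herm N t) (1 - Complex.I • herm N t) := by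
      have h2 : Commute (1 : Mat N) (Complex.I • herm N t) := Commute.one_left _
      exact ((Commute.one_right _).add_left h2.symm).sub_right
        ((Commute.one_left _).add_left (Commute.refl _))
    have hc2 : (1 - Complex.I • herm N t) * (1 + Complex.I • herm N t)⁻¹ =
        (1 + Complex.I • herm N t)⁻¹ * (1 - Complex.I • herm N t) := by
      calc _ = (1 + Complex.I • herm N t)⁻¹ * ((1 + Complex.I • herm N t) *
            (1 - Complex.I • herm N t)) * (1 + Complex.I • herm N t)⁻¹ := by
            rw [← Matrix.mul_assoc, Matrix.nonsing_inv_mul _ hu', Matrix.one_mul]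
        _ = _ := by
            rw [hc.eq, Matrix.mul_assoc, Matrix.mul_assoc, Matrix.mul_nonsing_inv _ hu',
              Matrix.mul_one]
    rw [hc2, Matrix.mul_assoc, Matrix.mul_nonsing_inv _ (isUnit_one_sub t), Matrix.mul_one]
  have h4 : (Yᴴ).det ≠ 0 := by
    rw [Matrix.det_conjTranspose, star_ne_zero]; exact det_resolv_ne_zero t
  set L : Coord N →ₗ[ℝ] Coord N := (2 : ℝ) • cong Yᴴ with hL
  have h5 : (Matrix.of fun p q : Fin N × Fin N => metricU N (cayley N t)
      (coordVector N (cayley N) t p) (coordVector N (cayley N) t q)) =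
      Matrix.of fun p q : Fin N × Fin N =>
      (herm N (L (Pi.single p 1)) * herm N (L (Pi.single q 1))).trace.re := by
    ext p q
    have h6 : ∀ p, (cayley N t)⁻¹ * coordVector N (cayley N) t p =
        Complex.I • herm N (L (Pi.single p 1)) := by
      intro p
      rw [h1, hL, LinearMap.smul_apply, herm_smul, herm_cong, Matrix.conjTranspose_conjTranspose]
      simp only [Matrix.smul_mul, Matrix.mul_smul, ← Matrix.mul_assoc]
      rw [hinv, smul_comm]
    simp only [Matrix.of_apply, metricU, h6]
    rw [Matrix.smul_mul, Matrix.mul_smul, smul_smul, Complex.I_mul_I, neg_one_smul,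
      Matrix.trace_neg, Complex.neg_re, neg_neg]
  rw [volumeDensity, h5, det_gram, mul_comm, Real.sqrt_mul detWt_pos.le, Real.sqrt_sq_eq_abs, hL,
    LinearMap.det_smul, abs_mul, abs_det_cong h4, Matrix.det_conjTranspose, norm_star,
    Module.finrank_fintype_fun_eq_card, Fintype.card_prod, Fintype.card_fin, abs_pow, abs_two]

end Calculus

theorem continuous_resolv : Continuous (resolv N) := by
  open scoped Matrix.Norms.Operator in
  exact continuous_iff_continuousAt.2 fun t => (hasStrictFDerivAt_resolv t).continuousAt

theorem continuous_herm : Continuous (herm N) := by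
  open scoped Matrix.Norms.Operator in
  exact continuous_iff_continuousAt.2 fun t => (hasStrictFDerivAt_herm t).continuousAt

theorem continuous_cayley : Continuous (cayley N) := by
  open scoped Matrix.Norms.Operator in
  exact continuous_iff_continuousAt.2 fun t => (hasStrictFDerivAt_cayley t).continuousAt

theorem continuous_toCoord : Continuous (toCoord N) :=
  LinearMap.continuous_of_finiteDimensional _

theorem continuous_cayleyU : Continuous (cayleyU N) :=
  continuous_cayley.subtype_mk _

theorem resolv_conjTranspose (t : Coord N) : (resolv N t)ᴴ = resolv N (-t) := by
  have h : herm N (-t) = -herm N t := by simpa using herm_smul (-1) t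
  rw [resolv, resolv, Matrix.conjTranspose_nonsing_inv, h]
  simp [herm_conjTranspose]

theorem cayley_conjTranspose (t : Coord N) : (cayley N t)ᴴ = cayley N (-t) := by
  rw [cayley_eq, cayley_eq, ← resolv_conjTranspose]
  simp

theorem cayley_mul_conjTranspose (t : Coord N) : cayley N t * (cayley N t)ᴴ = 1 :=
  Matrix.mem_unitaryGroup_iff.mp (cayley_mem N t)

/-- This is `X X† = 1`, expanded for `X = 2Y - 1`. -/
theorem resolv_mul_conjTranspose_add (t : Coord N) :
    resolv N t * (resolv N t)ᴴ + resolv N t * (resolv N t)ᴴ = resolv N t + (resolv N t)ᴴ := by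
  have h := cayley_mul_conjTranspose t
  rw [cayley_eq, Matrix.conjTranspose_sub, Matrix.conjTranspose_smul, Matrix.conjTranspose_one,
    Matrix.sub_mul, Matrix.mul_sub, Matrix.mul_sub, Matrix.smul_mul, Matrix.mul_smul,
    Matrix.mul_one, Matrix.one_mul, Matrix.one_mul] at h
  simp only [star_trivial, two_smul] at h
  generalize resolv N t * (resolv N t)ᴴ = a at *
  generalize resolv N t = b at *
  generalize bᴴ = c at *
  have h2 : (2 : ℝ) • ((a + a) - (b + c)) = 0 := by
    rw [two_smul]
    have : a + a + (a + a) - (b + b) - (c + c - 1) - 1 = 0 := by rw [h, sub_self]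
    rw [← this]; abel
  exact sub_eq_zero.1 ((smul_eq_zero.1 h2).resolve_left two_ne_zero)

/-- `X Y† = Y`, for the Cayley transform `X` and the resolvent `Y`. -/
theorem cayley_mul_resolv_conjTranspose (t : Coord N) :
    cayley N t * (resolv N t)ᴴ = resolv N t := by
  rw [cayley_eq, Matrix.sub_mul, Matrix.smul_mul, two_smul, resolv_mul_conjTranspose_add,
    Matrix.one_mul, add_sub_cancel_right]

theorem resolv_mul_cayley_conjTranspose (t : Coord N) :
    resolv N t * (cayley N t)ᴴ = (resolv N t)ᴴ := by
  rw [cayley_eq, Matrix.conjTranspose_sub, Matrix.conjTranspose_smul, Matrix.mul_sub,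
    Matrix.mul_smul, star_trivial, two_smul, resolv_mul_conjTranspose_add,
    Matrix.conjTranspose_one, Matrix.mul_one, add_sub_cancel_left]

/-! ### The spectral parametrisation and its Jacobian -/

/-- The part of a coordinate vector that lies off the diagonal. -/
def off (N : ℕ) : Coord N →ₗ[ℝ] Coord N where
  toFun t p := if p.1 = p.2 then 0 else t p
  map_add' s t := by ext p; simp only [Pi.add_apply]; split_ifs <;> simp
  map_smul' c t := by ext p; simp only [Pi.smul_apply, RingHom.id_apply]; split_ifs <;> simp

/-- The coordinates of a real diagonal matrix. -/
def dg (N : ℕ) : (Fin N → ℝ) →ₗ[ℝ] Coord N where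
  toFun d p := if p.1 = p.2 then d p.1 else 0
  map_add' s t := by ext p; simp only [Pi.add_apply]; split_ifs <;> simp
  map_smul' c t := by ext p; simp only [Pi.smul_apply, RingHom.id_apply]; split_ifs <;> simp

/-- The diagonal part of a coordinate vector. -/
def dpart (N : ℕ) : Coord N →ₗ[ℝ] (Fin N → ℝ) := LinearMap.funLeft ℝ ℝ fun i => (i, i)

theorem off_apply (t : Coord N) (p) : off N t p = if p.1 = p.2 then 0 else t p := rfl

theorem dg_apply (d : Fin N → ℝ) (p) : dg N d p = if p.1 = p.2 then d p.1 else 0 := rfl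

theorem dpart_apply (t : Coord N) (i) : dpart N t i = t (i, i) := rfl

theorem herm_dg (d : Fin N → ℝ) : herm N (dg N d) = Matrix.diagonal fun i => (d i : ℂ) := by
  ext i j
  simp only [herm, Matrix.of_apply, dg_apply, Matrix.diagonal_apply]
  by_cases h : i = j
  · simp [h]
  · simp [h, Ne.symm h]

/-- The factors of the Jacobian of the spectral parametrisation. -/
def gap (d : Fin N → ℝ) (p : Fin N × Fin N) : ℝ :=
  if p.1 = p.2 then 1 else 2 * (d p.1 - d p.2)

/-- The commutator with a real diagonal matrix, in coordinates. -/
def gapMap (d : Fin N → ℝ) : Coord N →ₗ[ℝ] Coord N :=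
  (Matrix.toLin' (Matrix.diagonal (gap d))).comp (LinearMap.funLeft ℝ ℝ Prod.swap)

theorem gapMap_apply (d : Fin N → ℝ) (s : Coord N) (p) : gapMap d s p = gap d p * s p.swap := by
  rw [gapMap, LinearMap.comp_apply, Matrix.toLin'_apply, Matrix.mulVec_diagonal]
  rfl

theorem abs_det_gapMap (d : Fin N → ℝ) : |LinearMap.det (gapMap d)| = ∏ p, |gap d p| := by
  have h : |LinearMap.det (LinearMap.funLeft ℝ ℝ (Prod.swap : Fin N × Fin N → _))| = 1 := by
    have h1 : (LinearMap.funLeft ℝ ℝ (Prod.swap : Fin N × Fin N → _)).comp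
        (LinearMap.funLeft ℝ ℝ Prod.swap) = LinearMap.id := by
      ext1 s; rfl
    have h2 := congrArg (fun f => |LinearMap.det f|) h1
    simp only [LinearMap.det_comp, LinearMap.det_id, abs_one, abs_mul] at h2
    nlinarith [abs_nonneg (LinearMap.det (LinearMap.funLeft ℝ ℝ (Prod.swap : Fin N × Fin N → _)))]
  rw [gapMap, LinearMap.det_comp, abs_mul, h, mul_one, LinearMap.det_toLin', Matrix.det_diagonal,
    Finset.abs_prod]

/-- The angular factor of the derivative of the spectral parametrisation. -/
def angMap (b : Coord N) : Coord N →ₗ[ℝ] Coord N :=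
  (off N).comp ((cong (resolv N b)ᴴ).comp (off N)) + (dg N).comp (dpart N)

theorem angMap_apply (b s : Coord N) (p) :
    angMap b s p = if p.1 = p.2 then s p else cong (resolv N b)ᴴ (off N s) p := by
  obtain ⟨i, j⟩ := p
  simp only [angMap, LinearMap.add_apply, LinearMap.comp_apply, Pi.add_apply, off_apply, dg_apply,
    dpart_apply]
  split_ifs with h
  · simp [show i = j from h]
  · simp

theorem angMap_zero : angMap (0 : Coord N) = LinearMap.id := by
  refine LinearMap.ext fun s => funext fun p => ?_
  have : herm N 0 = 0 := (hermL N).map_zero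
  rw [angMap_apply, resolv, this]
  simp [cong_one, off_apply]
  tauto

/-- The commutator with a diagonal matrix multiplies the entry `(i, j)` by a difference of
eigenvalues, and the factor `i` exchanges its real and imaginary coordinates; hence the swap in
`gapMap`. The commutator vanishes on the diagonal, which is left free for the variation of the
eigenvalues. -/
theorem herm_gapMap_angMap (d : Fin N → ℝ) (b s : Coord N) :
    herm N (gapMap d (angMap b s)) =
      (2 * Complex.I) • (herm N (cong (resolv N b)ᴴ (off N s)) * herm N (dg N d) -
        herm N (dg N d) * herm N (cong (resolv N b)ᴴ (off N s))) +
      herm N (dg N (dpart N s)) := by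
  generalize hu : cong (resolv N b)ᴴ (off N s) = u
  rw [herm_dg, herm_dg]
  ext i j
  rw [Matrix.add_apply, Matrix.smul_apply, Matrix.sub_apply, Matrix.mul_diagonal,
    Matrix.diagonal_mul, Matrix.diagonal_apply]
  simp only [herm, Matrix.of_apply, gapMap_apply, angMap_apply, hu, gap, Prod.swap, dpart_apply]
  rcases lt_trichotomy i j with h | h | h
  · simp [h.ne, h.ne', h]
    linear_combination (-2 * (u (j, i) : ℂ) * (d j - d i)) * Complex.I_sq
  · subst h; simp [mul_comm]
  · simp [h.ne, h.ne', h.not_gt]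
    linear_combination (2 * (u (i, j) : ℂ) * (d j - d i)) * Complex.I_sq

/-- The left side is the product rule for `X D X†`, with `dX = 2i Y B Y` and `dX† = -2i Y† B Y†`.
The two hypotheses allow `X` and `X†` to be pulled out, leaving a commutator with `D`. -/
theorem spectral_derivative_aux (X Y D B S : Mat N) (e1 : X * Yᴴ = Y) (e2 : Y * Xᴴ = Yᴴ) :
    (X * D) * (((2 : ℝ) • Complex.I • Yᴴ) * (-B * Yᴴ)) +
      (X * S + (((2 : ℝ) • Complex.I • Y) * (B * Y)) * D) * Xᴴ =
    X * ((2 * Complex.I) • (Yᴴ * B * Y * D - D * (Yᴴ * B * Y)) + S) * Xᴴ := by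
  have e3 : X * (Yᴴ * B * Y * D) * Xᴴ = Y * B * Y * D * Xᴴ := by
    simp only [← Matrix.mul_assoc, e1]
  have e4 : X * (D * (Yᴴ * B * Y)) * Xᴴ = X * D * (Yᴴ * B * Yᴴ) := by
    simp only [Matrix.mul_assoc, e2]
  have e5 : ∀ (c : ℂ) (P Q : Mat N), X * (c • (P - Q) + S) * Xᴴ =
      c • (X * P * Xᴴ - X * Q * Xᴴ) + X * S * Xᴴ := fun c P Q => by
    simp only [Matrix.mul_add, Matrix.mul_smul, Matrix.mul_sub, Matrix.add_mul, Matrix.smul_mul,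
      Matrix.sub_mul]
  rw [e5, e3, e4, Matrix.add_mul]
  simp only [Matrix.smul_mul, Matrix.mul_smul, Matrix.neg_mul, Matrix.mul_neg, Matrix.mul_assoc]
  rw [mul_smul, two_smul, two_smul, two_smul]
  simp only [smul_sub]
  abel

/-- The spectral parametrisation of the Hermitian matrices. -/
def specMap (N : ℕ) (t : Coord N) : Coord N := cong (cayley N (off N t)) (dg N (dpart N t))

section Calculus
open scoped Matrix.Norms.Operator

/-- Strict differentiability is what the inverse function theorem asks for; the factored form of the
derivative separates angular variables from eigenvalues. -/
theorem hasStrictFDerivAt_specMap (t : Coord N) :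
    HasStrictFDerivAt (specMap N) (LinearMap.toContinuousLinearMap
      ((cong (cayley N (off N t))).comp
        ((gapMap (dpart N t)).comp (angMap (off N t))))) t := by
  have hoff : HasStrictFDerivAt (off N) (LinearMap.toContinuousLinearMap (off N)) t :=
    (LinearMap.toContinuousLinearMap (off N)).hasStrictFDerivAt
  have hoff' : HasStrictFDerivAt (fun t => -off N t) (-LinearMap.toContinuousLinearMap (off N)) t :=
    hoff.neg
  have hd : HasStrictFDerivAt (fun t => herm N (dg N (dpart N t)))
      (LinearMap.toContinuousLinearMap ((hermL N).comp ((dg N).comp (dpart N)))) t :=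
    (LinearMap.toContinuousLinearMap ((hermL N).comp ((dg N).comp (dpart N)))).hasStrictFDerivAt
  have h1 := (hasStrictFDerivAt_cayley (off N t)).comp t hoff
  have h2 := (hasStrictFDerivAt_cayley (-off N t)).comp t hoff'
  have h3 := (h1.mul' hd).mul' h2
  have h4 := ((LinearMap.toContinuousLinearMap (toCoord N)).hasStrictFDerivAt).comp t h3
  have h5 : specMap N = fun t => toCoord N (cayley N (off N t) * herm N (dg N (dpart N t)) *
      cayley N (-off N t)) := by
    ext1 t
    rw [specMap, cong_apply, cayley_conjTranspose]
  rw [h5]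
  refine h4.congr_fderiv (ContinuousLinearMap.ext fun s => ?_)
  set X := cayley N (off N t) with hX
  set Y := resolv N (off N t) with hY
  set D := herm N (dg N (dpart N t)) with hD
  set B := herm N (off N s) with hB
  have hneg : herm N (-off N s) = -B := by simpa using herm_smul (-1) (off N s)
  change toCoord N ((X * D) * (((2 : ℝ) • Complex.I • resolv N (-off N t)) *
      (herm N (-off N s) * resolv N (-off N t))) +
      (X * herm N (dg N (dpart N s)) + (((2 : ℝ) • Complex.I • Y) * (B * Y)) * D) *
        cayley N (-off N t)) =
    cong X (gapMap (dpart N t) (angMap (off N t) s))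
  rw [cong_apply, herm_gapMap_angMap, herm_cong, ← hY, ← hD, ← hB, hneg, ← resolv_conjTranspose,
    ← cayley_conjTranspose, ← hX, ← hY]
  have e1 : X * Yᴴ = Y := cayley_mul_resolv_conjTranspose _
  have e2 : Y * Xᴴ = Yᴴ := resolv_mul_cayley_conjTranspose _
  refine congrArg (toCoord N) ?_
  rw [Matrix.conjTranspose_conjTranspose]
  generalize herm N (dg N (dpart N s)) = S
  clear_value X Y D B
  clear h1 h2 h3 h4
  exact spectral_derivative_aux X Y D B S e1 e2

end Calculus

theorem abs_det_specMap (t : Coord N) :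
    |(LinearMap.toContinuousLinearMap ((cong (cayley N (off N t))).comp
        ((gapMap (dpart N t)).comp (angMap (off N t))))).det| =
      |LinearMap.det (angMap (off N t))| * ∏ p, |gap (dpart N t) p| := by
  rw [ContinuousLinearMap.det, LinearMap.coe_toContinuousLinearMap, LinearMap.det_comp,
    LinearMap.det_comp, abs_mul, abs_mul, abs_det_cong_unitary (cayley_mem _ _), abs_det_gapMap,
    one_mul, mul_comm]

/-- Compactness makes the Haar measure of `U(N)` finite, as the averaging argument for Weyl's
formula requires. -/
theorem compactSpace_UN (N : ℕ) : CompactSpace (UN N) := by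
  have hc : IsCompact (Set.univ.pi fun _ => Set.univ.pi fun _ => Metric.closedBall (0 : ℂ) 1 :
      Set (Fin N → Fin N → ℂ)) :=
    isCompact_univ_pi fun _ => isCompact_univ_pi fun _ => isCompact_closedBall _ _
  have hcl : IsClosed (Matrix.unitaryGroup (Fin N) ℂ : Set (Mat N)) := isClosed_unitary
  refine isCompact_iff_compactSpace.1 (hc.of_isClosed_subset hcl fun x hx => ?_)
  intro i _ j _
  simpa using entry_norm_bound_of_unitary hx i j

attribute [local instance] compactSpace_UN

/-! ### Injectivity of the spectral parametrisation on a tube -/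

theorem off_dg (d : Fin N → ℝ) : off N (dg N d) = 0 := by
  ext p; simp only [off_apply, dg_apply]; split_ifs <;> simp

theorem off_off (t : Coord N) : off N (off N t) = off N t := by
  ext p; simp only [off_apply]; split_ifs <;> simp

theorem dpart_dg (d : Fin N → ℝ) : dpart N (dg N d) = d := by
  ext p; simp [dpart_apply, dg_apply]

theorem dpart_off (t : Coord N) : dpart N (off N t) = 0 := by
  ext p; simp [dpart_apply, off_apply]

theorem off_add_dg_dpart (t : Coord N) : off N t + dg N (dpart N t) = t := by
  ext ⟨i, j⟩
  simp only [Pi.add_apply, off_apply, dg_apply, dpart_apply]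
  split_ifs with h
  · simp [show i = j from h]
  · simp

/-- The diagonal matrix with diagonal `0, 1, 2, …`. -/
def diagIdx (N : ℕ) : Fin N → ℝ := fun i => (i : ℕ)

theorem diagIdx_strictMono : StrictMono (diagIdx N) := fun i j h => by
  simpa [diagIdx] using h

theorem gap_ne_zero {d : Fin N → ℝ} (hd : Function.Injective d) (p) : gap d p ≠ 0 := by
  unfold gap
  split_ifs with h
  · exact one_ne_zero
  · exact mul_ne_zero two_ne_zero (sub_ne_zero.2 fun h' => h (hd h'))

/-- Inverse function theorem at a single diagonal matrix with distinct entries, where the Jacobian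
is the nonzero product of the gaps. Other spectra are brought back to this one by
`cong_eq_iff_isDiag`. -/
theorem exists_injOn_specMap_fibre :
    ∃ ε > 0, ∀ b b' : Coord N, ‖off N b‖ < ε → ‖off N b'‖ < ε →
      specMap N (off N b + dg N (diagIdx N)) = specMap N (off N b' + dg N (diagIdx N)) →
      off N b = off N b' := by
  set t0 := dg N (diagIdx N) with ht0
  have h := hasStrictFDerivAt_specMap t0
  have hdet : (LinearMap.toContinuousLinearMap ((cong (cayley N (off N t0))).comp
        ((gapMap (dpart N t0)).comp (angMap (off N t0))))).det ≠ 0 := by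
    rw [← abs_ne_zero, abs_det_specMap, ht0, off_dg, dpart_dg, angMap_zero, LinearMap.det_id,
      abs_one, one_mul]
    exact Finset.prod_ne_zero_iff.2 fun p _ =>
      abs_ne_zero.2 (gap_ne_zero diagIdx_strictMono.injective p)
  rw [← ContinuousLinearMap.coe_toContinuousLinearEquivOfDetNeZero _ hdet] at h
  have hmem := (h.toOpenPartialHomeomorph _).open_source.mem_nhds h.mem_toOpenPartialHomeomorph_source
  obtain ⟨ε, hε, hb⟩ := Metric.mem_nhds_iff.1 hmem
  refine ⟨ε, hε, fun b b' h1 h2 he => ?_⟩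
  have := (h.toOpenPartialHomeomorph _).injOn (hb (a := off N b + t0) (by simpa using h1))
    (hb (a := off N b' + t0) (by simpa using h2)) he
  exact add_right_cancel this

theorem commute_diagonal {Z : Mat N} {d : Fin N → ℝ} (hd : Function.Injective d)
    (h : Z * herm N (dg N d) = herm N (dg N d) * Z) {i j : Fin N} (hij : i ≠ j) : Z i j = 0 := by
  have h1 := congrFun (congrFun h i) j
  rw [herm_dg, Matrix.mul_diagonal, Matrix.diagonal_mul, mul_comm, ← sub_eq_zero, ← sub_mul] at h1
  refine (mul_eq_zero.1 h1).resolve_left ?_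
  rw [← Complex.ofReal_sub, Complex.ofReal_eq_zero]
  exact sub_ne_zero.2 fun h' => hij (hd h').symm

theorem isDiag_mul_comm {Z : Mat N} (h : Z.IsDiag) (e : Fin N → ℝ) :
    Z * herm N (dg N e) = herm N (dg N e) * Z := by
  ext i j
  rw [herm_dg, Matrix.mul_diagonal, Matrix.diagonal_mul]
  by_cases hij : i = j
  · subst hij; ring
  · rw [h hij]; simp

theorem cong_unitary_eq_iff (k k' : UN N) (s t : Coord N) :
    cong (k : Mat N) s = cong (k' : Mat N) t ↔
      ((k'⁻¹ * k : UN N) : Mat N) * herm N s = herm N t * ((k'⁻¹ * k : UN N) : Mat N) := by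
  rw [← herm_injective.eq_iff, herm_cong, herm_cong]
  have h1 : ((k'⁻¹ * k : UN N) : Mat N) = (k' : Mat N)ᴴ * k := rfl
  rw [h1]
  constructor
  · intro h
    calc _ = (k' : Mat N)ᴴ * (k * herm N s * (k : Mat N)ᴴ) * k := by
          simp only [Matrix.mul_assoc, coe_conjTranspose_mul_self, Matrix.mul_one]
      _ = ((k' : Mat N)ᴴ * k') * herm N t * ((k' : Mat N)ᴴ * k) := by
          rw [h]; simp only [Matrix.mul_assoc]
      _ = _ := by rw [coe_conjTranspose_mul_self, Matrix.one_mul]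
  · intro h
    calc _ = (k' : Mat N) * (((k' : Mat N)ᴴ * k) * herm N s) * (k : Mat N)ᴴ := by
          simp only [← Matrix.mul_assoc, coe_mul_conjTranspose_self, Matrix.one_mul]
      _ = _ := by
        rw [h]; simp only [Matrix.mul_assoc, coe_mul_conjTranspose_self, Matrix.mul_one]

/-- The stabiliser of a diagonal matrix with distinct entries is the group of diagonal unitary
matrices. The right side does not involve `d`, so coincidences of frames transfer from one simple
spectrum to any other. -/
theorem cong_eq_iff_isDiag {d : Fin N → ℝ} (hd : Function.Injective d) (k k' : UN N) :
    cong (k : Mat N) (dg N d) = cong (k' : Mat N) (dg N d) ↔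
      ((k'⁻¹ * k : UN N) : Mat N).IsDiag := by
  rw [cong_unitary_eq_iff]
  exact ⟨fun h i j hij => commute_diagonal hd h hij, fun h => isDiag_mul_comm h d⟩

theorem charpoly_cong_dg (k : UN N) (d : Fin N → ℝ) :
    (herm N (cong (k : Mat N) (dg N d))).charpoly =
      ∏ i, (Polynomial.X - Polynomial.C (d i : ℂ)) := by
  rw [herm_cong, Matrix.charpoly_mul_comm, ← Matrix.mul_assoc, coe_conjTranspose_mul_self,
    Matrix.one_mul, herm_dg, Matrix.charpoly_diagonal]

theorem range_eq_of_cong_eq {k k' : UN N} {d d' : Fin N → ℝ}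
    (h : cong (k : Mat N) (dg N d) = cong (k' : Mat N) (dg N d')) : Set.range d = Set.range d' := by
  have h1 := charpoly_cong_dg k d
  rw [h, charpoly_cong_dg] at h1
  ext x
  have h2 := congrArg (fun p => Polynomial.eval (x : ℂ) p = 0) h1
  simp only [Polynomial.eval_prod, Polynomial.eval_sub, Polynomial.eval_X, Polynomial.eval_C,
    Finset.prod_eq_zero_iff, Finset.mem_univ, true_and, sub_eq_zero, Complex.ofReal_inj] at h2
  simp only [Set.mem_range, eq_comm (b := x)]
  exact (iff_of_eq h2).symm

theorem dg_eq_of_cong_eq {k k' : UN N} {d d' : Fin N → ℝ} (hd : StrictMono d) (hd' : StrictMono d')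
    (h : cong (k : Mat N) (dg N d) = cong (k' : Mat N) (dg N d')) : d = d' :=
  (StrictMono.range_inj hd hd').1 (range_eq_of_cong_eq h)

theorem exists_unitary_perm (σ : Equiv.Perm (Fin N)) (d : Fin N → ℝ) :
    ∃ k : UN N, dg N (d ∘ σ) = cong (k : Mat N) (dg N d) := by
  set P : Mat N := Matrix.of fun i j => if j = σ i then 1 else 0 with hP
  have hPP : P * Pᴴ = 1 := by
    ext i j
    simp [hP, Matrix.mul_apply, Matrix.one_apply, eq_comm]
  refine ⟨⟨P, Matrix.mem_unitaryGroup_iff.2 hPP⟩, herm_injective ?_⟩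
  rw [herm_cong, herm_dg, herm_dg]
  ext i j
  by_cases h : i = j
  · simp [hP, Matrix.mul_apply, Matrix.diagonal_apply, h]
  · simp [hP, Matrix.mul_apply, Matrix.diagonal_apply, h, Ne.symm h]

theorem exists_cong_dg (t : Coord N) : ∃ (k : UN N) (d : Fin N → ℝ), t = cong (k : Mat N) (dg N d) := by
  obtain ⟨k, d, h⟩ := exists_unitary_diagonalization (herm_conjTranspose N t)
  exact ⟨k, d, herm_injective (by rw [herm_cong, herm_dg]; exact h)⟩

/-- The spectral parametrisation is used on this set. -/
def specSet (N : ℕ) (ε : ℝ) : Set (Coord N) := {t | ‖off N t‖ < ε ∧ StrictMono (dpart N t)}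

theorem measurableSet_strictMono : MeasurableSet {d : Fin N → ℝ | StrictMono d} := by
  have : {d : Fin N → ℝ | StrictMono d} = ⋂ i, ⋂ j, {d | i < j → d i < d j} := by
    ext d; simp [StrictMono]
  rw [this]
  refine MeasurableSet.iInter fun i => MeasurableSet.iInter fun j => ?_
  by_cases h : i < j
  · simp only [h, true_imp_iff]
    exact measurableSet_lt (measurable_pi_apply i) (measurable_pi_apply j)
  · simp [h]

theorem continuous_off : Continuous (off N) := LinearMap.continuous_of_finiteDimensional _
theorem continuous_dpart : Continuous (dpart N) := LinearMap.continuous_of_finiteDimensional _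
theorem continuous_dg : Continuous (dg N) := LinearMap.continuous_of_finiteDimensional _

theorem measurableSet_specSet (ε : ℝ) : MeasurableSet (specSet N ε) :=
  (measurableSet_lt (continuous_off.norm.measurable) measurable_const).inter
    (continuous_dpart.measurable measurableSet_strictMono)

theorem specMap_eq (t : Coord N) :
    specMap N t = cong (cayleyU N (off N t) : Mat N) (dg N (dpart N t)) := rfl

/-- Equal images have equal ordered spectra. The coincidence of the frames is then independent of
the spectrum, and is tested at `diagIdx`; this is why one `ε` serves all spectra. -/
theorem exists_injOn_specMap : ∃ ε > 0, ∀ δ ≤ ε, Set.InjOn (specMap N) (specSet N δ) := by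
  obtain ⟨ε, hε, h⟩ := exists_injOn_specMap_fibre (N := N)
  refine ⟨ε, hε, fun δ hδ t ht t' ht' he => ?_⟩
  rw [specMap_eq, specMap_eq] at he
  have h1 := dg_eq_of_cong_eq ht.2 ht'.2 he
  rw [← h1, cong_eq_iff_isDiag ht.2.injective, ← cong_eq_iff_isDiag diagIdx_strictMono.injective]
    at he
  have h2 := h t t' (ht.1.trans_le hδ) (ht'.1.trans_le hδ) (by
    rw [specMap_eq, specMap_eq]
    simp only [map_add, off_off, off_dg, dpart_off, dpart_dg, add_zero, zero_add]
    exact he)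
  rw [← off_add_dg_dpart t, ← off_add_dg_dpart t', h1, h2]

/-! ### Simple spectrum -/

/-- The discriminant of the characteristic polynomial, as a polynomial in the matrix entries. -/
def discrim (N : ℕ) (t : Coord N) : ℂ :=
  (Matrix.of fun i j : Fin N => (herm N t ^ (i + j : ℕ)).trace).det

theorem herm_cong_dg_pow (k : UN N) (d : Fin N → ℝ) (m : ℕ) :
    herm N (cong (k : Mat N) (dg N d)) ^ m =
      (k : Mat N) * Matrix.diagonal (fun i => (d i : ℂ) ^ m) * (k : Mat N)ᴴ := by
    induction m with
    | zero => simp [coe_mul_conjTranspose_self]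
    | succ m ih =>
      rw [pow_succ, ih, herm_cong, herm_dg]
      calc _ = (k : Mat N) * (Matrix.diagonal (fun i => (d i : ℂ) ^ m) *
            ((k : Mat N)ᴴ * (k : Mat N)) * Matrix.diagonal (fun i => (d i : ℂ))) * (k : Mat N)ᴴ := by
            simp only [Matrix.mul_assoc]
        _ = _ := by
          rw [coe_conjTranspose_mul_self, Matrix.mul_one, Matrix.diagonal_mul_diagonal]
          simp only [pow_succ]

theorem trace_herm_cong_dg_pow (k : UN N) (d : Fin N → ℝ) (m : ℕ) :
    (herm N (cong (k : Mat N) (dg N d)) ^ m).trace = ∑ i, (d i : ℂ) ^ m := by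
  rw [herm_cong_dg_pow, Matrix.trace_mul_comm, ← Matrix.mul_assoc, coe_conjTranspose_mul_self,
    Matrix.one_mul, Matrix.trace_diagonal]

/-- The Hankel matrix of the power sums is `Vᵀ V`, where `V` is the Vandermonde matrix of the
eigenvalues. -/
theorem discrim_cong_dg (k : UN N) (d : Fin N → ℝ) :
    discrim N (cong (k : Mat N) (dg N d)) =
      (Matrix.vandermonde fun i => (d i : ℂ)).det ^ 2 := by
  have h2 : (Matrix.of fun i j : Fin N =>
      (herm N (cong (k : Mat N) (dg N d)) ^ (i + j : ℕ)).trace) =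
      (Matrix.vandermonde fun i => (d i : ℂ))ᵀ * Matrix.vandermonde fun i => (d i : ℂ) := by
    ext i j
    rw [Matrix.of_apply, trace_herm_cong_dg_pow, Matrix.mul_apply]
    simp [Matrix.vandermonde, pow_add]
  rw [discrim, h2, Matrix.det_mul, Matrix.det_transpose, sq]

theorem continuous_discrim : Continuous (discrim N) := by
  unfold discrim
  refine Continuous.matrix_det (continuous_matrix fun i j => ?_)
  exact (continuous_herm.pow _).matrix_trace

theorem volume_discrim_eq_zero : volume {t : Coord N | discrim N t = 0} = 0 := by
  refine volume_zeros_eq_zero _ continuous_discrim (dg N (diagIdx N)) ?_ fun v => ?_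
  · have : dg N (diagIdx N) = cong ((1 : UN N) : Mat N) (dg N (diagIdx N)) := by
      rw [OneMemClass.coe_one, cong_one]; rfl
    rw [this, discrim_cong_dg]
    refine pow_ne_zero _ (Matrix.det_vandermonde_ne_zero_iff.2 ?_)
    exact Complex.ofReal_injective.comp diagIdx_strictMono.injective
  -- On a line, the discriminant is the value of the same determinant formed over the polynomial
  -- ring.
  · set H : Matrix (Fin N) (Fin N) (Polynomial ℂ) :=
      (herm N (dg N (diagIdx N))).map Polynomial.C +
        (Polynomial.X : Polynomial ℂ) • (herm N v).map Polynomial.C with hH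
    refine ⟨(Matrix.of fun i j : Fin N => (H ^ (i + j : ℕ)).trace).det, fun s => ?_⟩
    have h1 : (Polynomial.evalRingHom (s : ℂ)).mapMatrix H =
        herm N (dg N (diagIdx N) + s • v) := by
      rw [herm_add, herm_smul]
      ext i j
      simp [hH]
      ring
    rw [← Polynomial.coe_evalRingHom, RingHom.map_det, discrim]
    congr 1
    ext i j
    rw [Matrix.of_apply, ← h1, ← map_pow, RingHom.mapMatrix_apply, RingHom.mapMatrix_apply,
      Matrix.map_apply, Matrix.of_apply, AddMonoidHom.map_trace]

/-- A nonzero discriminant means distinct eigenvalues, and a permutation matrix puts them in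
increasing order. -/
theorem ae_exists_injective :
    ∀ᵐ t : Coord N, ∃ (k : UN N) (d : Fin N → ℝ), StrictMono d ∧ t = cong (k : Mat N) (dg N d) := by
  have h : ∀ᵐ t : Coord N, discrim N t ≠ 0 := by
    rw [ae_iff]; simpa using volume_discrim_eq_zero
  filter_upwards [h] with t ht
  obtain ⟨k, d, rfl⟩ := exists_cong_dg t
  have hd : Function.Injective d := by
    rw [discrim_cong_dg] at ht
    have := Matrix.det_vandermonde_ne_zero_iff.1 (pow_ne_zero_iff two_ne_zero |>.1 ht)
    exact fun i j hij => this (by simp [hij])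
  obtain ⟨k', hk'⟩ := exists_unitary_perm (Tuple.sort d)⁻¹ (d ∘ Tuple.sort d)
  refine ⟨k * k', d ∘ Tuple.sort d,
    (Tuple.monotone_sort d).strictMono_of_injective (hd.comp (Tuple.sort d).injective), ?_⟩
  rw [Submonoid.coe_mul, cong_mul, LinearMap.comp_apply, ← hk']
  congr 2
  ext i; simp

/-! ### Splitting off the diagonal coordinates -/

/-- The diagonal of `Fin N × Fin N`. -/
def diagEquiv (N : ℕ) : Fin N ≃ {p : Fin N × Fin N // p.1 = p.2} where
  toFun i := ⟨(i, i), rfl⟩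
  invFun p := p.1.1
  left_inv i := rfl
  right_inv p := by
    obtain ⟨⟨i, j⟩, h⟩ := p
    simp only at h
    subst h; rfl

/-- Extension by zero from the off-diagonal coordinates. -/
def offExt (N : ℕ) (y : {p : Fin N × Fin N // ¬ p.1 = p.2} → ℝ) : Coord N :=
  fun p => if h : p.1 = p.2 then 0 else y ⟨p, h⟩

theorem continuous_offExt : Continuous (offExt N) := by
  refine continuous_pi fun p => ?_
  unfold offExt
  by_cases h : p.1 = p.2
  · simp only [h, dite_true]; exact continuous_const
  · simp only [h, dite_false]; exact continuous_apply _

theorem lintegral_off_mul_dpart {a : Coord N → ENNReal} {e : (Fin N → ℝ) → ENNReal}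
    (ha : Measurable a) (he : Measurable e) :
    ∫⁻ t, a (off N t) * e (dpart N t) = (∫⁻ y, a (offExt N y)) * ∫⁻ d, e d := by
  have h1 := (volume_preserving_piEquivPiSubtypeProd (fun _ : Fin N × Fin N => ℝ)
    (fun p => p.1 = p.2))
  have h2 := volume_measurePreserving_piCongrLeft (fun _ : {p : Fin N × Fin N // p.1 = p.2} => ℝ)
    (diagEquiv N)
  have h3 : ∫⁻ d, e d = ∫⁻ x : {p : Fin N × Fin N // p.1 = p.2} → ℝ, e (x ∘ diagEquiv N) := by
    have := h2.symm.lintegral_comp he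
    rw [← this]; rfl
  have h4 : ∫⁻ t, a (off N t) * e (dpart N t) =
      ∫⁻ z : ({p : Fin N × Fin N // p.1 = p.2} → ℝ) × ({p : Fin N × Fin N // ¬ p.1 = p.2} → ℝ),
        e (z.1 ∘ diagEquiv N) * a (offExt N z.2) := by
    rw [← h1.lintegral_comp]
    · refine lintegral_congr fun t => ?_
      rw [mul_comm]
      rfl
    · refine Measurable.mul (he.comp ?_) (ha.comp ?_)
      · exact measurable_pi_lambda _ fun i => (measurable_pi_apply _).comp measurable_fst
      · exact continuous_offExt.measurable.comp measurable_snd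
  rw [h4, h3, Measure.volume_eq_prod, mul_comm]
  have he' : Measurable fun x : {p : Fin N × Fin N // p.1 = p.2} → ℝ => e (x ∘ diagEquiv N) :=
    he.comp (measurable_pi_lambda _ fun i => measurable_pi_apply _)
  exact lintegral_prod_mul (μ := volume) (ν := volume) he'.aemeasurable
    (ha.comp continuous_offExt.measurable).aemeasurable

theorem continuous_det_angMap : Continuous fun b : Coord N => LinearMap.det (angMap b) := by
  simp only [← LinearMap.det_toMatrix']
  refine Continuous.matrix_det (continuous_matrix fun p q => ?_)
  simp only [LinearMap.toMatrix'_apply, angMap_apply]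
  by_cases h : p.1 = p.2
  · simp only [h, if_true]; exact continuous_const
  · simp only [h, if_false, cong_apply, Matrix.conjTranspose_conjTranspose]
    refine (continuous_apply p).comp (continuous_toCoord.comp ?_)
    have := continuous_resolv (N := N)
    exact ((this.matrix_conjTranspose).matrix_mul continuous_const).matrix_mul this

/-- The angular part of the volume of a tube in the spectral parametrisation. -/
def tubeConst (N : ℕ) (ε : ℝ) : ENNReal :=
  ∫⁻ y, {b : Coord N | ‖b‖ < ε}.indicator
    (fun b => ENNReal.ofReal |LinearMap.det (angMap b)|) (offExt N y)

/-- The angular map is the identity at 0, so on a small ball its determinant stays between 1/2 and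
2. The tube constant then lies between positive finite multiples of the volume of a bounded nonempty
open set. -/
theorem exists_tubeConst {ε : ℝ} (hε : 0 < ε) :
    ∃ δ > 0, δ ≤ ε ∧ tubeConst N δ ≠ 0 ∧ tubeConst N δ ≠ ⊤ := by
  have h1 : ∀ᶠ b in nhds (0 : Coord N), |LinearMap.det (angMap b)| ∈ Set.Ioo (1 / 2 : ℝ) 2 := by
    refine (continuous_det_angMap.abs.tendsto 0).eventually (isOpen_Ioo.mem_nhds ?_)
    rw [angMap_zero, LinearMap.det_id]; norm_num
  obtain ⟨δ, hδ, hb⟩ := Metric.eventually_nhds_iff.1 h1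
  have hδ' : 0 < min δ ε := lt_min hδ hε
  set U : Set ({p : Fin N × Fin N // ¬ p.1 = p.2} → ℝ) := {y | ‖offExt N y‖ < min δ ε} with hU
  have hUo : IsOpen U := isOpen_lt continuous_offExt.norm continuous_const
  have hUne : U.Nonempty := ⟨0, by
    have : offExt N 0 = 0 := by ext p; simp [offExt]
    simpa [hU, this] using ⟨hδ, hε⟩⟩
  have hUb : volume U < ⊤ := by
    refine (measure_mono (t := Metric.ball 0 (min δ ε)) fun y hy => ?_).trans_lt measure_ball_lt_top
    rw [mem_ball_zero_iff, pi_norm_lt_iff hδ']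
    rintro ⟨p, hp⟩
    have := (pi_norm_lt_iff hδ').1 hy p
    simpa [offExt, hp] using this
  have hle : ∀ y, U.indicator (fun _ => ENNReal.ofReal (1 / 2)) y ≤
      {b : Coord N | ‖b‖ < min δ ε}.indicator
        (fun b => ENNReal.ofReal |LinearMap.det (angMap b)|) (offExt N y) := by
    intro y
    by_cases hy : y ∈ U
    · have hy' : offExt N y ∈ {b : Coord N | ‖b‖ < min δ ε} := hy
      rw [Set.indicator_of_mem hy, Set.indicator_of_mem hy']
      exact ENNReal.ofReal_le_ofReal
        (hb (by simpa using lt_of_lt_of_le hy (min_le_left _ _))).1.le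
    · rw [Set.indicator_of_notMem hy]; exact zero_le
  have hle' : ∀ y, {b : Coord N | ‖b‖ < min δ ε}.indicator
        (fun b => ENNReal.ofReal |LinearMap.det (angMap b)|) (offExt N y) ≤
      U.indicator (fun _ => ENNReal.ofReal 2) y := by
    intro y
    by_cases hy : y ∈ U
    · have hy' : offExt N y ∈ {b : Coord N | ‖b‖ < min δ ε} := hy
      rw [Set.indicator_of_mem hy, Set.indicator_of_mem hy']
      exact ENNReal.ofReal_le_ofReal
        (hb (by simpa using lt_of_lt_of_le hy (min_le_left _ _))).2.le
    · have hy' : offExt N y ∉ {b : Coord N | ‖b‖ < min δ ε} := hy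
      rw [Set.indicator_of_notMem hy']; exact zero_le
  refine ⟨min δ ε, hδ', min_le_right _ _, ?_, ?_⟩
  · have := lintegral_mono (μ := volume) hle
    rw [lintegral_indicator_const hUo.measurableSet] at this
    refine fun h0 => ?_
    have h2 : 0 < ENNReal.ofReal (1 / 2) * volume U :=
      ENNReal.mul_pos (by simp) (hUo.measure_pos _ hUne).ne'
    exact absurd (this.trans h0.le) h2.not_ge
  · have := lintegral_mono (μ := volume) hle'
    rw [lintegral_indicator_const hUo.measurableSet] at this
    exact (this.trans_lt (ENNReal.mul_lt_top ENNReal.ofReal_lt_top hUb)).ne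

/-- The Weyl density. -/
def weylDensity (d : Fin N → ℝ) : ENNReal := ENNReal.ofReal (∏ p, |gap d p|)

theorem measurable_weylDensity : Measurable (weylDensity : (Fin N → ℝ) → ENNReal) := by
  refine Measurable.ennreal_ofReal (Finset.measurable_prod _ fun p _ => ?_)
  unfold gap
  split_ifs
  · exact measurable_const
  · fun_prop

/-- Change of variables: the Jacobian is a product, and an invariant `F` does not see the angular
variable, so the integral factorises. -/
theorem lintegral_specMap_image {ε : ℝ} (hinj : Set.InjOn (specMap N) (specSet N ε))
    {F : Coord N → ENNReal} (hF : Measurable F)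
    (hinv : ∀ (k : UN N) t, F (cong (k : Mat N) t) = F t) :
    ∫⁻ t in specMap N '' specSet N ε, F t =
      tubeConst N ε * ∫⁻ d in {d : Fin N → ℝ | StrictMono d}, weylDensity d * F (dg N d) := by
  rw [lintegral_image_eq_lintegral_abs_det_fderiv_mul volume (measurableSet_specSet ε)
    (fun t _ => (hasStrictFDerivAt_specMap t).hasFDerivAt.hasFDerivWithinAt) hinj,
    ← lintegral_indicator (measurableSet_specSet ε),
    ← lintegral_indicator measurableSet_strictMono, tubeConst, ← lintegral_off_mul_dpart]
  · refine lintegral_congr fun t => ?_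
    simp only [Set.indicator, specSet, Set.mem_ofPred_eq, abs_det_specMap]
    by_cases h1 : ‖off N t‖ < ε
    · by_cases h2 : StrictMono (dpart N t)
      · simp only [h1, h2, and_self, if_true]
        rw [specMap_eq, hinv, ENNReal.ofReal_mul (abs_nonneg _), mul_assoc]
        rfl
      · simp [h1, h2]
    · simp [h1]
  · refine Measurable.indicator ?_ (measurableSet_lt measurable_norm measurable_const)
    exact (continuous_det_angMap.abs.measurable).ennreal_ofReal
  · exact (measurable_weylDensity.mul (hF.comp continuous_dg.measurable)).indicator
      measurableSet_strictMono

/-! ### Averaging over the unitary group -/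

theorem continuous_cong_apply :
    Continuous fun z : UN N × Coord N => cong (star z.1 : Mat N) z.2 := by
  have h1 : Continuous fun z : UN N × Coord N => (z.1 : Mat N) :=
    continuous_subtype_val.comp continuous_fst
  have h2 : Continuous fun z : UN N × Coord N => herm N z.2 := continuous_herm.comp continuous_snd
  exact continuous_toCoord.comp
    ((h1.matrix_conjTranspose.matrix_mul h2).matrix_mul h1.matrix_conjTranspose.matrix_conjTranspose)

theorem map_cong_unitary (k : UN N) : (volume : Measure (Coord N)).map (cong (k : Mat N)) = volume := by
  have h := abs_det_cong_unitary k.2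
  have h0 : LinearMap.det (cong (k : Mat N)) ≠ 0 := by
    intro h'; rw [h', abs_zero] at h; exact zero_ne_one h
  rw [Measure.map_linearMap_addHaar_eq_smul_addHaar volume h0, abs_inv, h, inv_one,
    ENNReal.ofReal_one, one_smul]

theorem measurePreserving_cong (k : UN N) :
    MeasurePreserving (cong (k : Mat N)) (volume : Measure (Coord N)) volume :=
  ⟨(LinearMap.continuous_of_finiteDimensional _).measurable, map_cong_unitary k⟩

/-- The Haar measure of the set of rotations that bring `h` into `A`. -/
def rotMeasure (N : ℕ) (A : Set (Coord N)) (h : Coord N) : ENNReal :=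
  (Measure.haar : Measure (UN N)) {g | cong (star g : Mat N) h ∈ A}

/-- For a simple spectrum, whether a conjugate of the diagonal matrix lies in the image of the tube
depends on the frame alone, modulo diagonal unitaries. Left invariance of the Haar measure then
removes `k`. -/
theorem rotMeasure_specMap {d d' : Fin N → ℝ} (hd : StrictMono d) (hd' : StrictMono d')
    (k k' : UN N) (ε : ℝ) :
    rotMeasure N (specMap N '' specSet N ε) (cong (k : Mat N) (dg N d)) =
      rotMeasure N (specMap N '' specSet N ε) (cong (k' : Mat N) (dg N d')) := by
  have h1 : ∀ {d : Fin N → ℝ}, StrictMono d → ∀ g : UN N,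
      cong (g : Mat N) (dg N d) ∈ specMap N '' specSet N ε ↔
      ∃ b : Coord N, ‖off N b‖ < ε ∧ (((cayleyU N (off N b))⁻¹ * g : UN N) : Mat N).IsDiag := by
    intro d hd g
    constructor
    · rintro ⟨t, ht, h⟩
      rw [specMap_eq] at h
      have h2 := dg_eq_of_cong_eq ht.2 hd h
      rw [h2] at h
      exact ⟨t, ht.1, (cong_eq_iff_isDiag hd.injective _ _).1 h.symm⟩
    · rintro ⟨b, hb, h⟩
      refine ⟨off N b + dg N d, ⟨?_, ?_⟩, ?_⟩
      · simpa [off_off, off_dg] using hb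
      · simpa [dpart_off, dpart_dg] using hd
      · rw [specMap_eq]
        simp only [map_add, off_off, off_dg, dpart_off, dpart_dg, add_zero, zero_add]
        exact ((cong_eq_iff_isDiag hd.injective _ _).2 h).symm
  have h2 : ∀ {d : Fin N → ℝ}, StrictMono d → ∀ k : UN N,
      rotMeasure N (specMap N '' specSet N ε) (cong (k : Mat N) (dg N d)) =
      (Measure.haar : Measure (UN N)) {g : UN N | ∃ b : Coord N, ‖off N b‖ < ε ∧
        (((cayleyU N (off N b))⁻¹ * g⁻¹ : UN N) : Mat N).IsDiag} := by
    intro d hd k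
    rw [rotMeasure, ← measure_preimage_mul _ k]
    congr 1
    ext g
    have h3 : cong (star ((k * g : UN N) : Mat N)) (cong (k : Mat N) (dg N d)) =
        cong ((g⁻¹ : UN N) : Mat N) (dg N d) := by
      rw [← LinearMap.comp_apply, ← cong_mul, Submonoid.coe_mul, star_mul, Matrix.mul_assoc,
        Matrix.star_eq_conjTranspose (k : Mat N), coe_conjTranspose_mul_self, Matrix.mul_one]
      rfl
    change cong (star ((k * g : UN N) : Mat N)) (cong (k : Mat N) (dg N d)) ∈
      specMap N '' specSet N ε ↔ _
    rw [h3, h1 hd]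
    rfl
  rw [h2 hd, h2 hd']

theorem ae_rotMeasure_eq (N : ℕ) (ε : ℝ) :
    ∀ᵐ t : Coord N, rotMeasure N (specMap N '' specSet N ε) t =
      rotMeasure N (specMap N '' specSet N ε) (dg N (diagIdx N)) := by
  filter_upwards [ae_exists_injective (N := N)] with t ht
  obtain ⟨k, d, hd, rfl⟩ := ht
  have h1 : cong ((1 : UN N) : Mat N) (dg N (diagIdx N)) = dg N (diagIdx N) := by
    rw [OneMemClass.coe_one, cong_one]; rfl
  exact (rotMeasure_specMap hd diagIdx_strictMono _ _ _).trans (congrArg _ h1)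

theorem measurable_rotIndicator {A : Set (Coord N)} (hA : MeasurableSet A) :
    Measurable fun z : UN N × Coord N => A.indicator (fun _ => (1 : ENNReal))
      (cong (star z.1 : Mat N) z.2) :=
  (measurable_const.indicator hA).comp continuous_cong_apply.measurable

theorem lintegral_rotIndicator {A : Set (Coord N)} (hA : MeasurableSet A) (t : Coord N) (c : ENNReal) :
    ∫⁻ g : UN N, A.indicator (fun _ => (1 : ENNReal)) (cong (star g : Mat N) t) * c
      ∂(Measure.haar : Measure (UN N)) = rotMeasure N A t * c := by
  have hc : Continuous fun g : UN N => cong (star g : Mat N) t :=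
    Continuous.comp (g := fun z : UN N × Coord N => cong (star z.1 : Mat N) z.2)
      (f := fun g => (g, t)) continuous_cong_apply (continuous_id.prodMk continuous_const)
  have hmt : Measurable fun g : UN N =>
      A.indicator (fun _ => (1 : ENNReal)) (cong (star g : Mat N) t) :=
    (measurable_const.indicator hA).comp hc.measurable
  have hs : MeasurableSet {g : UN N | cong (star g : Mat N) t ∈ A} :=
    hc.measurable hA
  rw [lintegral_mul_const _ hmt, rotMeasure, ← lintegral_indicator_one hs]
  rfl

theorem setLIntegral_eq_rotIndicator {A : Set (Coord N)} (hA : MeasurableSet A)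
    {F : Coord N → ENNReal} (hF : Measurable F)
    (hinv : ∀ (k : UN N) t, F (cong (k : Mat N) t) = F t) (g : UN N) :
    ∫⁻ t in A, F t =
      ∫⁻ t, A.indicator (fun _ => (1 : ENNReal)) (cong (star g : Mat N) t) * F t := by
  rw [← lintegral_indicator hA, ← (measurePreserving_cong (star g)).lintegral_comp
    (hF.indicator hA)]
  refine lintegral_congr fun t => ?_
  by_cases h : cong ((star g : UN N) : Mat N) t ∈ A
  · have h' : cong (star (g : Mat N)) t ∈ A := h
    rw [Set.indicator_of_mem h, Set.indicator_of_mem h', hinv, one_mul]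
  · have h' : cong (star (g : Mat N)) t ∉ A := h
    rw [Set.indicator_of_notMem h, Set.indicator_of_notMem h', zero_mul]

/-- The integral over `A` equals that over any rotate of `A`; average over all rotations and
exchange the integrals. -/
theorem mul_setLIntegral_eq {A : Set (Coord N)} (hA : MeasurableSet A)
    {F : Coord N → ENNReal} (hF : Measurable F)
    (hinv : ∀ (k : UN N) t, F (cong (k : Mat N) t) = F t) :
    (Measure.haar : Measure (UN N)) Set.univ * ∫⁻ t in A, F t =
      ∫⁻ t, rotMeasure N A t * F t := by
  have h1 := lintegral_congr (μ := (Measure.haar : Measure (UN N)))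
    (setLIntegral_eq_rotIndicator hA hF hinv)
  rw [lintegral_const, mul_comm] at h1
  have h2 : Measurable fun z : UN N × Coord N => A.indicator (fun _ => (1 : ENNReal))
      (cong (star z.1 : Mat N) z.2) * F z.2 :=
    (measurable_rotIndicator hA).mul (hF.comp measurable_snd)
  rw [h1, lintegral_lintegral_swap (μ := (Measure.haar : Measure (UN N))) h2.aemeasurable]
  exact lintegral_congr fun t => lintegral_rotIndicator hA t (F t)

/-- Symmetrisation of an integral over the Weyl chamber. -/
theorem lintegral_eq_card_mul_strictMono {G : (Fin N → ℝ) → ENNReal} (hG : Measurable G)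
    (hsymm : ∀ (σ : Equiv.Perm (Fin N)) d, G (d ∘ σ) = G d)
    (hzero : ∀ d, ¬ Function.Injective d → G d = 0) :
    ∫⁻ d, G d = (Fintype.card (Equiv.Perm (Fin N)) : ENNReal) * ∫⁻ d in {d | StrictMono d}, G d := by
  set W : Set (Fin N → ℝ) := {d | StrictMono d}
  have hW : MeasurableSet W := measurableSet_strictMono
  have h1 : ∀ d, G d = ∑ σ : Equiv.Perm (Fin N), W.indicator G (d ∘ σ) := by
    intro d
    -- Exactly one permutation sorts a vector with distinct coordinates; if two coordinates agree,
    -- both sides vanish.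
    by_cases hd : Function.Injective d
    · rw [Finset.sum_eq_single (Tuple.sort d)]
      · rw [Set.indicator_of_mem, hsymm]
        exact (Tuple.monotone_sort d).strictMono_of_injective (hd.comp (Tuple.sort d).injective)
      · intro σ _ hσ
        refine Set.indicator_of_notMem (fun h : StrictMono (d ∘ σ) => hσ ?_) _
        have h2 := Tuple.unique_monotone h.monotone (Tuple.monotone_sort d)
        ext1 i
        exact hd (congrFun h2 i)
      · simp
    · rw [hzero d hd, Finset.sum_eq_zero]
      intro σ _
      refine Set.indicator_of_notMem (fun h : StrictMono (d ∘ σ) => hd ?_) _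
      exact (σ.injective_comp d).1 h.injective
  have h2 : ∀ σ : Equiv.Perm (Fin N), MeasurePreserving (fun d : Fin N → ℝ => d ∘ σ) := fun σ =>
    (volume_measurePreserving_piCongrLeft (fun _ : Fin N => ℝ) σ).symm
  calc _ = ∫⁻ d, ∑ σ : Equiv.Perm (Fin N), W.indicator G (d ∘ σ) := lintegral_congr h1
    _ = ∑ σ : Equiv.Perm (Fin N), ∫⁻ d, W.indicator G (d ∘ σ) :=
        lintegral_finsetSum _ fun σ _ => (hG.indicator hW).comp (h2 σ).measurable
    _ = ∑ σ : Equiv.Perm (Fin N), ∫⁻ d in W, G d := by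
        refine Finset.sum_congr rfl fun σ _ => ?_
        rw [(h2 σ).lintegral_comp (hG.indicator hW), lintegral_indicator hW]
    _ = _ := by simp

theorem weylDensity_perm (σ : Equiv.Perm (Fin N)) (d : Fin N → ℝ) :
    weylDensity (d ∘ σ) = weylDensity d := by
  unfold weylDensity
  congr 1
  refine Fintype.prod_equiv (σ.prodCongr σ) _ _ fun p => ?_
  simp [gap]

theorem weylDensity_eq_zero {d : Fin N → ℝ} (hd : ¬ Function.Injective d) : weylDensity d = 0 := by
  obtain ⟨i, j, h, hij⟩ := Function.not_injective_iff.1 hd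
  unfold weylDensity
  rw [Finset.prod_eq_zero (Finset.mem_univ (i, j)), ENNReal.ofReal_zero]
  simp [gap, hij, h]

theorem weylDensity_pos {d : Fin N → ℝ} (hd : Function.Injective d) : 0 < weylDensity d :=
  ENNReal.ofReal_pos.2 (Finset.prod_pos fun p _ => abs_pos.2 (gap_ne_zero hd p))

theorem exists_injective_not_null :
    volume {d : Fin N → ℝ | StrictMono d} ≠ 0 := by
  have : IsOpen {d : Fin N → ℝ | StrictMono d} := by
    have : {d : Fin N → ℝ | StrictMono d} = ⋂ i, ⋂ j, {d | i < j → d i < d j} := by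
      ext d; simp [StrictMono]
    rw [this]
    refine isOpen_iInter_of_finite fun i => isOpen_iInter_of_finite fun j => ?_
    by_cases h : i < j
    · simp only [h, true_imp_iff]
      exact isOpen_lt (continuous_apply i) (continuous_apply j)
    · simp [h]
  exact (this.measure_pos _ ⟨_, diagIdx_strictMono⟩).ne'

/-- **Weyl's integration formula** for class functions of Hermitian matrices, up to the value of
the constant. -/
theorem exists_weyl_integration (N : ℕ) : ∃ C : ENNReal, C ≠ 0 ∧ C ≠ ⊤ ∧
    ∀ F : Coord N → ENNReal, Measurable F → (∀ (k : UN N) t, F (cong (k : Mat N) t) = F t) →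
      ∫⁻ t, F t = C * ∫⁻ d, weylDensity d * F (dg N d) := by
  obtain ⟨ε, hε, hinj⟩ := exists_injOn_specMap (N := N)
  obtain ⟨δ, hδ, hδε, hc0, hct⟩ := exists_tubeConst (N := N) hε
  have hi := hinj δ hδε
  set A := specMap N '' specSet N δ with hA
  have hAm : MeasurableSet A := measurable_image_of_fderivWithin (measurableSet_specSet δ)
    (fun t _ => (hasStrictFDerivAt_specMap t).hasFDerivAt.hasFDerivWithinAt) hi
  set m := (Measure.haar : Measure (UN N)) Set.univ with hm
  have hm0 : m ≠ 0 := (isOpen_univ.measure_pos _ Set.univ_nonempty).ne'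
  have hmt : m ≠ ⊤ := measure_ne_top _ _
  set κ := rotMeasure N A (dg N (diagIdx N)) with hκ
  have hκt : κ ≠ ⊤ := measure_ne_top _ _
  set n : ENNReal := (Fintype.card (Equiv.Perm (Fin N)) : ENNReal) with hn
  have hn0 : n ≠ 0 := by simp [hn]
  have hnt : n ≠ ⊤ := by simp [hn]
  -- The integral over the image of the tube, computed in two ways: by change of variables, and by
  -- averaging over `U(N)`, where `κ` is the almost everywhere constant value of `rotMeasure`.
  have key : ∀ F : Coord N → ENNReal, Measurable F →
      (∀ (k : UN N) t, F (cong (k : Mat N) t) = F t) →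
      m * (tubeConst N δ * ∫⁻ d in {d : Fin N → ℝ | StrictMono d}, weylDensity d * F (dg N d)) =
        κ * ∫⁻ t, F t := by
    intro F hF hinv
    rw [← lintegral_specMap_image hi hF hinv, mul_setLIntegral_eq hAm hF hinv,
      ← lintegral_const_mul _ hF]
    refine lintegral_congr_ae ?_
    filter_upwards [ae_rotMeasure_eq N δ] with t ht
    rw [ht]
  have hsymm : ∀ F : Coord N → ENNReal, Measurable F →
      (∀ (k : UN N) t, F (cong (k : Mat N) t) = F t) →
      ∫⁻ d, weylDensity d * F (dg N d) =
        n * ∫⁻ d in {d : Fin N → ℝ | StrictMono d}, weylDensity d * F (dg N d) := by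
    intro F hF hinv
    refine lintegral_eq_card_mul_strictMono
      (measurable_weylDensity.mul (hF.comp continuous_dg.measurable)) (fun σ d => ?_)
      (fun d hd => by rw [weylDensity_eq_zero hd, zero_mul])
    obtain ⟨k, hk⟩ := exists_unitary_perm σ d
    rw [weylDensity_perm, hk, hinv]
  -- For `F = 1`, a zero `κ` would annihilate the right side of `key` even though the integral there
  -- may be infinite, while the left side is positive.
  have hκ0 : κ ≠ 0 := by
    intro h0
    have h1 := key 1 measurable_one (fun _ _ => rfl)
    rw [h0, zero_mul] at h1
    simp only [mul_eq_zero, hm0, hc0, false_or, Pi.one_apply, mul_one] at h1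
    rw [setLIntegral_eq_zero_iff measurableSet_strictMono measurable_weylDensity] at h1
    refine exists_injective_not_null (N := N) ?_
    refine measure_mono_null ?_ (ae_iff.1 h1)
    intro d hd
    simp only [Set.mem_ofPred_eq, Classical.not_imp]
    exact ⟨hd, (weylDensity_pos (StrictMono.injective hd)).ne'⟩
  -- The factor `n = N!` passes from the Weyl chamber to the whole of `ℝᴺ`.
  refine ⟨κ⁻¹ * (m * tubeConst N δ * n⁻¹), ?_, ?_, fun F hF hinv => ?_⟩
  · exact mul_ne_zero (ENNReal.inv_ne_zero.2 hκt)
      (mul_ne_zero (mul_ne_zero hm0 hc0) (ENNReal.inv_ne_zero.2 hnt))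
  · exact ENNReal.mul_ne_top (ENNReal.inv_ne_top.2 hκ0)
      (ENNReal.mul_ne_top (ENNReal.mul_ne_top hmt hct) (ENNReal.inv_ne_top.2 hn0))
  · have h1 := key F hF hinv
    rw [hsymm F hF hinv, mul_assoc, mul_assoc _ n⁻¹, ← mul_assoc n⁻¹,
      ENNReal.inv_mul_cancel hn0 hnt, one_mul, mul_assoc, h1, ← mul_assoc,
      ENNReal.inv_mul_cancel hκ0 hκt, one_mul]

/-! ### Invariance of the volume of the unitary group -/

/-- The density of the Riemannian volume of `U(N)` in the Cayley chart. -/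
def densU (N : ℕ) (t : Coord N) : ℝ :=
  √(detWt N) * (2 ^ (N * N) * ‖(resolv N t).det‖ ^ (2 * N))

theorem continuous_densU : Continuous (densU N) :=
  continuous_const.mul (continuous_const.mul (continuous_resolv.matrix_det.norm.pow _))

theorem densU_pos (t : Coord N) : 0 < densU N t :=
  mul_pos (Real.sqrt_pos.2 detWt_pos)
    (mul_pos (by positivity) (pow_pos (norm_pos_iff.2 (det_resolv_ne_zero t)) _))

theorem volU_eq : volU N =
    (volume.withDensity fun t => ENNReal.ofReal (densU N t)).map (cayleyU N) := by
  unfold volU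
  simp only [volumeDensity_cayley]
  rfl

theorem lintegral_volU {G : UN N → ENNReal} (hG : Measurable G) :
    ∫⁻ x, G x ∂(volU N) = ∫⁻ t, ENNReal.ofReal (densU N t) * G (cayleyU N t) := by
  have hm : Measurable fun t => ENNReal.ofReal (densU N t) :=
    continuous_densU.measurable.ennreal_ofReal
  rw [volU_eq, lintegral_map hG continuous_cayleyU.measurable,
    lintegral_withDensity_eq_lintegral_mul _ hm (g := fun t => G (cayleyU N t))
      (hG.comp continuous_cayleyU.measurable)]
  rfl

theorem one_add_inv_conjTranspose (x : UN N) (hx : (1 + (x : Mat N)).det ≠ 0) :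
    ((1 + (x : Mat N))⁻¹)ᴴ = (x : Mat N) * (1 + (x : Mat N))⁻¹ := by
  have h1 : (1 + (x : Mat N))ᴴ * ((x : Mat N) * (1 + (x : Mat N))⁻¹) = 1 := by
    rw [Matrix.conjTranspose_add, Matrix.conjTranspose_one, ← Matrix.mul_assoc, Matrix.add_mul,
      coe_conjTranspose_mul_self, Matrix.one_mul, add_comm, Matrix.mul_nonsing_inv _ hx.isUnit]
  rw [Matrix.conjTranspose_nonsing_inv]
  exact Matrix.inv_eq_right_inv h1

theorem inv_add_mul_inv (x : Mat N) (hx : (1 + x).det ≠ 0) : (1 + x)⁻¹ + x * (1 + x)⁻¹ = 1 := by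
  have := Matrix.mul_nonsing_inv _ hx.isUnit
  rwa [Matrix.add_mul, Matrix.one_mul] at this

/-- The inverse of the Cayley chart. -/
def icay (x : Mat N) : Coord N := toCoord N (Complex.I • ((2 : ℝ) • (1 + x)⁻¹ - 1))

/-- The coordinates recover only Hermitian matrices. This one is Hermitian because the adjoint of
`(1 + x)⁻¹` is `x (1 + x)⁻¹ = 1 - (1 + x)⁻¹`. -/
theorem herm_icay (x : UN N) (hx : (1 + (x : Mat N)).det ≠ 0) :
    herm N (icay (x : Mat N)) = Complex.I • ((2 : ℝ) • (1 + (x : Mat N))⁻¹ - 1) := by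
  refine herm_toCoord ?_
  have h := inv_add_mul_inv (x : Mat N) hx
  rw [Matrix.conjTranspose_smul, Matrix.conjTranspose_sub, Matrix.conjTranspose_smul,
    one_add_inv_conjTranspose x hx, Matrix.conjTranspose_one]
  have h2 : (x : Mat N) * (1 + (x : Mat N))⁻¹ = 1 - (1 + (x : Mat N))⁻¹ := by
    rw [eq_sub_iff_add_eq, add_comm]; exact h
  have h3 : star Complex.I = -Complex.I := Complex.conj_I
  rw [h2, h3, neg_smul, ← smul_neg]
  congr 1
  rw [star_trivial, two_smul, two_smul]; abel

theorem resolv_icay (x : UN N) (hx : (1 + (x : Mat N)).det ≠ 0) :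
    resolv N (icay (x : Mat N)) = (2 : ℝ)⁻¹ • (1 + (x : Mat N)) := by
  rw [resolv, herm_icay x hx, smul_smul, Complex.I_mul_I, neg_one_smul]
  refine Matrix.inv_eq_right_inv ?_
  have : (1 : Mat N) - -((2 : ℝ) • (1 + (x : Mat N))⁻¹ - 1) = (2 : ℝ) • (1 + (x : Mat N))⁻¹ := by
    abel
  rw [this, Matrix.smul_mul, Matrix.mul_smul, Matrix.nonsing_inv_mul _ hx.isUnit, smul_smul]
  norm_num

theorem cayley_icay (x : UN N) (hx : (1 + (x : Mat N)).det ≠ 0) :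
    cayley N (icay (x : Mat N)) = x := by
  rw [cayley_eq, resolv_icay x hx, smul_smul]
  norm_num

theorem one_add_cayley (t : Coord N) : 1 + cayley N t = (2 : ℝ) • resolv N t := by
  rw [cayley_eq]; abel

theorem det_one_add_cayley_ne_zero (t : Coord N) : (1 + cayley N t).det ≠ 0 := by
  have h : (2 : ℝ) • resolv N t = (2 : ℂ) • resolv N t := by
    ext i j; simp
  rw [one_add_cayley, h, Matrix.det_smul]
  exact mul_ne_zero (pow_ne_zero _ two_ne_zero) (det_resolv_ne_zero t)

theorem icay_cayley (t : Coord N) : icay (cayley N t) = t := by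
  have h : (1 + cayley N t)⁻¹ = (2 : ℝ)⁻¹ • (1 - Complex.I • herm N t) := by
    rw [one_add_cayley]
    refine Matrix.inv_eq_right_inv ?_
    rw [Matrix.smul_mul, Matrix.mul_smul, resolv_mul, smul_smul]
    norm_num
  rw [icay, h, smul_smul, mul_inv_cancel₀ two_ne_zero, one_smul]
  have : Complex.I • (1 - Complex.I • herm N t - 1) = herm N t := by
    rw [sub_sub_cancel_left, smul_neg, smul_smul, Complex.I_mul_I, neg_one_smul, neg_neg]
  rw [this, toCoord_herm]

/-- The part of the Cayley chart that a right translation maps into the Cayley chart. -/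
def transDom (k : UN N) : Set (Coord N) := {t | (1 + cayley N t * (k : Mat N)).det ≠ 0}

/-- A right translation, in the Cayley chart. -/
def transMap (k : UN N) (t : Coord N) : Coord N := icay (cayley N t * (k : Mat N))

theorem isOpen_transDom (k : UN N) : IsOpen (transDom k) :=
  isOpen_ne_fun (continuous_const.add (continuous_cayley.matrix_mul continuous_const)).matrix_det
    continuous_const

theorem cayley_transMap {k : UN N} {t : Coord N} (ht : t ∈ transDom k) :
    cayley N (transMap k t) = cayley N t * (k : Mat N) :=
  cayley_icay (cayleyU N t * k) ht

theorem cayleyU_transMap {k : UN N} {t : Coord N} (ht : t ∈ transDom k) :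
    cayleyU N (transMap k t) = cayleyU N t * k :=
  Subtype.ext (cayley_transMap ht)

theorem transMap_mem {k : UN N} {t : Coord N} (ht : t ∈ transDom k) :
    transMap k t ∈ transDom k⁻¹ := by
  have h : cayley N t * (k : Mat N) * ((k⁻¹ : UN N) : Mat N) = cayley N t := by
    rw [Matrix.mul_assoc, ← Submonoid.coe_mul, mul_inv_cancel, OneMemClass.coe_one, Matrix.mul_one]
  change (1 + cayley N (transMap k t) * ((k⁻¹ : UN N) : Mat N)).det ≠ 0
  rw [cayley_transMap ht, h]
  exact det_one_add_cayley_ne_zero t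

theorem transMap_inv {k : UN N} {t : Coord N} (ht : t ∈ transDom k) :
    transMap k⁻¹ (transMap k t) = t := by
  have h : cayley N t * (k : Mat N) * ((k⁻¹ : UN N) : Mat N) = cayley N t := by
    rw [Matrix.mul_assoc, ← Submonoid.coe_mul, mul_inv_cancel, OneMemClass.coe_one, Matrix.mul_one]
  rw [transMap, cayley_transMap ht, h, icay_cayley]

theorem image_transMap (k : UN N) : transMap k '' transDom k = transDom k⁻¹ := by
  ext t
  constructor
  · rintro ⟨s, hs, rfl⟩; exact transMap_mem hs
  · intro ht
    have h1 := transMap_mem ht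
    have h2 := transMap_inv ht
    rw [inv_inv] at h1 h2
    exact ⟨_, h1, h2⟩

theorem injOn_transMap (k : UN N) : Set.InjOn (transMap k) (transDom k) := fun s hs t ht h => by
  rw [← transMap_inv hs, h, transMap_inv ht]

/-- The congruence that is the derivative of a right translation in the Cayley chart. -/
def transDeriv (k : UN N) (t : Coord N) : Mat N :=
  (2 : ℝ) • ((1 + cayley N t * (k : Mat N))⁻¹ * resolv N t)

/-- Unitarity makes the right factor of the derivative the adjoint of the left one. A right
translation thus acts infinitesimally by a congruence, whose Jacobian is given by `abs_det_cong`. -/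
theorem translation_derivative_aux {k : UN N} {t : Coord N} (ht : t ∈ transDom k) (B : Mat N) :
    Complex.I • ((2 : ℝ) • -((1 + cayley N t * (k : Mat N))⁻¹ *
      ((((2 : ℝ) • Complex.I • resolv N t) * (B * resolv N t)) * (k : Mat N)) *
        (1 + cayley N t * (k : Mat N))⁻¹)) =
      transDeriv k t * B * (transDeriv k t)ᴴ := by
  have h1 := one_add_inv_conjTranspose (cayleyU N t * k) ht
  have hC : ((cayleyU N t * k : UN N) : Mat N) = cayley N t * k := rfl
  rw [hC] at h1
  have h2 : (resolv N t)ᴴ * cayley N t = resolv N t := by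
    have h3 := resolv_mul_cayley_conjTranspose (-t)
    rwa [← resolv_conjTranspose, ← cayley_conjTranspose, Matrix.conjTranspose_conjTranspose,
      Matrix.conjTranspose_conjTranspose] at h3
  rw [transDeriv, Matrix.conjTranspose_smul, Matrix.conjTranspose_mul, h1]
  set R := (1 + cayley N t * (k : Mat N))⁻¹
  set Y := resolv N t
  have h4 : Yᴴ * (cayley N t * (k : Mat N) * R) = Y * (k : Mat N) * R := by
    rw [← Matrix.mul_assoc, ← Matrix.mul_assoc, h2]
  rw [h4, star_trivial]
  simp only [Matrix.smul_mul, Matrix.mul_smul, Matrix.mul_assoc]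
  simp only [← smul_neg, smul_comm (2 : ℝ) Complex.I, smul_smul, Complex.I_mul_I]
  rw [neg_one_smul, smul_neg, neg_neg]

section Calculus
open scoped Matrix.Norms.Operator

theorem hasFDerivAt_transMap {k : UN N} {t : Coord N} (ht : t ∈ transDom k) :
    HasFDerivAt (transMap k) (LinearMap.toContinuousLinearMap (cong (transDeriv k t))) t := by
  have h1 : HasFDerivAt (fun t => 1 + cayley N t * (k : Mat N))
      ((LinearMap.toContinuousLinearMap (LinearMap.mulRight ℝ (k : Mat N))).comp
        (sandwich ((2 : ℝ) • Complex.I • resolv N t) (resolv N t))) t :=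
    ((LinearMap.toContinuousLinearMap (LinearMap.mulRight ℝ (k : Mat N))).hasFDerivAt.comp t
      (hasStrictFDerivAt_cayley t).hasFDerivAt).const_add 1
  have ht' : (1 + cayley N t * (k : Mat N)).det ≠ 0 := ht
  obtain ⟨u, hu⟩ := (Matrix.isUnit_iff_isUnit_det _).2 ht'.isUnit
  have h2 := hasFDerivAt_ringInverse (𝕜 := ℝ) u
  rw [hu] at h2
  have h3 := ((h2.comp t h1).const_smul (2 : ℝ)).sub_const 1
  have h4 := ((LinearMap.toContinuousLinearMap (toCoord N)).hasFDerivAt).comp t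
    (h3.const_smul Complex.I)
  have h5 : transMap k = fun t => toCoord N (Complex.I • ((2 : ℝ) •
      Ring.inverse (1 + cayley N t * (k : Mat N)) - 1)) := by
    ext1 t; rw [transMap, icay, Matrix.nonsing_inv_eq_ringInverse]
  have h6 : ((u⁻¹ : (Mat N)ˣ) : Mat N) = (1 + cayley N t * (k : Mat N))⁻¹ := by
    rw [← hu, Matrix.coe_units_inv]
  rw [h5]
  refine h4.congr_fderiv (ContinuousLinearMap.ext fun s => ?_)
  change toCoord N (Complex.I • ((2 : ℝ) • -(((u⁻¹ : (Mat N)ˣ) : Mat N) *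
      ((((2 : ℝ) • Complex.I • resolv N t) * (herm N s * resolv N t)) * (k : Mat N)) *
        ((u⁻¹ : (Mat N)ˣ) : Mat N)))) = cong (transDeriv k t) s
  rw [h6, cong_apply, ← translation_derivative_aux ht]

end Calculus

theorem det_real_smul (c : ℝ) (x : Mat N) : (c • x).det = (c : ℂ) ^ N * x.det := by
  have h : c • x = (c : ℂ) • x := by ext i j; simp
  rw [h, Matrix.det_smul, Fintype.card_fin]

/-- The new resolvent is `(1 + X k) / 2` and the Jacobian is `|det (2 (1 + X k)⁻¹ Y)|²ᴺ`; the
factors 2 and `1 + X k` cancel. -/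
theorem abs_det_transDeriv_mul_densU {k : UN N} {t : Coord N} (ht : t ∈ transDom k) :
    |(LinearMap.toContinuousLinearMap (cong (transDeriv k t))).det| * densU N (transMap k t) =
      densU N t := by
  have ht' : (1 + cayley N t * (k : Mat N)).det ≠ 0 := ht
  have h1 : (transDeriv k t).det =
      2 ^ N * ((1 + cayley N t * (k : Mat N)).det⁻¹ * (resolv N t).det) := by
    rw [transDeriv, det_real_smul, Matrix.det_mul, Matrix.det_nonsing_inv, Ring.inverse_eq_inv']
    simp
  have h0 : (transDeriv k t).det ≠ 0 := by
    rw [h1]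
    exact mul_ne_zero (pow_ne_zero _ two_ne_zero)
      (mul_ne_zero (inv_ne_zero ht') (det_resolv_ne_zero t))
  have h2 : (resolv N (transMap k t)).det = (2 ^ N)⁻¹ * (1 + cayley N t * (k : Mat N)).det := by
    have := resolv_icay (cayleyU N t * k) ht
    change resolv N (transMap k t) = (2 : ℝ)⁻¹ • (1 + cayley N t * (k : Mat N)) at this
    rw [this, det_real_smul]
    simp
  rw [ContinuousLinearMap.det, LinearMap.coe_toContinuousLinearMap, abs_det_cong h0, densU, densU,
    h1, h2]
  have h3 : ‖(1 + cayley N t * (k : Mat N)).det‖ ≠ 0 := norm_ne_zero_iff.2 ht'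
  simp only [norm_mul, norm_inv, norm_pow, RCLike.norm_ofNat, mul_pow, inv_pow]
  field_simp

/-- The polynomial whose zeros are the points of the Cayley chart that a right translation moves
out of the chart. -/
def transPoly (k : UN N) (t : Coord N) : ℂ :=
  ((1 - Complex.I • herm N t) + (1 + Complex.I • herm N t) * (k : Mat N)).det

theorem transPoly_eq (k : UN N) (t : Coord N) :
    transPoly k t = (1 - Complex.I • herm N t).det * (1 + cayley N t * (k : Mat N)).det := by
  have hc : (1 - Complex.I • herm N t) * cayley N t = 1 + Complex.I • herm N t := by
    have : cayley N t = (2 : ℝ) • resolv N t - 1 := cayley_eq t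
    rw [this, Matrix.mul_sub, Matrix.mul_smul, mul_resolv, Matrix.mul_one, two_smul]; abel
  rw [transPoly, ← Matrix.det_mul, Matrix.mul_add, Matrix.mul_one, ← Matrix.mul_assoc, hc]

theorem transPoly_ne_zero_iff (k : UN N) (t : Coord N) : transPoly k t ≠ 0 ↔ t ∈ transDom k := by
  rw [transPoly_eq, mul_ne_zero_iff]
  exact ⟨fun h => h.2, fun h => ⟨(isUnit_one_sub t).ne_zero, h⟩⟩

theorem eval_det_X_smul_add (A B : Mat N) (s : ℂ) :
    (((Polynomial.X : Polynomial ℂ) • B.map Polynomial.C + A.map Polynomial.C).det).eval s =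
      (A + s • B).det := by
  rw [← Polynomial.coe_evalRingHom, RingHom.map_det]
  congr 1
  ext i j
  simp
  ring

theorem exists_scalar_transDom (k : UN N) : ∃ s : ℝ, dg N (fun _ => s) ∈ transDom k := by
  set A : Mat N := 1 + (k : Mat N)
  set B : Mat N := Complex.I • ((k : Mat N) - 1)
  set q := ((Polynomial.X : Polynomial ℂ) • B.map Polynomial.C + A.map Polynomial.C).det with hq
  have hkdet : (k : Mat N).det ≠ 0 := norm_ne_zero_iff.1 (by rw [norm_det_unitary]; exact one_ne_zero)
  have hq0 : q ≠ 0 := by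
    intro h0
    -- The polynomial is seen to be nonzero at the complex parameter `-i`, where `A + s B` equals
    -- `2k`; hence some real parameter is not a root.
    have h1 := eval_det_X_smul_add A B (-Complex.I)
    rw [← hq, h0, Polynomial.eval_zero] at h1
    have h2 : A + (-Complex.I) • B = (2 : ℝ) • (k : Mat N) := by
      rw [smul_smul, neg_mul, Complex.I_mul_I, neg_neg, one_smul, two_smul]
      simp only [A]; abel
    rw [h2, det_real_smul] at h1
    exact mul_ne_zero (pow_ne_zero _ (by norm_num)) hkdet h1.symm
  have hfin : {s : ℝ | q.IsRoot (s : ℂ)}.Finite :=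
    (Polynomial.finite_setOfPred_isRoot hq0).preimage Complex.ofReal_injective.injOn
  obtain ⟨s, hs⟩ := hfin.infinite_compl.nonempty
  refine ⟨s, (transPoly_ne_zero_iff _ _).1 fun h => hs ?_⟩
  change q.eval (s : ℂ) = 0
  rw [eval_det_X_smul_add, ← h, transPoly, herm_dg]
  congr 1
  have h3 : (Matrix.diagonal fun _ => (s : ℂ) : Mat N) = (s : ℂ) • 1 := by
    rw [Matrix.smul_one_eq_diagonal]
  rw [h3, Matrix.add_mul, Matrix.one_mul]
  simp only [A, B, smul_smul, Matrix.smul_mul, Matrix.one_mul, smul_sub, mul_comm (s : ℂ)]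
  abel

/-- Clearing the denominator `det (1 - i H)` makes the complement the zero set of a polynomial that
is not identically zero. -/
theorem ae_mem_transDom (k : UN N) : ∀ᵐ t : Coord N, t ∈ transDom k := by
  have h : volume {t : Coord N | transPoly k t = 0} = 0 := by
    obtain ⟨s, hs⟩ := exists_scalar_transDom k
    refine volume_zeros_eq_zero _ ?_ (dg N fun _ => s) ((transPoly_ne_zero_iff _ _).2 hs)
      fun v => ?_
    · unfold transPoly
      refine Continuous.matrix_det ?_
      have := fun c : ℂ => continuous_const_smul c |>.comp (continuous_herm (N := N))
      exact (continuous_const.sub (this _)).add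
        ((continuous_const.add (this _)).matrix_mul continuous_const)
    · set t0 := dg N (fun _ => s)
      set A : Mat N := (1 - Complex.I • herm N t0) + (1 + Complex.I • herm N t0) * (k : Mat N)
      set B : Mat N := Complex.I • (herm N v * (k : Mat N) - herm N v)
      refine ⟨((Polynomial.X : Polynomial ℂ) • B.map Polynomial.C + A.map Polynomial.C).det,
        fun r => ?_⟩
      rw [eval_det_X_smul_add, transPoly, herm_add, herm_smul]
      congr 1
      have h3 : r • herm N v = (r : ℂ) • herm N v := by ext i j; simp
      rw [h3]
      simp only [A, B, smul_add, smul_sub, Matrix.add_mul, Matrix.one_mul, Matrix.smul_mul]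
      rw [smul_comm Complex.I (r : ℂ), smul_comm Complex.I (r : ℂ)]
      abel
  rw [ae_iff]
  convert h using 2
  ext t
  exact (not_congr (transPoly_ne_zero_iff k t)).symm.trans not_not

theorem lintegral_volU_mul_right (k : UN N) {G : UN N → ENNReal} (hG : Measurable G) :
    ∫⁻ x, G (x * k) ∂(volU N) = ∫⁻ x, G x ∂(volU N) := by
  have hk : Measurable fun x : UN N => x * k := by fun_prop
  have hr : ∀ k : UN N, volume.restrict (transDom k) = (volume : Measure (Coord N)) := fun k =>
    Measure.restrict_eq_self_of_ae_mem (ae_mem_transDom k)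
  have h1 : ∫⁻ t, ENNReal.ofReal (densU N t) * G (cayleyU N t) =
      ∫⁻ t in transMap k '' transDom k, ENNReal.ofReal (densU N t) * G (cayleyU N t) := by
    rw [image_transMap, hr]
  have h2 : ∫⁻ t, ENNReal.ofReal (densU N t) * G (cayleyU N t * k) =
      ∫⁻ t in transDom k, ENNReal.ofReal (densU N t) * G (cayleyU N t * k) := by
    rw [hr]
  rw [lintegral_volU hG, lintegral_volU (G := fun x => G (x * k)) (hG.comp hk), h1, h2,
    lintegral_image_eq_lintegral_abs_det_fderiv_mul volume (isOpen_transDom k).measurableSet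
      (fun t ht => (hasFDerivAt_transMap ht).hasFDerivWithinAt) (injOn_transMap k)]
  refine setLIntegral_congr_fun (isOpen_transDom k).measurableSet fun t ht => ?_
  rw [cayleyU_transMap ht, ← mul_assoc, ← ENNReal.ofReal_mul (abs_nonneg _),
    abs_det_transDeriv_mul_densU ht]

/-! ### Diagonalisation of unitary matrices -/

theorem cayley_cong (k : UN N) (t : Coord N) :
    cayley N (cong (k : Mat N) t) = (k : Mat N) * cayley N t * (k : Mat N)ᴴ := by
  have h1 : resolv N (cong (k : Mat N) t) = (k : Mat N) * resolv N t * (k : Mat N)ᴴ := by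
    rw [resolv, herm_cong]
    refine Matrix.inv_eq_right_inv ?_
    have h2 : (1 : Mat N) - Complex.I • ((k : Mat N) * herm N t * (k : Mat N)ᴴ) =
        (k : Mat N) * (1 - Complex.I • herm N t) * (k : Mat N)ᴴ := by
      rw [Matrix.mul_sub, Matrix.sub_mul, Matrix.mul_one, coe_mul_conjTranspose_self,
        Matrix.mul_smul, Matrix.smul_mul]
    rw [h2]
    calc _ = (k : Mat N) * ((1 - Complex.I • herm N t) * ((k : Mat N)ᴴ * (k : Mat N)) *
          resolv N t) * (k : Mat N)ᴴ := by simp only [Matrix.mul_assoc]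
      _ = 1 := by
        rw [coe_conjTranspose_mul_self, Matrix.mul_one, mul_resolv, Matrix.mul_one,
          coe_mul_conjTranspose_self]
  rw [cayley_eq, cayley_eq, h1, Matrix.mul_sub, Matrix.sub_mul, Matrix.mul_smul, Matrix.smul_mul,
    Matrix.mul_one, coe_mul_conjTranspose_self]

/-- The scalar Cayley transform. -/
def cay (r : ℝ) : ℂ := (1 + Complex.I * r) / (1 - Complex.I * r)

theorem one_sub_I_mul_ne_zero (r : ℝ) : (1 - Complex.I * r : ℂ) ≠ 0 := by
  intro h
  have := congrArg Complex.re h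
  simp at this

theorem resolv_dg (d : Fin N → ℝ) :
    resolv N (dg N d) = Matrix.diagonal fun i => (1 - Complex.I * d i)⁻¹ := by
  rw [resolv, herm_dg]
  refine Matrix.inv_eq_right_inv ?_
  rw [← Matrix.diagonal_one, ← Matrix.diagonal_smul, Matrix.diagonal_sub,
    Matrix.diagonal_mul_diagonal]
  congr 1; ext i
  exact mul_inv_cancel₀ (one_sub_I_mul_ne_zero _)

theorem cayley_dg (d : Fin N → ℝ) :
    cayley N (dg N d) = Matrix.diagonal fun i => cay (d i) := by
  have h : cayley N (dg N d) = (1 + Complex.I • herm N (dg N d)) * resolv N (dg N d) := rfl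
  rw [h, resolv_dg, herm_dg, ← Matrix.diagonal_one, ← Matrix.diagonal_smul, Matrix.diagonal_add,
    Matrix.diagonal_mul_diagonal]
  rfl

theorem norm_cay (r : ℝ) : ‖cay r‖ = 1 := by
  have : (1 + Complex.I * r : ℂ) = star (1 - Complex.I * r : ℂ) := by
    simp
  rw [cay, norm_div, this, norm_star, div_self (norm_ne_zero_iff.2 (one_sub_I_mul_ne_zero r))]

theorem exists_angle {z : ℂ} (hz : ‖z‖ = 1) : ∃ θ : ℝ, z = Complex.exp (Complex.I * θ) :=
  ⟨z.arg, by
    have := Complex.norm_mul_exp_arg_mul_I z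
    rw [hz, Complex.ofReal_one, one_mul] at this
    rw [mul_comm, this]⟩

/-- Every unitary matrix is diagonalisable by a unitary matrix. -/
theorem exists_unitary_diagonal (x : UN N) : ∃ (k : UN N) (θ : Fin N → ℝ),
    (x : Mat N) = (k : Mat N) * Matrix.diagonal (fun i => Complex.exp (Complex.I * θ i)) *
      (k : Mat N)ᴴ := by
  -- A scalar of modulus 1 moves `x` into the Cayley chart. There it is the transform of a Hermitian
  -- matrix, which is diagonalised before the scalar is divided out.
  obtain ⟨s, hs⟩ := exists_scalar_transDom x
  obtain ⟨k, d, hd⟩ := exists_cong_dg (transMap x (dg N fun _ => s))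
  have h1 := cayley_transMap hs
  rw [hd, cayley_cong, cayley_dg, cayley_dg] at h1
  have hc : cay s ≠ 0 := norm_ne_zero_iff.1 (by rw [norm_cay]; exact one_ne_zero)
  have h2 : ∀ i, ∃ θ : ℝ, (cay s)⁻¹ * cay (d i) = Complex.exp (Complex.I * θ) := fun i =>
    exists_angle (by rw [norm_mul, norm_inv, norm_cay, norm_cay]; norm_num)
  choose θ hθ using h2
  refine ⟨k, θ, ?_⟩
  have h3 : (Matrix.diagonal fun _ => cay s : Mat N) = cay s • 1 := by
    rw [Matrix.smul_one_eq_diagonal]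
  rw [h3, Matrix.smul_mul, Matrix.one_mul] at h1
  have h4 : (Matrix.diagonal fun i => Complex.exp (Complex.I * θ i) : Mat N) =
      (cay s)⁻¹ • Matrix.diagonal fun i => cay (d i) := by
    rw [← Matrix.diagonal_smul]
    congr 1; ext i
    exact (hθ i).symm
  rw [h4, Matrix.mul_smul, Matrix.smul_mul, h1, smul_smul, inv_mul_cancel₀ hc, one_smul]

/-! ### The theta function is positive -/

theorem jacobiTheta_eq_jacobiTheta₂ (φ s : ℝ) :
    jacobiTheta φ s = jacobiTheta₂ (φ / π : ℂ) (Complex.I * (s / π : ℝ)) := by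
  unfold jacobiTheta jacobiTheta₂
  refine tsum_congr fun m => ?_
  have hp : (π : ℂ) ≠ 0 := by exact_mod_cast Real.pi_ne_zero
  unfold jacobiTheta₂_term
  congr 1
  push_cast
  field_simp
  linear_combination -(m : ℂ) ^ 2 * s * Complex.I_sq

/-- The functional equation (Poisson summation) rewrites the oscillating series as a positive
multiple of a sum of real exponentials. -/
theorem exists_jacobiTheta_eq (φ : ℝ) {s : ℝ} (hs : 0 < s) :
    ∃ r : ℝ, 0 < r ∧ jacobiTheta φ s = r := by
  have hp : (π : ℂ) ≠ 0 := by exact_mod_cast Real.pi_ne_zero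
  have hs' : (s : ℂ) ≠ 0 := by exact_mod_cast hs.ne'
  rw [jacobiTheta_eq_jacobiTheta₂, jacobiTheta₂_functional_equation]
  have h1 : -Complex.I * (Complex.I * (s / π : ℝ)) = ((s / π : ℝ) : ℂ) := by
    rw [← mul_assoc, neg_mul, Complex.I_mul_I, neg_neg, one_mul]
  have h2 : -(π : ℂ) * Complex.I * (φ / π : ℂ) ^ 2 / (Complex.I * (s / π : ℝ)) =
      ((-φ ^ 2 / s : ℝ) : ℂ) := by
    push_cast
    field_simp [Complex.I_ne_zero]
  have hterm : ∀ n : ℤ, jacobiTheta₂_term n ((φ / π : ℂ) / (Complex.I * (s / π : ℝ)))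
      (-1 / (Complex.I * (s / π : ℝ))) =
      ((Real.exp (2 * π * n * φ / s - π ^ 2 * n ^ 2 / s) : ℝ) : ℂ) := by
    intro n
    rw [jacobiTheta₂_term, Complex.ofReal_exp]
    congr 1
    push_cast
    field_simp [Complex.I_ne_zero]
    ring
  have him : 0 < (-1 / (Complex.I * (s / π : ℝ)) : ℂ).im := by
    have : (-1 / (Complex.I * (s / π : ℝ)) : ℂ) = Complex.I * ((π / s : ℝ) : ℂ) := by
      push_cast
      field_simp [Complex.I_ne_zero]
      rw [Complex.I_sq]
    rw [this]
    simp
    positivity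
  have hsum := (hasSum_jacobiTheta₂_term ((φ / π : ℂ) / (Complex.I * (s / π : ℝ))) him)
  simp only [hterm] at hsum
  have hsr : Summable fun n : ℤ => Real.exp (2 * π * n * φ / s - π ^ 2 * n ^ 2 / s) :=
    Complex.summable_ofReal.1 hsum.summable
  refine ⟨1 / (s / π) ^ (1 / 2 : ℝ) * Real.exp (-φ ^ 2 / s) *
    ∑' n : ℤ, Real.exp (2 * π * n * φ / s - π ^ 2 * n ^ 2 / s), ?_, ?_⟩
  · have h3 := hsr.tsum_pos (fun n => (Real.exp_pos _).le) 0 (Real.exp_pos _)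
    have h4 : 0 < s / π := div_pos hs Real.pi_pos
    have h5 := Real.rpow_pos_of_pos h4 (1 / 2)
    positivity
  · rw [h1, h2, ← hsum.tsum_eq, ← Complex.ofReal_exp, ← Complex.ofReal_tsum]
    push_cast
    congr 3
    rw [← Complex.ofReal_div, Complex.ofReal_cpow (div_pos hs Real.pi_pos).le]
    push_cast; rfl

/-- The real theta function. -/
def thetaR (s φ : ℝ) : ℝ := (jacobiTheta (φ / 2) (s / 2)).re

theorem jacobiTheta_eq_thetaR {s : ℝ} (hs : 0 < s) (φ : ℝ) :
    jacobiTheta (φ / 2) (s / 2) = (thetaR s φ : ℂ) := by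
  obtain ⟨r, _, h⟩ := exists_jacobiTheta_eq (φ / 2) (half_pos hs)
  rw [thetaR, h, Complex.ofReal_re]

theorem thetaR_pos {s : ℝ} (hs : 0 < s) (φ : ℝ) : 0 < thetaR s φ := by
  obtain ⟨r, h0, h⟩ := exists_jacobiTheta_eq (φ / 2) (half_pos hs)
  rw [thetaR, h, Complex.ofReal_re]
  exact h0

theorem det_smul_matrixTheta {s : ℝ} (hs : 0 < s) (c : ℝ) (k x : UN N) (θ : Fin N → ℝ)
    (hx : (x : Mat N) = (k : Mat N) *
      Matrix.diagonal (fun i => Complex.exp (Complex.I * θ i)) * (k : Mat N)ᴴ) :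
    ((c : ℂ) • matrixTheta N s x).det = ((c ^ N * ∏ i, thetaR s (θ i) : ℝ) : ℂ) := by
  rw [matrixTheta_conj N hs k x θ hx, Matrix.det_smul, Matrix.det_mul, Matrix.det_mul,
    Matrix.det_diagonal, mul_right_comm (Matrix.det (k : Mat N)), ← Matrix.det_mul,
    coe_mul_conjTranspose_self, Matrix.det_one, one_mul, Fintype.card_fin]
  simp only [jacobiTheta_eq_thetaR hs]
  push_cast
  rfl

theorem thetaDet_eq {σ : ℝ} (hσ : 0 < σ) {c : ℝ} (hc : 0 < c) (xbar x : UN N) :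
    thetaDet N c σ xbar x = (thetaProfile N c σ xbar x : ℂ) ∧ 0 < thetaProfile N c σ xbar x := by
  have hs : 0 < σ ^ 2 := by positivity
  obtain ⟨k, θ, h⟩ := exists_unitary_diagonal (x * star xbar)
  have h1 := det_smul_matrixTheta hs c k _ θ h
  have h2 : thetaDet N c σ xbar x = ((c ^ N * ∏ i, thetaR (σ ^ 2) (θ i) : ℝ) : ℂ) := h1
  rw [thetaProfile, h2, Complex.ofReal_re]
  exact ⟨rfl, mul_pos (pow_pos hc _) (Finset.prod_pos fun i _ => thetaR_pos hs _)⟩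

/-! ### Continuity -/

theorem summable_norm_thetaCoeff {s : ℝ} (hs : 0 < s) :
    Summable fun m : ℤ => ‖Complex.exp (-(m : ℂ) ^ 2 * (s / 2 : ℝ))‖ := by
  have := (hasSum_jacobiTheta 0 (half_pos hs)).summable.norm
  simpa using this

theorem hasSum_matrixTheta_apply {s : ℝ} (hs : 0 < s) (x : UN N) (i j : Fin N) :
    HasSum (fun m : ℤ => Complex.exp (-(m : ℂ) ^ 2 * (s / 2 : ℝ)) * ((x ^ m : UN N) : Mat N) i j)
      (matrixTheta N s x i j) := by
  have h : ∀ i j, Summable fun m : ℤ =>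
      (Complex.exp (-(m : ℂ) ^ 2 * (s / 2 : ℝ)) • ((x ^ m : UN N) : Mat N)) i j := by
    intro i j
    refine Summable.of_norm_bounded (summable_norm_thetaCoeff hs) fun m => ?_
    rw [Matrix.smul_apply, smul_eq_mul, norm_mul]
    exact mul_le_of_le_one_right (norm_nonneg _) (entry_norm_bound_of_unitary (x ^ m).2 i j)
  have h2 : Summable fun m : ℤ =>
      (Complex.exp (-(m : ℂ) ^ 2 * (s / 2 : ℝ)) • ((x ^ m : UN N) : Mat N)) :=
    Pi.summable.2 fun i => Pi.summable.2 fun j => h i j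
  exact Pi.hasSum.1 (Pi.hasSum.1 h2.hasSum i) j

/-- Entries of unitary matrices are bounded by 1, so the series is dominated by its summable
coefficients uniformly on `U(N)`. -/
theorem continuous_matrixTheta {s : ℝ} (hs : 0 < s) : Continuous (matrixTheta N s) := by
  refine continuous_matrix fun i j => ?_
  simp only [← (hasSum_matrixTheta_apply hs _ i j).tsum_eq]
  refine continuous_tsum (fun m => ?_) (summable_norm_thetaCoeff hs) fun m x => ?_
  · refine continuous_const.mul ?_
    have h1 : Continuous fun x : UN N => ((x ^ m : UN N) : Mat N) :=
      continuous_subtype_val.comp (continuous_zpow m)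
    exact (continuous_apply j).comp ((continuous_apply i).comp h1)
  · rw [norm_mul]
    exact mul_le_of_le_one_right (norm_nonneg _) (entry_norm_bound_of_unitary (x ^ m).2 i j)

theorem continuous_thetaProfile {σ : ℝ} (hσ : 0 < σ) (c : ℝ) (xbar : UN N) :
    Continuous (thetaProfile N c σ xbar) := by
  have hs : 0 < σ ^ 2 := by positivity
  have h : Continuous fun x : UN N => x * star xbar := by fun_prop
  have h2 : Continuous fun x => thetaDet N c σ xbar x :=
    (((continuous_matrixTheta hs).comp h).const_smul (c : ℂ)).matrix_det
  exact Complex.continuous_re.comp h2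

/-- The centre enters only through `x x̄†`, and right invariance of the volume absorbs `x̄†`. -/
theorem lintegral_thetaProfile {σ : ℝ} (hσ : 0 < σ) (c : ℝ) (xbar : UN N) :
    ∫⁻ x, ENNReal.ofReal (thetaProfile N c σ xbar x) ∂(volU N) =
      ∫⁻ x, ENNReal.ofReal (thetaProfile N c σ 1 x) ∂(volU N) := by
  rw [← lintegral_volU_mul_right (star xbar)
    (continuous_thetaProfile hσ c 1).measurable.ennreal_ofReal]
  simp [thetaProfile, thetaDet]

/-- The scalar theta function in the Cayley coordinate. -/
def thetaCay (s r : ℝ) : ℝ := (∑' m : ℤ, Complex.exp (-(m : ℂ) ^ 2 * (s / 2 : ℝ)) * cay r ^ m).re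

theorem exists_angle_thetaCay {s : ℝ} (r : ℝ) :
    ∃ θ : ℝ, cay r = Complex.exp (Complex.I * θ) ∧ thetaCay s r = thetaR s θ := by
  obtain ⟨θ, h⟩ := exists_angle (norm_cay r)
  refine ⟨θ, h, ?_⟩
  rw [thetaCay, thetaR, jacobiTheta]
  congr 1
  refine tsum_congr fun m => ?_
  rw [h, ← Complex.exp_int_mul, ← Complex.exp_add]
  congr 1
  push_cast; ring

theorem thetaProfile_cayleyU_dg {σ : ℝ} (hσ : 0 < σ) (c : ℝ) (d : Fin N → ℝ) :
    thetaProfile N c σ 1 (cayleyU N (dg N d)) = c ^ N * ∏ i, thetaCay (σ ^ 2) (d i) := by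
  have hs : 0 < σ ^ 2 := by positivity
  choose θ h1 h2 using fun i => exists_angle_thetaCay (s := σ ^ 2) (d i)
  have h3 := det_smul_matrixTheta hs c 1 (cayleyU N (dg N d) * star 1) θ (by
    simp only [star_one, mul_one, OneMemClass.coe_one, Matrix.one_mul, Matrix.conjTranspose_one,
      ← h1]
    exact cayley_dg d)
  rw [thetaProfile, thetaDet, h3, Complex.ofReal_re]
  simp only [h2]

theorem thetaProfile_cayleyU_cong {σ : ℝ} (hσ : 0 < σ) (c : ℝ) (k : UN N) (t : Coord N) :
    thetaProfile N c σ 1 (cayleyU N (cong (k : Mat N) t)) =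
      thetaProfile N c σ 1 (cayleyU N t) := by
  have hs : 0 < σ ^ 2 := by positivity
  obtain ⟨k', θ, h⟩ := exists_unitary_diagonal (cayleyU N t * star 1)
  have h1 := det_smul_matrixTheta hs c k' _ θ h
  have h2 := det_smul_matrixTheta hs c (k * k') (cayleyU N (cong (k : Mat N) t) * star 1) θ (by
    rw [star_one, mul_one] at h ⊢
    change cayley N (cong (k : Mat N) t) = _
    change cayley N t = _ at h
    rw [cayley_cong, h, Submonoid.coe_mul, Matrix.conjTranspose_mul]
    simp only [Matrix.mul_assoc])
  rw [thetaProfile, thetaProfile, thetaDet, thetaDet, h1, h2]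

/-! ### Andréief's identity -/

section Andreief
variable {ι 𝕜 : Type*} [Fintype ι] [RCLike 𝕜]

theorem det_mul_det_eq_sum [DecidableEq ι] (f g : ι → ι → 𝕜) :
    (Matrix.of fun i j => f j i).det * (Matrix.of fun i j => g j i).det =
      ∑ σ : Equiv.Perm ι, ∑ τ : Equiv.Perm ι, ((σ.sign : ℤ) : 𝕜) * ((τ.sign : ℤ) : 𝕜) *
        ∏ i, f (σ i) i * g (τ i) i := by
  rw [← Matrix.det_transpose, ← Matrix.det_transpose (Matrix.of fun i j => g j i),
    Matrix.det_apply', Matrix.det_apply', Finset.sum_mul_sum]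
  refine Finset.sum_congr rfl fun σ _ => Finset.sum_congr rfl fun τ _ => ?_
  simp only [Matrix.transpose_apply, Matrix.of_apply, Finset.prod_mul_distrib]
  ring

theorem integrable_prod_mul {f g : ι → ℝ → 𝕜}
    (h : ∀ j k, Integrable fun r => f j r * g k r) (σ τ : Equiv.Perm ι) :
    Integrable fun x : ι → ℝ => ∏ i, f (σ i) (x i) * g (τ i) (x i) :=
  Integrable.fintype_prod (f := fun i r => f (σ i) r * g (τ i) r) fun _ => h _ _

theorem integrable_det_mul_det [DecidableEq ι] {f g : ι → ℝ → 𝕜}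
    (h : ∀ j k, Integrable fun r => f j r * g k r) :
    Integrable fun x : ι → ℝ => (Matrix.of fun i j => f j (x i)).det *
      (Matrix.of fun i j => g j (x i)).det := by
  have : (fun x : ι → ℝ => (Matrix.of fun i j => f j (x i)).det *
      (Matrix.of fun i j => g j (x i)).det) = fun x =>
      ∑ σ : Equiv.Perm ι, ∑ τ : Equiv.Perm ι, ((σ.sign : ℤ) : 𝕜) * ((τ.sign : ℤ) : 𝕜) *
        ∏ i, f (σ i) (x i) * g (τ i) (x i) := by
    ext1 x
    exact det_mul_det_eq_sum (fun j i => f j (x i)) (fun j i => g j (x i))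
  rw [this]
  exact integrable_finsetSum _ fun σ _ => integrable_finsetSum _ fun τ _ =>
    (integrable_prod_mul h σ τ).const_mul _

/-- **Andréief's identity**. -/
theorem integral_det_mul_det [DecidableEq ι] {f g : ι → ℝ → 𝕜}
    (h : ∀ j k, Integrable fun r => f j r * g k r) :
    ∫ x : ι → ℝ, (Matrix.of fun i j => f j (x i)).det * (Matrix.of fun i j => g j (x i)).det =
      (Fintype.card (Equiv.Perm ι) : 𝕜) * (Matrix.of fun j k => ∫ r, f j r * g k r).det := by
  set A : Matrix ι ι 𝕜 := Matrix.of fun j k => ∫ r, f j r * g k r with hA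
  have h1 : ∀ x : ι → ℝ, (Matrix.of fun i j => f j (x i)).det *
      (Matrix.of fun i j => g j (x i)).det =
      ∑ σ : Equiv.Perm ι, ∑ τ : Equiv.Perm ι, ((σ.sign : ℤ) : 𝕜) * ((τ.sign : ℤ) : 𝕜) *
        ∏ i, f (σ i) (x i) * g (τ i) (x i) := fun x =>
    det_mul_det_eq_sum (fun j i => f j (x i)) (fun j i => g j (x i))
  simp only [h1]
  rw [integral_finsetSum _ fun σ _ => integrable_finsetSum _ fun τ _ =>
    (integrable_prod_mul h σ τ).const_mul _]
  -- For fixed `σ`, the sum over `τ` is the determinant of `A` with rows permuted by `σ`. Its sign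
  -- cancels the remaining sign, so all `σ` contribute equally.
  have h2 : ∀ σ : Equiv.Perm ι, (∫ x : ι → ℝ, ∑ τ : Equiv.Perm ι, ((σ.sign : ℤ) : 𝕜) *
      ((τ.sign : ℤ) : 𝕜) * ∏ i, f (σ i) (x i) * g (τ i) (x i)) = A.det := by
    intro σ
    rw [integral_finsetSum _ fun τ _ => (integrable_prod_mul h σ τ).const_mul _]
    have h3 : ∀ τ : Equiv.Perm ι, (∫ x : ι → ℝ, ((σ.sign : ℤ) : 𝕜) *
        ((τ.sign : ℤ) : 𝕜) * ∏ i, f (σ i) (x i) * g (τ i) (x i)) =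
        ((σ.sign : ℤ) : 𝕜) * (((τ.sign : ℤ) : 𝕜) * ∏ i, A (σ i) (τ i)) := by
      intro τ
      rw [integral_const_mul, integral_fintype_prod_volume_eq_prod
        (f := fun i r => f (σ i) r * g (τ i) r), mul_assoc]
      rfl
    simp only [h3]
    rw [← Finset.mul_sum]
    have h4 : ∑ τ : Equiv.Perm ι, ((τ.sign : ℤ) : 𝕜) * ∏ i, A (σ i) (τ i) =
        (A.submatrix σ id).det := by
      rw [← Matrix.det_transpose, Matrix.det_apply']
      rfl
    rw [h4, Matrix.det_permute, ← mul_assoc]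
    have h5 : ((σ.sign : ℤ) : 𝕜) * ((σ.sign : ℤ) : 𝕜) = 1 := by
      rw [← Int.cast_mul, Int.units_coe_mul_self, Int.cast_one]
    rw [h5, one_mul]
  simp only [h2]
  rw [Finset.sum_const, Finset.card_univ, nsmul_eq_mul]

end Andreief

/-! ### Gaussian moments -/

theorem exp_quadratic_eq {s : ℝ} (hs : 0 < s) (a u : ℝ) :
    Real.exp (a * u - u ^ 2 / (2 * s)) =
      Real.exp (s * a ^ 2 / 2) * Real.exp (-(2 * s)⁻¹ * (u - s * a) ^ 2) := by
  rw [← Real.exp_add]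
  congr 1
  field_simp
  ring

theorem integrable_exp_quadratic {s : ℝ} (hs : 0 < s) (a : ℝ) :
    Integrable fun u : ℝ => Real.exp (a * u - u ^ 2 / (2 * s)) := by
  simp only [exp_quadratic_eq hs]
  have h := integrable_exp_neg_mul_sq (b := (2 * s)⁻¹) (by positivity)
  exact (h.comp_sub_right (s * a)).const_mul _

theorem integral_exp_quadratic {s : ℝ} (hs : 0 < s) (a : ℝ) :
    ∫ u : ℝ, Real.exp (a * u - u ^ 2 / (2 * s)) = √(2 * π * s) * Real.exp (s * a ^ 2 / 2) := by
  simp only [exp_quadratic_eq hs]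
  rw [integral_const_mul,
    integral_sub_right_eq_self (fun u : ℝ => Real.exp (-(2 * s)⁻¹ * u ^ 2)) (s * a),
    integral_gaussian, mul_comm]
  congr 2
  field_simp

/-- The log-normal weight of the eigenvalues in `H(N)`. -/
def wH (N : ℕ) (s r : ℝ) : ℝ :=
  (Set.Ioi (0 : ℝ)).indicator (fun r => Real.exp (-Real.log r ^ 2 / (2 * s)) * (r ^ N)⁻¹) r

theorem wH_nonneg (s r : ℝ) : 0 ≤ wH N s r := by
  refine Set.indicator_nonneg (fun r hr => ?_) r
  have : (0 : ℝ) < r := hr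
  positivity

/-- The substitution `r = eᵘ` makes the log-normal moments Gaussian integrals; its Jacobian accounts
for the `+ 1` in the exponent. -/
theorem pow_mul_wH_exp {s : ℝ} (m : ℕ) (u : ℝ) :
    |Real.exp u| • (Real.exp u ^ m * (Real.exp (-Real.log (Real.exp u) ^ 2 / (2 * s)) *
      (Real.exp u ^ N)⁻¹)) = Real.exp (((m : ℝ) - N + 1) * u - u ^ 2 / (2 * s)) := by
  rw [abs_of_pos (Real.exp_pos u), Real.log_exp, ← Real.exp_nat_mul, ← Real.exp_nat_mul,
    ← Real.exp_neg, smul_eq_mul, ← Real.exp_add, ← Real.exp_add, ← Real.exp_add]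
  congr 1; ring

theorem pow_mul_wH (s r : ℝ) (m : ℕ) : r ^ m * wH N s r =
    (Real.exp '' Set.univ).indicator
      (fun r => r ^ m * (Real.exp (-Real.log r ^ 2 / (2 * s)) * (r ^ N)⁻¹)) r := by
  rw [Set.image_univ, Real.range_exp, wH]
  by_cases h : r ∈ Set.Ioi (0 : ℝ)
  · rw [Set.indicator_of_mem h, Set.indicator_of_mem h]
  · rw [Set.indicator_of_notMem h, Set.indicator_of_notMem h, mul_zero]

theorem measurableSet_range_exp : MeasurableSet (Real.exp '' Set.univ) := by
  rw [Set.image_univ, Real.range_exp]; exact measurableSet_Ioi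

theorem integrable_pow_mul_wH {s : ℝ} (hs : 0 < s) (m : ℕ) :
    Integrable fun r => r ^ m * wH N s r := by
  simp only [pow_mul_wH]
  rw [integrable_indicator_iff measurableSet_range_exp,
    integrableOn_image_iff_integrableOn_abs_deriv_smul MeasurableSet.univ
      (fun x _ => (Real.hasDerivAt_exp x).hasDerivWithinAt) Real.exp_injective.injOn]
  simp only [pow_mul_wH_exp]
  exact (integrable_exp_quadratic hs _).integrableOn

theorem integral_pow_mul_wH {s : ℝ} (hs : 0 < s) (m : ℕ) :
    ∫ r, r ^ m * wH N s r = √(2 * π * s) * Real.exp (s * ((m : ℝ) - N + 1) ^ 2 / 2) := by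
  simp only [pow_mul_wH]
  rw [integral_indicator measurableSet_range_exp,
    integral_image_eq_integral_abs_deriv_smul MeasurableSet.univ
      (fun x _ => (Real.hasDerivAt_exp x).hasDerivWithinAt) Real.exp_injective.injOn]
  simp only [pow_mul_wH_exp]
  rw [Measure.restrict_univ, integral_exp_quadratic hs]

/-! ### Fourier coefficients in the Cayley coordinate -/

theorem cay_eq (r : ℝ) : cay r = -1 + 2 * (1 - Complex.I * r)⁻¹ := by
  rw [cay]
  field_simp [one_sub_I_mul_ne_zero r]
  ring

theorem cay_ne_zero (r : ℝ) : cay r ≠ 0 :=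
  norm_ne_zero_iff.1 (by rw [norm_cay]; exact one_ne_zero)

theorem one_add_sq_eq (r : ℝ) :
    ((1 + r ^ 2 : ℝ) : ℂ) = (1 - Complex.I * r) * (1 + Complex.I * r) := by
  push_cast
  linear_combination (r : ℂ) ^ 2 * Complex.I_sq

theorem one_add_I_mul_ne_zero (r : ℝ) : (1 + Complex.I * r : ℂ) ≠ 0 := by
  have := one_sub_I_mul_ne_zero (-r)
  simpa using this

theorem hasDerivAt_cay (r : ℝ) :
    HasDerivAt cay (cay r * Complex.I * (2 / (1 + r ^ 2 : ℝ) : ℝ)) r := by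
  have h1 : HasDerivAt (fun r : ℝ => (1 - Complex.I * r : ℂ)) (-Complex.I) r := by
    have := (((hasDerivAt_id r).ofReal_comp).const_mul Complex.I).const_sub 1
    simpa using this
  have h2 : HasDerivAt (fun r : ℝ => (1 + Complex.I * r : ℂ)) Complex.I r := by
    have := (((hasDerivAt_id r).ofReal_comp).const_mul Complex.I).const_add 1
    simpa using this
  have h3 := h2.div h1 (one_sub_I_mul_ne_zero r)
  refine h3.congr_deriv ?_
  rw [cay, Complex.ofReal_div, one_add_sq_eq]
  field_simp [one_sub_I_mul_ne_zero r, one_add_I_mul_ne_zero r]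
  push_cast
  ring

theorem continuous_cay : Continuous cay :=
  continuous_iff_continuousAt.2 fun r => (hasDerivAt_cay r).continuousAt

theorem tendsto_cay {l : Filter ℝ} (hl : Filter.Tendsto (fun r : ℝ => |r|) l Filter.atTop) :
    Filter.Tendsto cay l (nhds (-1)) := by
  have h1 : Filter.Tendsto (fun r : ℝ => ‖(1 - Complex.I * r : ℂ)‖) l Filter.atTop := by
    refine Filter.tendsto_atTop_mono (fun r => ?_) hl
    have := Complex.abs_im_le_norm (1 - Complex.I * r)
    simpa using this
  have h2 : Filter.Tendsto (fun r : ℝ => (1 - Complex.I * r : ℂ)⁻¹) l (nhds 0) := by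
    rw [tendsto_zero_iff_norm_tendsto_zero]
    simp only [norm_inv]
    exact h1.inv_tendsto_atTop
  have h3 := (h2.const_mul 2).const_add (-1)
  simp only [mul_zero, add_zero] at h3
  exact h3.congr fun r => (cay_eq r).symm

theorem integrable_two_div : Integrable fun r : ℝ => (2 / (1 + r ^ 2) : ℝ) := by
  simpa [div_eq_mul_inv] using integrable_inv_one_add_sq.const_mul 2

theorem integrable_cay_zpow (m : ℤ) :
    Integrable fun r : ℝ => cay r ^ m * ((2 / (1 + r ^ 2) : ℝ) : ℂ) := by
  have hc : Continuous fun r => cay r ^ m := continuous_cay.zpow₀ m fun r => Or.inl (cay_ne_zero r)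
  refine Integrable.bdd_mul (c := 1) integrable_two_div.ofReal hc.aestronglyMeasurable
    (ae_of_all _ fun r => ?_)
  rw [norm_zpow, norm_cay, one_zpow]

/-- With `cay r = e^{iθ}` and `θ = 2 arctan r`, the measure `2 dr / (1 + r²)` is `dθ`. For `m ≠ 0`
the antiderivative `cayᵐ / (i m)` has the same limit at both ends of the line. -/
theorem integral_cay_zpow (m : ℤ) :
    ∫ r : ℝ, cay r ^ m * ((2 / (1 + r ^ 2) : ℝ) : ℂ) = if m = 0 then (2 * π : ℂ) else 0 := by
  split_ifs with hm
  · simp only [hm, zpow_zero, one_mul]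
    rw [integral_complex_ofReal]
    simp only [div_eq_mul_inv]
    rw [integral_const_mul, integral_univ_inv_one_add_sq]
    push_cast; rfl
  · have hd : ∀ r : ℝ, HasDerivAt (fun r => (m * Complex.I)⁻¹ * cay r ^ m)
        (cay r ^ m * ((2 / (1 + r ^ 2) : ℝ) : ℂ)) r := by
      intro r
      have h1 := ((hasDerivAt_zpow m (cay r) (Or.inl (cay_ne_zero r))).comp r
        (hasDerivAt_cay r)).const_mul ((m * Complex.I : ℂ)⁻¹)
      refine h1.congr_deriv ?_
      have h2 : (m : ℂ) ≠ 0 := by exact_mod_cast hm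
      have h3 := Complex.I_ne_zero
      rw [zpow_sub_one₀ (cay_ne_zero r)]
      have h4 := cay_ne_zero r
      field_simp
    have hlim : ∀ {l : Filter ℝ}, Filter.Tendsto (fun r : ℝ => |r|) l Filter.atTop →
        Filter.Tendsto (fun r => (m * Complex.I : ℂ)⁻¹ * cay r ^ m) l
          (nhds ((m * Complex.I : ℂ)⁻¹ * (-1) ^ m)) := fun hl =>
      ((tendsto_cay hl).zpow₀ m (Or.inl (by norm_num))).const_mul _
    rw [integral_of_hasDerivAt_of_tendsto hd (integrable_cay_zpow m)
      (hlim Filter.tendsto_abs_atBot_atTop) (hlim Filter.tendsto_abs_atTop_atTop), sub_self]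

/-! ### The weight of the eigenvalues in `U(N)` -/

theorem thetaCay_eq {s : ℝ} (hs : 0 < s) (r : ℝ) :
    (thetaCay s r : ℂ) = ∑' m : ℤ, Complex.exp (-(m : ℂ) ^ 2 * (s / 2 : ℝ)) * cay r ^ m := by
  obtain ⟨θ, h⟩ := exists_angle (norm_cay r)
  have h1 : ∑' m : ℤ, Complex.exp (-(m : ℂ) ^ 2 * (s / 2 : ℝ)) * cay r ^ m =
      jacobiTheta (θ / 2) (s / 2) := by
    rw [jacobiTheta]
    refine tsum_congr fun m => ?_
    rw [h, ← Complex.exp_int_mul, ← Complex.exp_add]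
    congr 1
    push_cast; ring
  rw [thetaCay, h1, jacobiTheta_eq_thetaR hs, Complex.ofReal_re]

theorem thetaCay_pos {s : ℝ} (hs : 0 < s) (r : ℝ) : 0 < thetaCay s r := by
  obtain ⟨θ, _, h⟩ := exists_angle_thetaCay (s := s) r
  rw [h]; exact thetaR_pos hs θ

theorem norm_cay_zpow (r : ℝ) (m : ℤ) : ‖cay r ^ m‖ = 1 := by
  rw [norm_zpow, norm_cay, one_zpow]

/-- The weight of the eigenvalues in `U(N)`, in the Cayley coordinate. -/
def wU (s r : ℝ) : ℝ := thetaCay s r * (2 / (1 + r ^ 2))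

theorem wU_nonneg {s : ℝ} (hs : 0 < s) (r : ℝ) : 0 ≤ wU s r :=
  mul_nonneg (thetaCay_pos hs r).le (by positivity)

theorem cay_zpow_mul_wU {s : ℝ} (hs : 0 < s) (n : ℤ) (r : ℝ) :
    cay r ^ n * (wU s r : ℂ) = ∑' m : ℤ, Complex.exp (-(m : ℂ) ^ 2 * (s / 2 : ℝ)) *
      (cay r ^ (m + n) * ((2 / (1 + r ^ 2) : ℝ) : ℂ)) := by
  rw [wU, Complex.ofReal_mul, thetaCay_eq hs, mul_left_comm, ← tsum_mul_right]
  refine tsum_congr fun m => ?_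
  rw [zpow_add₀ (cay_ne_zero r)]
  ring

/-- Since `|cay r| = 1`, the norms of the terms integrate to a constant times the summable theta
coefficients, which permits termwise integration. -/
theorem hasSum_integral_cay_zpow_mul_wU {s : ℝ} (hs : 0 < s) (n : ℤ) :
    HasSum (fun m : ℤ => ∫ r, Complex.exp (-(m : ℂ) ^ 2 * (s / 2 : ℝ)) *
      (cay r ^ (m + n) * ((2 / (1 + r ^ 2) : ℝ) : ℂ))) (∫ r, cay r ^ n * (wU s r : ℂ)) := by
  simp only [cay_zpow_mul_wU hs]
  refine hasSum_integral_of_summable_integral_norm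
    (fun m => (integrable_cay_zpow (m + n)).const_mul _) ?_
  have h : ∀ m : ℤ, (∫ r : ℝ, ‖Complex.exp (-(m : ℂ) ^ 2 * (s / 2 : ℝ)) *
      (cay r ^ (m + n) * ((2 / (1 + r ^ 2) : ℝ) : ℂ))‖) =
      ‖Complex.exp (-(m : ℂ) ^ 2 * (s / 2 : ℝ))‖ * ∫ r : ℝ, ‖((2 / (1 + r ^ 2) : ℝ) : ℂ)‖ := by
    intro m
    rw [← integral_const_mul]
    refine integral_congr_ae (ae_of_all _ fun r => ?_)
    simp only [norm_mul, norm_cay_zpow, one_mul]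
  simp only [h]
  exact (summable_norm_thetaCoeff hs).mul_right _

/-- Orthogonality keeps only the term `m = -n` of the theta series. -/
theorem integral_cay_zpow_mul_wU {s : ℝ} (hs : 0 < s) (n : ℤ) :
    ∫ r, cay r ^ n * (wU s r : ℂ) = ((2 * π * Real.exp (-(n : ℝ) ^ 2 * s / 2) : ℝ) : ℂ) := by
  rw [← (hasSum_integral_cay_zpow_mul_wU hs n).tsum_eq, tsum_eq_single (-n)]
  · rw [integral_const_mul, integral_cay_zpow, if_pos (neg_add_cancel n)]
    push_cast
    rw [mul_comm]
    congr 2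
    ring
  · intro m hm
    rw [integral_const_mul, integral_cay_zpow, if_neg, mul_zero]
    intro h
    exact hm (eq_neg_of_add_eq_zero_left h)

theorem continuous_thetaCay {s : ℝ} (hs : 0 < s) : Continuous (thetaCay s) := by
  refine Complex.continuous_re.comp (continuous_tsum (fun m => ?_) (summable_norm_thetaCoeff hs)
    fun m r => ?_)
  · exact continuous_const.mul (continuous_cay.zpow₀ m fun r => Or.inl (cay_ne_zero r))
  · rw [norm_mul, norm_cay_zpow, mul_one]

theorem integrable_cay_zpow_mul_wU {s : ℝ} (hs : 0 < s) (n : ℤ) :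
    Integrable fun r => cay r ^ n * (wU s r : ℂ) := by
  have h : ∀ r, cay r ^ n * (wU s r : ℂ) =
      (thetaCay s r : ℂ) * (cay r ^ n * ((2 / (1 + r ^ 2) : ℝ) : ℂ)) := fun r => by
    rw [wU, Complex.ofReal_mul]; ring
  simp only [h]
  refine Integrable.bdd_mul (c := ∑' m : ℤ, ‖Complex.exp (-(m : ℂ) ^ 2 * (s / 2 : ℝ))‖)
    (integrable_cay_zpow n)
    (Complex.continuous_ofReal.comp (continuous_thetaCay hs)).aestronglyMeasurable
    (ae_of_all _ fun r => ?_)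
  rw [thetaCay_eq hs]
  refine (norm_tsum_le_tsum_norm ?_).trans_eq ?_
  · simpa only [norm_mul, norm_cay_zpow, mul_one] using summable_norm_thetaCoeff hs
  · simp only [norm_mul, norm_cay_zpow, mul_one]

/-- The moment matrix of the eigenvalue weight of `U(N)`. -/
def gramU (N : ℕ) (s : ℝ) : Matrix (Fin N) (Fin N) ℝ :=
  Matrix.of fun j k => Real.exp (-((j : ℝ) - k) ^ 2 * s / 2)

/-- The moment matrix of the eigenvalue weight of `H(N)`. -/
def gramH (N : ℕ) (s : ℝ) : Matrix (Fin N) (Fin N) ℝ :=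
  Matrix.of fun j k => Real.exp (s * ((j : ℝ) + k - N + 1) ^ 2 / 2)

theorem sum_range_sq_sub (N : ℕ) :
    ∑ j ∈ Finset.range N, ((j : ℝ) ^ 2 - (N - 1) * j) = -((N : ℝ) * (N - 1) * (N - 2) / 6) := by
  have h : ∀ n : ℕ, ∑ j ∈ Finset.range n, ((j : ℝ) ^ 2 - (N - 1) * j) =
      (n : ℝ) * (n - 1) * (2 * n - 1) / 6 - (N - 1) * (n * (n - 1) / 2) := by
    intro n
    induction n with
    | zero => simp
    | succ n ih => rw [Finset.sum_range_succ, ih]; push_cast; ring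
  rw [h]; ring

/-- The heart of the duality: `(j + k - N + 1)² / 2 = -(j - k)² / 2 + q(j) + q(k)`, with `q(j) = j²
- (N - 1) j + (N - 1)² / 4`. The sum of `2 q(j)` over `0 ≤ j < N` is `(N³ - N) / 6`. -/
theorem det_gramH (N : ℕ) (s : ℝ) :
    (gramH N s).det = Real.exp (((N : ℝ) ^ 3 - N) / 6 * s) * (gramU N s).det := by
  set a : Fin N → ℝ := fun j => Real.exp (s * ((j : ℝ) ^ 2 - (N - 1) * j + ((N : ℝ) - 1) ^ 2 / 4))
    with ha
  have h1 : gramH N s = Matrix.diagonal a * gramU N s * Matrix.diagonal a := by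
    ext j k
    rw [Matrix.mul_diagonal, Matrix.diagonal_mul]
    simp only [gramH, gramU, Matrix.of_apply, ha, ← Real.exp_add]
    congr 1
    ring
  have h2 : (∏ j, a j) * (∏ j, a j) = Real.exp (((N : ℝ) ^ 3 - N) / 6 * s) := by
    rw [ha, ← Real.exp_sum, ← Real.exp_add, ← Finset.mul_sum, Finset.sum_add_distrib,
      Fin.sum_univ_eq_sum_range (fun j => ((j : ℝ) ^ 2 - (N - 1) * j)) N, sum_range_sq_sub,
      Finset.sum_const, Finset.card_univ, Fintype.card_fin, nsmul_eq_mul]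
    congr 1
    ring
  rw [h1, Matrix.det_mul, Matrix.det_mul, Matrix.det_diagonal, ← h2]
  ring

theorem det_const_mul (c : ℝ) (A : Matrix (Fin N) (Fin N) ℝ) :
    (Matrix.of fun j k => c * A j k).det = c ^ N * A.det := by
  have : (Matrix.of fun j k => c * A j k) = c • A := by ext; simp
  rw [this, Matrix.det_smul, Fintype.card_fin]

/-! ### The eigenvalue integral of `H(N)` -/

/-- The eigenvalue integrand of `H(N)`. -/
def eigH (N : ℕ) (s : ℝ) (x : Fin N → ℝ) : ℝ :=
  (Matrix.vandermonde x).det ^ 2 * ∏ i, wH N s (x i)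

theorem eigH_nonneg (s : ℝ) (x : Fin N → ℝ) : 0 ≤ eigH N s x :=
  mul_nonneg (sq_nonneg _) (Finset.prod_nonneg fun _ _ => wH_nonneg _ _)

/-- The weights are absorbed into the rows of one of the two Vandermonde determinants, giving the
form to which Andréief's identity applies. -/
theorem eigH_eq (s : ℝ) (x : Fin N → ℝ) : eigH N s x =
    (Matrix.of fun i j : Fin N => wH N s (x i) * x i ^ (j : ℕ)).det *
      (Matrix.of fun i j : Fin N => x i ^ (j : ℕ)).det := by
  have h := Matrix.det_mul_column (fun i => wH N s (x i)) (Matrix.vandermonde x)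
  have h2 : (Matrix.of fun i j : Fin N => x i ^ (j : ℕ)) = Matrix.vandermonde x := by
    ext i j; simp [Matrix.vandermonde]
  have h3 : (Matrix.of fun i j : Fin N => wH N s (x i) * x i ^ (j : ℕ)) =
      Matrix.of fun i j => wH N s (x i) * Matrix.vandermonde x i j := by
    ext i j; simp [Matrix.vandermonde]
  rw [h3, h, h2, eigH]; ring

theorem eigH_integrable_aux {s : ℝ} (hs : 0 < s) (j k : Fin N) :
    Integrable fun r : ℝ => (wH N s r * r ^ (j : ℕ)) * r ^ (k : ℕ) := by
  have h := integrable_pow_mul_wH (N := N) hs (j + k : ℕ)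
  refine h.congr (ae_of_all _ fun r => ?_)
  simp only
  rw [pow_add]; ring

theorem integrable_eigH {s : ℝ} (hs : 0 < s) : Integrable (eigH N s) := by
  have : eigH N s = _ := funext fun x => eigH_eq s x
  rw [this]
  exact integrable_det_mul_det (f := fun (j : Fin N) r => wH N s r * r ^ (j : ℕ))
    (g := fun (j : Fin N) r => r ^ (j : ℕ)) fun j k => eigH_integrable_aux hs j k

theorem integral_eigH {s : ℝ} (hs : 0 < s) :
    ∫ x, eigH N s x = (Fintype.card (Equiv.Perm (Fin N)) : ℝ) *
      (√(2 * π * s) ^ N * (gramH N s).det) := by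
  simp only [eigH_eq]
  rw [integral_det_mul_det (f := fun (j : Fin N) r => wH N s r * r ^ (j : ℕ))
    (g := fun (j : Fin N) r => r ^ (j : ℕ)) fun j k => eigH_integrable_aux hs j k,
    ← det_const_mul]
  congr 3
  ext j k
  have h := integral_pow_mul_wH (N := N) hs (j + k : ℕ)
  rw [gramH, Matrix.of_apply]
  push_cast at h
  rw [← h]
  refine integral_congr_ae (ae_of_all _ fun r => ?_)
  simp only
  rw [pow_add]; ring

/-! ### The eigenvalue integral of `U(N)` -/

/-- The eigenvalue integrand of `U(N)`, in the Cayley coordinates. -/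
def eigU (N : ℕ) (s : ℝ) (x : Fin N → ℝ) : ℝ :=
  ‖(Matrix.vandermonde fun i => cay (x i)).det‖ ^ 2 * ∏ i, wU s (x i)

theorem eigU_nonneg {s : ℝ} (hs : 0 < s) (x : Fin N → ℝ) : 0 ≤ eigU N s x :=
  mul_nonneg (sq_nonneg _) (Finset.prod_nonneg fun _ _ => wU_nonneg hs _)

theorem star_cay (r : ℝ) : star (cay r) = (cay r)⁻¹ := by
  rw [Complex.inv_def, Complex.normSq_eq_norm_sq, norm_cay]; simp

/-- On the unit circle conjugation is inversion, so `|det V|²` is the product of the Vandermonde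
determinants of `cay` and `cay⁻¹`; the moments then depend on `j - k`. -/
theorem eigU_eq (s : ℝ) (x : Fin N → ℝ) : (eigU N s x : ℂ) =
    (Matrix.of fun i j : Fin N => (wU s (x i) : ℂ) * cay (x i) ^ (j : ℕ)).det *
      (Matrix.of fun i j : Fin N => (cay (x i))⁻¹ ^ (j : ℕ)).det := by
  set V := Matrix.vandermonde fun i => cay (x i) with hV
  have h := Matrix.det_mul_column (fun i => (wU s (x i) : ℂ)) V
  have h2 : (Matrix.of fun i j : Fin N => (cay (x i))⁻¹ ^ (j : ℕ)) = V.map star := by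
    ext i j; simp [hV, Matrix.vandermonde, ← star_cay]
  have h3 : (Matrix.of fun i j : Fin N => (wU s (x i) : ℂ) * cay (x i) ^ (j : ℕ)) =
      Matrix.of fun i j => (wU s (x i) : ℂ) * V i j := by
    ext i j; simp [hV, Matrix.vandermonde]
  have h4 : (V.map star).det = star V.det := by
    rw [← Matrix.det_conjTranspose, ← Matrix.det_transpose]; rfl
  have h5 : V.det * star V.det = ((‖V.det‖ ^ 2 : ℝ) : ℂ) := by
    rw [← Complex.normSq_eq_norm_sq]; exact Complex.mul_conj _
  rw [h3, h, h2, h4, mul_assoc, h5, eigU]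
  push_cast; ring

theorem eigU_aux (s r : ℝ) (j k : ℕ) :
    ((wU s r : ℂ) * cay r ^ j) * (cay r)⁻¹ ^ k = cay r ^ ((j : ℤ) - k) * (wU s r : ℂ) := by
  rw [zpow_sub₀ (cay_ne_zero r), zpow_natCast, zpow_natCast, inv_pow]
  ring

theorem integrable_eigU {s : ℝ} (hs : 0 < s) : Integrable (eigU N s) := by
  have h : Integrable fun x => (eigU N s x : ℂ) := by
    simp only [eigU_eq]
    refine integrable_det_mul_det (f := fun (j : Fin N) r => (wU s r : ℂ) * cay r ^ (j : ℕ))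
      (g := fun (j : Fin N) r => (cay r)⁻¹ ^ (j : ℕ)) fun j k => ?_
    simp only [eigU_aux]
    exact integrable_cay_zpow_mul_wU hs _
  simpa using h.re

theorem integral_eigU {s : ℝ} (hs : 0 < s) :
    ∫ x, eigU N s x = (Fintype.card (Equiv.Perm (Fin N)) : ℝ) *
      ((2 * π) ^ N * (gramU N s).det) := by
  apply Complex.ofReal_injective
  rw [← integral_complex_ofReal]
  simp only [eigU_eq]
  rw [integral_det_mul_det (f := fun (j : Fin N) r => (wU s r : ℂ) * cay r ^ (j : ℕ))
      (g := fun (j : Fin N) r => (cay r)⁻¹ ^ (j : ℕ)) fun j k => by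
        simp only [eigU_aux]
        exact integrable_cay_zpow_mul_wU hs _, ← det_const_mul, Complex.ofReal_mul,
    Complex.ofReal_natCast]
  congr 1
  rw [← Complex.ofRealHom_eq_coe, RingHom.map_det]
  congr 1
  ext j k
  simp only [eigU_aux, Matrix.of_apply, integral_cay_zpow_mul_wU hs, RingHom.mapMatrix_apply,
    Matrix.map_apply, Complex.ofRealHom_eq_coe, gramU]
  push_cast; rfl

/-! ### The Weyl density in terms of Vandermonde determinants -/

/-- The product runs over ordered pairs, so each factor of the Vandermonde determinant appears
twice. -/
theorem prod_norm_sub_eq (v : Fin N → ℂ) :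
    ∏ p : Fin N × Fin N, (if p.1 = p.2 then 1 else ‖v p.1 - v p.2‖) =
      ‖(Matrix.vandermonde v).det‖ ^ 2 := by
  rw [Fintype.prod_prod_type, Matrix.det_vandermonde, norm_prod]
  simp only [norm_prod]
  have h1 : ∀ i : Fin N, ∏ j, (if i = j then 1 else ‖v i - v j‖) =
      (∏ j ∈ Finset.Ioi i, ‖v j - v i‖) * ∏ j ∈ Finset.Iio i, ‖v i - v j‖ := by
    intro i
    have h2 : (Finset.univ : Finset (Fin N)) = (Finset.Ioi i).disjUnion (Finset.Iic i)
        (Finset.disjoint_left.2 fun a ha hb => by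
          simp only [Finset.mem_Ioi, Finset.mem_Iic] at ha hb; omega) := by
      ext j; simp [lt_or_ge]
    rw [h2, Finset.prod_disjUnion, ← Finset.Iio_insert, Finset.prod_insert (by simp), if_pos rfl,
      one_mul]
    congr 1
    · refine Finset.prod_congr rfl fun j hj => ?_
      rw [if_neg (Finset.mem_Ioi.1 hj).ne, norm_sub_rev]
    · refine Finset.prod_congr rfl fun j hj => ?_
      rw [if_neg (Finset.mem_Iio.1 hj).ne']
  simp only [h1]
  rw [Finset.prod_mul_distrib, sq]
  congr 1
  refine Finset.prod_comm' fun i j => ?_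
  simp

theorem prod_gap_eq (d : Fin N → ℝ) :
    ∏ p, |gap d p| = detWt N * (Matrix.vandermonde d).det ^ 2 := by
  have h1 := prod_norm_sub_eq fun i => (d i : ℂ)
  have h2 : (Matrix.vandermonde fun i => (d i : ℂ)).det = ((Matrix.vandermonde d).det : ℂ) := by
    rw [← Complex.ofRealHom_eq_coe, RingHom.map_det]
    congr 1
    ext i j; simp [Matrix.vandermonde]
  rw [h2, Complex.norm_real, Real.norm_eq_abs, sq_abs] at h1
  rw [← h1, detWt, ← Finset.prod_mul_distrib]
  refine Finset.prod_congr rfl fun p _ => ?_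
  simp only [gap, wt]
  split_ifs
  · simp
  · rw [abs_mul, abs_two, ← Complex.ofReal_sub, Complex.norm_real, Real.norm_eq_abs]

theorem detWt_mul_two_pow : detWt N * 2 ^ N = 2 ^ (N * N) := by
  have h1 : ∏ p : Fin N × Fin N, (if p.1 = p.2 then (2 : ℝ) else 1) = 2 ^ N := by
    rw [Fintype.prod_prod_type]
    simp
  have h2 : ∏ p : Fin N × Fin N, (2 : ℝ) = 2 ^ (N * N) := by simp
  rw [detWt, ← h1, ← h2, ← Finset.prod_mul_distrib]
  refine Finset.prod_congr rfl fun p _ => ?_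
  unfold wt; split_ifs <;> norm_num

theorem cay_sub_cay (a b : ℝ) :
    cay a - cay b = 2 * Complex.I * (a - b) * ((1 - Complex.I * a)⁻¹ * (1 - Complex.I * b)⁻¹) := by
  rw [cay, cay]
  field_simp [one_sub_I_mul_ne_zero a, one_sub_I_mul_ne_zero b]
  ring

theorem norm_one_sub_sq (r : ℝ) : ‖(1 - Complex.I * r : ℂ)‖ ^ 2 = 1 + r ^ 2 := by
  rw [← Complex.normSq_eq_norm_sq, Complex.normSq_apply]
  simp
  ring

/-- Each difference of Cayley transforms is `2i (a - b)` divided by `(1 - i a)(1 - i b)`. These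
denominators account for `densU`, up to one factor `2 / (1 + d²)` per eigenvalue, the Jacobian of
the angle. -/
theorem prod_gap_mul_densU (d : Fin N → ℝ) :
    (∏ p, |gap d p|) * densU N (dg N d) = √(detWt N) * detWt N *
      (‖(Matrix.vandermonde fun i => cay (d i)).det‖ ^ 2 * ∏ i, (2 / (1 + d i ^ 2))) := by
  set ρ : Fin N → ℝ := fun i => ‖(1 - Complex.I * d i : ℂ)‖ with hρ
  have hρ0 : ∀ i, ρ i ≠ 0 := fun i => norm_ne_zero_iff.2 (one_sub_I_mul_ne_zero _)
  set Q : ℝ := ∏ p : Fin N × Fin N, (if p.1 = p.2 then 1 else ρ p.1 * ρ p.2) with hQ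
  set P : ℝ := ∏ i, ρ i with hP
  have hP0 : P ≠ 0 := Finset.prod_ne_zero_iff.2 fun i _ => hρ0 i
  have h1 : ∏ p, |gap d p| = ‖(Matrix.vandermonde fun i => cay (d i)).det‖ ^ 2 * Q := by
    rw [← prod_norm_sub_eq, hQ, ← Finset.prod_mul_distrib]
    refine Finset.prod_congr rfl fun p _ => ?_
    unfold gap
    split_ifs
    · simp
    · rw [cay_sub_cay, norm_mul, norm_mul, norm_mul, norm_mul, norm_inv, norm_inv,
        ← Complex.ofReal_sub, Complex.norm_real, Complex.norm_I, RCLike.norm_ofNat, abs_mul, abs_two,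
        Real.norm_eq_abs]
      have h3 := hρ0 p.1
      have h4 := hρ0 p.2
      simp only [hρ] at h3 h4 ⊢
      field_simp
  -- `Q` omits the diagonal pairs, whose product is `P²`.
  have h2 : Q * P ^ 2 = P ^ (2 * N) := by
    have h3 : ∏ p : Fin N × Fin N, (if p.1 = p.2 then ρ p.1 * ρ p.2 else 1) = P ^ 2 := by
      rw [Fintype.prod_prod_type]
      simp [Finset.prod_mul_distrib, sq, hP]
    have h4 : ∏ p : Fin N × Fin N, (ρ p.1 * ρ p.2) = P ^ (2 * N) := by
      rw [Fintype.prod_prod_type]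
      simp only [Finset.prod_mul_distrib, Finset.prod_const, Finset.card_univ, Fintype.card_fin]
      rw [Finset.prod_pow]
      ring
    rw [← h3, ← h4, hQ, ← Finset.prod_mul_distrib]
    refine Finset.prod_congr rfl fun p _ => ?_
    split_ifs <;> simp
  have h5 : densU N (dg N d) = √(detWt N) * (2 ^ (N * N) * (P ^ (2 * N))⁻¹) := by
    rw [densU, resolv_dg, Matrix.det_diagonal, norm_prod]
    simp only [norm_inv, Finset.prod_inv_distrib, inv_pow]
    rfl
  have h6 : ∏ i, (2 / (1 + d i ^ 2)) = 2 ^ N * (P ^ 2)⁻¹ := by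
    simp only [← norm_one_sub_sq]
    rw [Finset.prod_div_distrib, Finset.prod_const, Finset.card_univ, Fintype.card_fin,
      Finset.prod_pow, div_eq_mul_inv]
  have hQ0 : Q ≠ 0 := by
    intro h; rw [h, zero_mul] at h2; exact pow_ne_zero _ hP0 h2.symm
  rw [h1, h5, h6, ← detWt_mul_two_pow, ← h2]
  field_simp

/-- The constant `C` satisfies the Weyl integration formula for Hermitian matrices. -/
def IsWeylConst (N : ℕ) (C : ENNReal) : Prop := C ≠ 0 ∧ C ≠ ⊤ ∧
    ∀ F : Coord N → ENNReal, Measurable F → (∀ (k : UN N) t, F (cong (k : Mat N) t) = F t) →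
      ∫⁻ t, F t = C * ∫⁻ d, weylDensity d * F (dg N d)

/-! ### The normalising factor on the unitary group -/

theorem densU_cong (k : UN N) (t : Coord N) : densU N (cong (k : Mat N) t) = densU N t := by
  have h : ∀ t : Coord N, resolv N t = (2 : ℝ)⁻¹ • (1 + cayley N t) := fun t => by
    rw [one_add_cayley, smul_smul, inv_mul_cancel₀ two_ne_zero, one_smul]
  have h1 : (resolv N (cong (k : Mat N) t)).det = (resolv N t).det := by
    have h2 : 1 + cayley N (cong (k : Mat N) t) =
        (k : Mat N) * (1 + cayley N t) * (k : Mat N)ᴴ := by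
      rw [cayley_cong, Matrix.mul_add, Matrix.add_mul, Matrix.mul_one, coe_mul_conjTranspose_self]
    rw [h, h, det_real_smul, det_real_smul, h2, Matrix.det_mul, Matrix.det_mul,
      mul_right_comm (Matrix.det (k : Mat N)), ← Matrix.det_mul, coe_mul_conjTranspose_self,
      Matrix.det_one, one_mul]
  rw [densU, densU, h1]

theorem weylDensity_mul_densU_mul_thetaProfile {σ : ℝ} (hσ : 0 < σ) {c : ℝ}
    (d : Fin N → ℝ) :
    weylDensity d * (ENNReal.ofReal (densU N (dg N d)) *
      ENNReal.ofReal (thetaProfile N c σ 1 (cayleyU N (dg N d)))) =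
      ENNReal.ofReal (√(detWt N) * detWt N * c ^ N * eigU N (σ ^ 2) d) := by
  have h0 : 0 ≤ ∏ p, |gap d p| := Finset.prod_nonneg fun p _ => abs_nonneg _
  rw [weylDensity, ← mul_assoc, ← ENNReal.ofReal_mul h0, prod_gap_mul_densU,
    ← ENNReal.ofReal_mul, thetaProfile_cayleyU_dg hσ, eigU]
  · congr 1
    simp only [wU, Finset.prod_mul_distrib]
    ring
  · have := (detWt_pos (N := N)).le
    positivity

theorem lintegral_thetaProfile_one {C : ENNReal} (hC : IsWeylConst N C) {σ : ℝ} (hσ : 0 < σ)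
    {c : ℝ} (hc : 0 < c) :
    ∫⁻ x, ENNReal.ofReal (thetaProfile N c σ 1 x) ∂(volU N) =
      C * ENNReal.ofReal (√(detWt N) * detWt N * c ^ N * (Fintype.card (Equiv.Perm (Fin N)) *
        ((2 * π) ^ N * (gramU N (σ ^ 2)).det))) := by
  have hs : 0 < σ ^ 2 := by positivity
  have hw := (detWt_pos (N := N)).le
  have hm : Measurable fun x => ENNReal.ofReal (thetaProfile N c σ 1 x) :=
    (continuous_thetaProfile hσ c 1).measurable.ennreal_ofReal
  rw [lintegral_volU hm, hC.2.2 (fun t => ENNReal.ofReal (densU N t) *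
    ENNReal.ofReal (thetaProfile N c σ 1 (cayleyU N t)))
      (continuous_densU.measurable.ennreal_ofReal.mul (hm.comp continuous_cayleyU.measurable))
      (fun k t => by rw [densU_cong, thetaProfile_cayleyU_cong hσ])]
  simp only [weylDensity_mul_densU_mul_thetaProfile hσ]
  rw [← integral_eigU hs, ← integral_const_mul, ofReal_integral_eq_lintegral_ofReal
    ((integrable_eigU hs).const_mul _) (Filter.Eventually.of_forall fun x =>
      mul_nonneg (by positivity) (eigU_nonneg hs x))]

theorem integrable_thetaProfile {σ : ℝ} (hσ : 0 < σ) {c : ℝ} (hc : 0 < c) (xbar : UN N) :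
    Integrable (thetaProfile N c σ xbar) (volU N) := by
  obtain ⟨C, hC⟩ := exists_weyl_integration N
  refine (lintegral_ofReal_ne_top_iff_integrable
    (continuous_thetaProfile hσ c xbar).aestronglyMeasurable
    (Filter.Eventually.of_forall fun x => (thetaDet_eq hσ hc xbar x).2.le)).1 ?_
  rw [lintegral_thetaProfile hσ, lintegral_thetaProfile_one hC hσ hc]
  exact ENNReal.mul_ne_top hC.2.1 ENNReal.ofReal_ne_top

theorem thetaNorm_eq_toReal {σ : ℝ} (hσ : 0 < σ) {c : ℝ} (hc : 0 < c) (xbar : UN N) :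
    thetaNorm N c σ xbar =
      (∫⁻ x, ENNReal.ofReal (thetaProfile N c σ 1 x) ∂(volU N)).toReal := by
  rw [← lintegral_thetaProfile hσ c xbar]
  exact integral_eq_lintegral_of_nonneg_ae
    (Filter.Eventually.of_forall fun x => (thetaDet_eq hσ hc xbar x).2.le)
    (continuous_thetaProfile hσ c xbar).aestronglyMeasurable

theorem lintegral_thetaProfile_one_ne_zero {σ : ℝ} (hσ : 0 < σ) {c : ℝ} (hc : 0 < c) :
    ∫⁻ x, ENNReal.ofReal (thetaProfile N c σ 1 x) ∂(volU N) ≠ 0 := by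
  have hm : Measurable fun x => ENNReal.ofReal (thetaProfile N c σ 1 x) :=
    (continuous_thetaProfile hσ c 1).measurable.ennreal_ofReal
  rw [lintegral_volU hm]
  intro h
  have h1 := (lintegral_eq_zero_iff (continuous_densU.measurable.ennreal_ofReal.mul
    (hm.comp continuous_cayleyU.measurable))).1 h
  have h2 : ∀ᵐ t : Coord N, False := h1.mono fun t ht => by
    have h3 := densU_pos t
    have h4 := (thetaDet_eq hσ hc 1 (cayleyU N t)).2
    simp only [Pi.mul_apply, Function.comp_apply, Pi.zero_apply, mul_eq_zero,
      ENNReal.ofReal_eq_zero] at ht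
    rcases ht with ht | ht <;> linarith
  exact h2.exists.elim fun _ h => h

theorem thetaNorm_pos {σ : ℝ} (hσ : 0 < σ) {c : ℝ} (hc : 0 < c) (xbar : UN N) :
    0 < thetaNorm N c σ xbar := by
  obtain ⟨C, hC⟩ := exists_weyl_integration N
  rw [thetaNorm_eq_toReal hσ hc]
  refine ENNReal.toReal_pos (lintegral_thetaProfile_one_ne_zero hσ hc) ?_
  rw [lintegral_thetaProfile_one hC hσ hc]
  exact ENNReal.mul_ne_top hC.2.1 ENNReal.ofReal_ne_top

/-- Positivity is read off from the integral that this determinant computes, taken with `c = 1` and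
`σ = √s`. -/
theorem det_gramU_pos {s : ℝ} (hs : 0 < s) : 0 < (gramU N s).det := by
  obtain ⟨C, hC⟩ := exists_weyl_integration N
  have hσ := Real.sqrt_pos.2 hs
  have h := lintegral_thetaProfile_one_ne_zero (N := N) hσ one_pos
  rw [lintegral_thetaProfile_one hC hσ one_pos, Real.sq_sqrt hs.le] at h
  have h1 := ENNReal.ofReal_pos.1 (pos_iff_ne_zero.2 (right_ne_zero_of_mul h))
  have hw := (detWt_pos (N := N)).le
  exact pos_of_mul_pos_right (pos_of_mul_pos_right (pos_of_mul_pos_right h1 (by positivity))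
    (by positivity)) (by positivity)

theorem thetaNorm_eq {C : ENNReal} (hC : IsWeylConst N C) {σ : ℝ} (hσ : 0 < σ)
    {c : ℝ} (hc : 0 < c) (xbar : UN N) :
    thetaNorm N c σ xbar = C.toReal * (√(detWt N) * detWt N * c ^ N *
      (Fintype.card (Equiv.Perm (Fin N)) * ((2 * π) ^ N * (gramU N (σ ^ 2)).det))) := by
  have hw := (detWt_pos (N := N)).le
  have hg := (det_gramU_pos (N := N) (sq_pos_of_pos hσ)).le
  rw [thetaNorm_eq_toReal hσ hc, lintegral_thetaProfile_one hC hσ hc, ENNReal.toReal_mul,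
    ENNReal.toReal_ofReal (by positivity)]

theorem isProbabilityMeasure_thetaDistribution {σ : ℝ} (hσ : 0 < σ) {c : ℝ} (hc : 0 < c)
    (xbar : UN N) : IsProbabilityMeasure (thetaDistribution N c σ xbar) := by
  have hp := thetaNorm_pos hσ hc xbar
  refine ⟨?_⟩
  rw [thetaDistribution, withDensity_apply _ MeasurableSet.univ, Measure.restrict_univ,
    ← ofReal_integral_eq_lintegral_ofReal ((integrable_thetaProfile hσ hc xbar).const_mul _)
      (Filter.Eventually.of_forall fun x =>
        mul_nonneg (inv_nonneg.2 hp.le) (thetaDet_eq hσ hc xbar x).2.le),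
    integral_const_mul]
  rw [← thetaNorm, inv_mul_cancel₀ hp.ne', ENNReal.ofReal_one]

/-! ### The volume of the space of positive-definite matrices, in coordinates -/

/-- The coordinates of positive-definite matrices. -/
def posSet (N : ℕ) : Set (Coord N) := {t | (herm N t).PosDef}

/-- Positive definite means positive semidefinite, a closed condition, together with nonzero
determinant, an open one. -/
theorem measurableSet_posSet : MeasurableSet (posSet N) := by
  have h1 : posSet N = {t | ∀ v : Fin N → ℂ, 0 ≤ (star v ⬝ᵥ (herm N t *ᵥ v)).re} ∩
      {t | (herm N t).det ≠ 0} := by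
    ext t
    have hh : (herm N t).IsHermitian := herm_conjTranspose N t
    constructor
    · intro ht
      have ht' : (herm N t).PosDef := ht
      exact ⟨fun v => (Complex.le_def.1 (ht'.posSemidef.dotProduct_mulVec_nonneg v)).1,
        ht'.det_pos.ne'⟩
    · rintro ⟨h1, h2⟩
      have h3 : (herm N t).PosSemidef := by
        refine Matrix.PosSemidef.of_dotProduct_mulVec_nonneg hh fun v => Complex.le_def.2 ⟨h1 v, ?_⟩
        have := hh.im_star_dotProduct_mulVec_self v
        simpa using this.symm
      exact h3.posDef_iff_det_ne_zero.2 h2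
  rw [h1, Set.ofPred_forall]
  refine (IsClosed.measurableSet (isClosed_iInter fun v => isClosed_le continuous_const ?_)).inter
    (isOpen_ne_fun continuous_herm.matrix_det continuous_const).measurableSet
  exact Complex.continuous_re.comp
    (continuous_const.dotProduct (continuous_herm.matrix_mulVec continuous_const))

theorem cong_mem_posSet_iff {g : Mat N} (hg : g.det ≠ 0) (t : Coord N) :
    cong g t ∈ posSet N ↔ t ∈ posSet N := by
  have hu : IsUnit g := (Matrix.isUnit_iff_isUnit_det g).2 hg.isUnit
  have := Matrix.IsUnit.posDef_star_right_conjugate_iff (x := herm N t) hu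
  rw [Matrix.star_eq_conjTranspose, ← herm_cong] at this
  exact this

theorem dg_mem_posSet_iff (d : Fin N → ℝ) : dg N d ∈ posSet N ↔ ∀ i, 0 < d i := by
  have := posDef_conj_diagonal_iff 1 d
  simp only [OneMemClass.coe_one, Matrix.one_mul, Matrix.conjTranspose_one, Matrix.mul_one] at this
  rw [← herm_dg] at this
  exact this

/-- The density of the Riemannian volume of `H(N)`. -/
def densH (N : ℕ) : Coord N → ENNReal :=
  (posSet N).indicator fun t => ENNReal.ofReal (√(detWt N) * (‖(herm N t).det‖ ^ N)⁻¹)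

theorem measurable_densH : Measurable (densH N) :=
  (measurable_const.mul
    (continuous_herm.matrix_det.norm.pow N).measurable.inv).ennreal_ofReal.indicator
      measurableSet_posSet

theorem volH_eq : volH N = (volume.withDensity (densH N)).map (herm N) := by
  rw [volH, densH, withDensity_indicator measurableSet_posSet]
  congr 1
  refine withDensity_congr_ae ?_
  filter_upwards [ae_restrict_mem (measurableSet_posSet (N := N))] with t ht
  rw [volumeDensity_herm ht]

theorem measurableEmbedding_herm : MeasurableEmbedding (herm N) :=
  continuous_herm.measurableEmbedding herm_injective

theorem densH_cong {g : Mat N} (hg : g.det ≠ 0) (t : Coord N) :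
    ENNReal.ofReal (‖g.det‖ ^ (2 * N)) * densH N (cong g t) = densH N t := by
  have h0 : ‖g.det‖ ≠ 0 := norm_ne_zero_iff.2 hg
  by_cases ht : t ∈ posSet N
  · simp only [densH]
    rw [Set.indicator_of_mem ht, Set.indicator_of_mem ((cong_mem_posSet_iff hg t).2 ht),
      ← ENNReal.ofReal_mul (by positivity)]
    congr 1
    rw [herm_cong, Matrix.det_mul, Matrix.det_mul, Matrix.det_conjTranspose, norm_mul, norm_mul,
      norm_star, mul_right_comm, ← pow_two, mul_pow, ← pow_mul]
    field_simp
  · simp only [densH]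
    rw [Set.indicator_of_notMem ht,
      Set.indicator_of_notMem (fun h => ht ((cong_mem_posSet_iff hg t).1 h)), mul_zero]

theorem cong_injective {g : Mat N} (hg : g.det ≠ 0) : Function.Injective (cong g) := by
  intro s t h
  have := congrArg (cong g⁻¹) h
  simpa only [← LinearMap.comp_apply, ← cong_mul, Matrix.nonsing_inv_mul g hg.isUnit, cong_one,
    LinearMap.id_apply] using this

theorem continuous_cong (g : Mat N) : Continuous (cong g) :=
  LinearMap.continuous_of_finiteDimensional _

/-- The Jacobian `|det g|²ᴺ` of the congruence is balanced by the factor `|det x|⁻ᴺ` of the density.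
This reduces every Gaussian integral to the one centred at the identity. -/
theorem measurePreserving_cong_densH {g : Mat N} (hg : g.det ≠ 0) :
    MeasurePreserving (cong g) (volume.withDensity (densH N))
      (volume.withDensity (densH N)) := by
  have hm : Measurable (cong g) := (continuous_cong g).measurable
  have hdet := abs_det_cong hg
  have h0 : 0 < ‖g.det‖ ^ (2 * N) := pow_pos (norm_pos_iff.2 hg) _
  have hd0 : LinearMap.det (cong g) ≠ 0 := fun h => by
    rw [h, abs_zero] at hdet; exact h0.ne hdet
  refine ⟨hm, Measure.ext fun s hs => ?_⟩
  rw [Measure.map_apply hm hs, withDensity_apply _ (hm hs), withDensity_apply _ hs,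
    ← lintegral_indicator (hm hs), ← lintegral_indicator hs]
  have h1 : ∀ t, (cong g ⁻¹' s).indicator (densH N) t =
      ENNReal.ofReal (‖g.det‖ ^ (2 * N)) * s.indicator (densH N) (cong g t) := fun t => by
    by_cases ht : cong g t ∈ s
    · rw [Set.indicator_of_mem (s := cong g ⁻¹' s) ht, Set.indicator_of_mem ht, densH_cong hg]
    · rw [Set.indicator_of_notMem (s := cong g ⁻¹' s) ht, Set.indicator_of_notMem ht, mul_zero]
  have hi : Measurable (s.indicator (densH N)) := measurable_densH.indicator hs
  simp only [h1]
  rw [lintegral_const_mul _ (f := fun t => s.indicator (densH N) (cong g t)) (hi.comp hm), ← lintegral_map hi hm,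
    Measure.map_linearMap_addHaar_eq_smul_addHaar _ hd0, lintegral_smul_measure, smul_eq_mul,
    ← mul_assoc, ← ENNReal.ofReal_mul h0.le, abs_inv, hdet, mul_inv_cancel₀ h0.ne',
    ENNReal.ofReal_one, one_mul]

/-! ### The distance to the identity -/

theorem distSqH_cong_dg (k : UN N) (d : Fin N → ℝ) :
    distSqH N (herm N (cong (k : Mat N) (dg N d))) 1 = ∑ i, Real.log (d i) ^ 2 := by
  rw [distSqH, inv_one, Matrix.one_mul, charpoly_cong_dg, Polynomial.roots_prod _ _
    (Finset.prod_ne_zero_iff.2 fun i _ => Polynomial.X_sub_C_ne_zero _)]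
  simp only [Polynomial.roots_X_sub_C, Multiset.bind_singleton, Multiset.map_map,
    Function.comp_def, Complex.ofReal_re]
  rfl

theorem sum_coeff_mul_trace (p : Polynomial ℝ) (k : UN N) (d : Fin N → ℝ) :
    ∑ m ∈ Finset.range (p.natDegree + 1),
      p.coeff m * ((herm N (cong (k : Mat N) (dg N d))) ^ m).trace.re = ∑ i, p.eval (d i) := by
  simp only [trace_herm_cong_dg_pow, Polynomial.eval_eq_sum_range, ← Complex.ofReal_pow,
    ← Complex.ofReal_sum, Complex.ofReal_re, Finset.mul_sum]
  exact Finset.sum_comm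

/-- Weierstrass approximation of `log²` on the intervals `[1/(n+1), n+1]`, which exhaust the
positive half-line. -/
theorem exists_polynomial_tendsto_log_sq : ∃ p : ℕ → Polynomial ℝ, ∀ x : ℝ, 0 < x →
    Filter.Tendsto (fun n => (p n).eval x) Filter.atTop (nhds (Real.log x ^ 2)) := by
  have h : ∀ n : ℕ, ∃ p : Polynomial ℝ, ∀ x ∈ Set.Icc (1 / ((n : ℝ) + 1)) ((n : ℝ) + 1),
      |p.eval x - Real.log x ^ 2| < 1 / ((n : ℝ) + 1) := fun n => by
    refine exists_polynomial_near_of_continuousOn _ _ (fun x => Real.log x ^ 2) ?_ _ (by positivity)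
    refine (Real.continuousOn_log.mono fun x hx => ?_).pow 2
    have : 0 < 1 / ((n : ℝ) + 1) := by positivity
    exact (this.trans_le hx.1).ne'
  choose p hp using h
  refine ⟨p, fun x hx => ?_⟩
  have h0 := tendsto_one_div_add_atTop_nhds_zero_nat (𝕜 := ℝ)
  rw [tendsto_iff_norm_sub_tendsto_zero]
  refine squeeze_zero' (Filter.Eventually.of_forall fun n => norm_nonneg _) ?_ h0
  have h1 := h0.eventually (gt_mem_nhds hx)
  obtain ⟨m, hm⟩ := exists_nat_gt x
  filter_upwards [h1, Filter.eventually_ge_atTop m] with n hn hmn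
  have : (m : ℝ) ≤ n := by exact_mod_cast hmn
  exact (hp n x ⟨hn.le, by linarith⟩).le

/-- The distance is defined through the roots of a characteristic polynomial, whose measurability is
not apparent. Approximating `log²` by polynomials exhibits it as a pointwise limit of combinations
of traces of powers, which are continuous. -/
theorem measurable_indicator_distSqH :
    Measurable ((posSet N).indicator fun t => distSqH N (herm N t) 1) := by
  obtain ⟨p, hp⟩ := exists_polynomial_tendsto_log_sq
  refine measurable_of_tendsto_metrizable (f := fun n => (posSet N).indicator fun t =>
    ∑ m ∈ Finset.range ((p n).natDegree + 1), (p n).coeff m * (herm N t ^ m).trace.re)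
    (fun n => ?_) (tendsto_pi_nhds.2 fun t => ?_)
  · refine Measurable.indicator (Continuous.measurable ?_) measurableSet_posSet
    exact continuous_finsetSum _ fun m _ => continuous_const.mul
      (Complex.continuous_re.comp (continuous_herm.pow m).matrix_trace)
  · by_cases ht : t ∈ posSet N
    · simp only [Set.indicator_of_mem ht]
      obtain ⟨k, d, rfl⟩ := exists_cong_dg t
      have hk : (k : Mat N).det ≠ 0 :=
        norm_ne_zero_iff.1 (by rw [norm_det_unitary]; exact one_ne_zero)
      rw [cong_mem_posSet_iff hk, dg_mem_posSet_iff] at ht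
      simp only [sum_coeff_mul_trace, distSqH_cong_dg]
      exact tendsto_finsetSum _ fun i _ => hp _ (ht i)
    · simp only [Set.indicator_of_notMem ht]
      exact tendsto_const_nhds

/-! ### The normalising factor on the space of positive-definite matrices -/

theorem gaussProfile_one_eq {σ : ℝ} {t : Coord N} (ht : t ∈ posSet N) :
    gaussProfile N σ 1 (herm N t) = Real.exp
      (-((posSet N).indicator (fun t => distSqH N (herm N t) 1) t) / (2 * σ ^ 2)) := by
  rw [Set.indicator_of_mem ht, gaussProfile]

/-- The density of the volume of `H(N)` times the Gaussian density profile at the identity. -/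
def gaussDens (N : ℕ) (σ : ℝ) (t : Coord N) : ENNReal :=
  densH N t * ENNReal.ofReal (gaussProfile N σ 1 (herm N t))

/-- Off the positive cone the density vanishes, so the profile may be replaced there by a measurable
function. -/
theorem gaussDens_eq (σ : ℝ) (t : Coord N) :
    gaussDens N σ t = densH N t * ENNReal.ofReal (Real.exp
      (-((posSet N).indicator (fun t => distSqH N (herm N t) 1) t) / (2 * σ ^ 2))) := by
  by_cases ht : t ∈ posSet N
  · rw [gaussDens, gaussProfile_one_eq ht]
  · have : densH N t = 0 := Set.indicator_of_notMem ht _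
    rw [gaussDens, this, zero_mul, zero_mul]

theorem measurable_gaussDens (σ : ℝ) : Measurable (gaussDens N σ) := by
  rw [funext (gaussDens_eq σ)]
  exact measurable_densH.mul
    (measurable_indicator_distSqH.neg.div_const _).exp.ennreal_ofReal

theorem gaussDens_cong (σ : ℝ) (k : UN N) (t : Coord N) :
    gaussDens N σ (cong (k : Mat N) t) = gaussDens N σ t := by
  have hk : (k : Mat N).det ≠ 0 :=
    norm_ne_zero_iff.1 (by rw [norm_det_unitary]; exact one_ne_zero)
  have h1 := densH_cong hk t
  rw [norm_det_unitary, one_pow, ENNReal.ofReal_one, one_mul] at h1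
  obtain ⟨k', d, rfl⟩ := exists_cong_dg t
  have h2 : cong (k : Mat N) (cong (k' : Mat N) (dg N d)) =
      cong ((k * k' : UN N) : Mat N) (dg N d) := by
    rw [Submonoid.coe_mul, cong_mul]; rfl
  rw [gaussDens, gaussDens, h1, gaussProfile, gaussProfile, h2, distSqH_cong_dg, distSqH_cong_dg]

/-- The prefactor `√(detWt N) * detWt N` also occurs in `weylDensity_mul_densU_mul_thetaProfile`, so
it cancels from the ratio. -/
theorem weylDensity_mul_gaussDens (σ : ℝ) (d : Fin N → ℝ) :
    weylDensity d * gaussDens N σ (dg N d) =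
      ENNReal.ofReal (√(detWt N) * detWt N * eigH N (σ ^ 2) d) := by
  have hw := (detWt_pos (N := N)).le
  have h0 : 0 ≤ ∏ p, |gap d p| := Finset.prod_nonneg fun p _ => abs_nonneg _
  by_cases hd : ∀ i, 0 < d i
  · have hm := (dg_mem_posSet_iff d).2 hd
    have h1 := distSqH_cong_dg 1 d
    rw [OneMemClass.coe_one, cong_one, LinearMap.id_apply] at h1
    simp only [gaussDens, densH]
    rw [Set.indicator_of_mem hm, gaussProfile, h1, weylDensity,
      ← ENNReal.ofReal_mul (by positivity), ← ENNReal.ofReal_mul h0, prod_gap_eq, eigH]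
    congr 1
    have h2 : (herm N (dg N d)).det = ((∏ i, d i : ℝ) : ℂ) := by
      rw [herm_dg, Matrix.det_diagonal]; push_cast; rfl
    have h3 : ∏ i, wH N (σ ^ 2) (d i) =
        (‖(herm N (dg N d)).det‖ ^ N)⁻¹ * Real.exp (-(∑ i, Real.log (d i) ^ 2) / (2 * σ ^ 2)) := by
      have h4 : ∀ i, wH N (σ ^ 2) (d i) =
          Real.exp (-Real.log (d i) ^ 2 / (2 * σ ^ 2)) * (d i ^ N)⁻¹ := fun i =>
        Set.indicator_of_mem (show d i ∈ Set.Ioi (0 : ℝ) from hd i) _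
      rw [h2, Complex.norm_real, Real.norm_of_nonneg (Finset.prod_nonneg fun i _ => (hd i).le),
        ← Finset.prod_pow, ← Finset.prod_inv_distrib, ← Finset.sum_neg_distrib, Finset.sum_div,
        Real.exp_sum, ← Finset.prod_mul_distrib]
      exact Finset.prod_congr rfl fun i _ => by rw [h4, mul_comm]
    rw [h3]
    ring
  · have hm : dg N d ∉ posSet N := fun h => hd ((dg_mem_posSet_iff d).1 h)
    have h1 : densH N (dg N d) = 0 := Set.indicator_of_notMem hm _
    push Not at hd
    obtain ⟨i, hi⟩ := hd
    have h2 : wH N (σ ^ 2) (d i) = 0 := Set.indicator_of_notMem (fun h => hi.not_gt h) _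
    rw [gaussDens, h1, eigH, Finset.prod_eq_zero (Finset.mem_univ i) h2]
    simp

theorem aestronglyMeasurable_gaussProfile_one (σ : ℝ) :
    AEStronglyMeasurable (fun t => gaussProfile N σ 1 (herm N t))
      (volume.withDensity (densH N)) := by
  rw [densH, withDensity_indicator measurableSet_posSet]
  refine AEStronglyMeasurable.mono_ac (withDensity_absolutelyContinuous _ _) ?_
  refine (measurable_indicator_distSqH.neg.div_const
    (2 * σ ^ 2)).exp.aestronglyMeasurable.congr ?_
  filter_upwards [ae_restrict_mem (measurableSet_posSet (N := N))] with t ht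
  exact (gaussProfile_one_eq ht).symm

theorem lintegral_gaussProfile_one {C : ENNReal} (hC : IsWeylConst N C) {σ : ℝ} (hσ : 0 < σ) :
    ∫⁻ t, ENNReal.ofReal (gaussProfile N σ 1 (herm N t)) ∂(volume.withDensity (densH N)) =
      C * ENNReal.ofReal (√(detWt N) * detWt N * (Fintype.card (Equiv.Perm (Fin N)) *
        (√(2 * π * σ ^ 2) ^ N * (gramH N (σ ^ 2)).det))) := by
  have hs : 0 < σ ^ 2 := by positivity
  have hw := (detWt_pos (N := N)).le
  rw [lintegral_withDensity_eq_lintegral_mul₀' measurable_densH.aemeasurable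
    (aestronglyMeasurable_gaussProfile_one σ).aemeasurable.ennreal_ofReal]
  change ∫⁻ t, gaussDens N σ t = _
  rw [hC.2.2 _ (measurable_gaussDens σ) (gaussDens_cong σ)]
  simp only [weylDensity_mul_gaussDens]
  rw [← integral_eigH hs, ← integral_const_mul, ofReal_integral_eq_lintegral_ofReal
    ((integrable_eigH hs).const_mul _) (Filter.Eventually.of_forall fun x =>
      mul_nonneg (by positivity) (eigH_nonneg _ x))]

theorem integrable_gaussProfile_one {σ : ℝ} (hσ : 0 < σ) :
    Integrable (fun t => gaussProfile N σ 1 (herm N t)) (volume.withDensity (densH N)) := by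
  obtain ⟨C, hC⟩ := exists_weyl_integration N
  refine (lintegral_ofReal_ne_top_iff_integrable (aestronglyMeasurable_gaussProfile_one σ)
    (Filter.Eventually.of_forall fun x => (Real.exp_pos _).le)).1 ?_
  rw [lintegral_gaussProfile_one hC hσ]
  exact ENNReal.mul_ne_top hC.2.1 ENNReal.ofReal_ne_top

/-- After the congruence, `y⁻¹ x` is similar to the original matrix through `h†`, and the distance
depends only on the characteristic polynomial. -/
theorem gaussProfile_cong (σ : ℝ) {h : Mat N} (hh : h.det ≠ 0) (t : Coord N) :
    gaussProfile N σ (h * hᴴ) (herm N (cong h t)) = gaussProfile N σ 1 (herm N t) := by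
  have hh' : (hᴴ).det ≠ 0 := by
    rw [Matrix.det_conjTranspose]; exact star_ne_zero.2 hh
  have h1 : (h * hᴴ)⁻¹ * herm N (cong h t) = (hᴴ)⁻¹ * (herm N t * hᴴ) := by
    rw [herm_cong, Matrix.mul_inv_rev]
    calc _ = (hᴴ)⁻¹ * ((h⁻¹ * h) * (herm N t * hᴴ)) := by simp only [Matrix.mul_assoc]
      _ = _ := by rw [Matrix.nonsing_inv_mul h hh.isUnit, Matrix.one_mul]
  rw [gaussProfile, gaussProfile, distSqH, distSqH, h1, Matrix.charpoly_mul_comm,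
    Matrix.mul_assoc, Matrix.mul_nonsing_inv _ hh'.isUnit, Matrix.mul_one, inv_one, Matrix.one_mul]

theorem exists_det_ne_zero_eq_mul_conjTranspose {y : Mat N} (hy : y.PosDef) :
    ∃ h : Mat N, h.det ≠ 0 ∧ y = h * hᴴ := by
  obtain ⟨g, hg⟩ := exists_eq_conjTranspose_mul_self hy
  refine ⟨gᴴ, fun h0 => hy.det_pos.ne' ?_, by rw [Matrix.conjTranspose_conjTranspose]; exact hg⟩
  rw [hg, Matrix.det_mul, h0, zero_mul]

theorem measurableEmbedding_cong {g : Mat N} (hg : g.det ≠ 0) : MeasurableEmbedding (cong g) :=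
  (continuous_cong g).measurableEmbedding (cong_injective hg)

theorem integrable_gaussProfile {σ : ℝ} (hσ : 0 < σ) {ybar : Mat N} (hy : ybar.PosDef) :
    Integrable (gaussProfile N σ ybar) (volH N) := by
  obtain ⟨h, hh, rfl⟩ := exists_det_ne_zero_eq_mul_conjTranspose hy
  rw [volH_eq, measurableEmbedding_herm.integrable_map_iff,
    ← (measurePreserving_cong_densH hh).integrable_comp_emb (measurableEmbedding_cong hh)]
  refine (integrable_gaussProfile_one hσ).congr (Filter.Eventually.of_forall fun t => ?_)
  exact (gaussProfile_cong σ hh t).symm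

theorem gaussNorm_eq {C : ENNReal} (hC : IsWeylConst N C) {σ : ℝ} (hσ : 0 < σ) {ybar : Mat N}
    (hy : ybar.PosDef) :
    gaussNorm N σ ybar = C.toReal * (√(detWt N) * detWt N *
      (Fintype.card (Equiv.Perm (Fin N)) * (√(2 * π * σ ^ 2) ^ N * (gramH N (σ ^ 2)).det))) := by
  obtain ⟨h, hh, rfl⟩ := exists_det_ne_zero_eq_mul_conjTranspose hy
  have hw := (detWt_pos (N := N)).le
  have hg : 0 ≤ (gramH N (σ ^ 2)).det := by
    rw [det_gramH]
    exact mul_nonneg (Real.exp_pos _).le (det_gramU_pos (sq_pos_of_pos hσ)).le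
  rw [gaussNorm, volH_eq, measurableEmbedding_herm.integral_map,
    ← (measurePreserving_cong_densH hh).integral_comp (measurableEmbedding_cong hh)]
  simp only [gaussProfile_cong σ hh]
  rw [integral_eq_lintegral_of_nonneg_ae (f := fun t => gaussProfile N σ 1 (herm N t))
    (Filter.Eventually.of_forall fun x => (Real.exp_pos _).le)
    (aestronglyMeasurable_gaussProfile_one σ), lintegral_gaussProfile_one hC hσ,
    ENNReal.toReal_mul, ENNReal.toReal_ofReal (by positivity)]

/-- The ratio of the two normalising factors. -/
theorem gaussNorm_div_thetaNorm {σ : ℝ} (hσ : 0 < σ) {c : ℝ} (hc : 0 < c) {ybar : Mat N}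
    (hy : ybar.PosDef) (xbar : UN N) :
    gaussNorm N σ ybar / thetaNorm N c σ xbar =
      (√(2 * π * σ ^ 2) / (2 * π * c)) ^ N * Real.exp (((N : ℝ) ^ 3 - N) / 6 * σ ^ 2) := by
  obtain ⟨C, hC⟩ := exists_weyl_integration N
  have hC' : IsWeylConst N C := hC
  have hC0 : C.toReal ≠ 0 := (ENNReal.toReal_pos hC.1 hC.2.1).ne'
  have hw := detWt_pos (N := N)
  have hg := (det_gramU_pos (N := N) (sq_pos_of_pos hσ)).ne'
  have hcard : (Fintype.card (Equiv.Perm (Fin N)) : ℝ) ≠ 0 :=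
    Nat.cast_ne_zero.2 Fintype.card_ne_zero
  have hsw := (Real.sqrt_pos.2 hw).ne'
  -- The Weyl constant, the weight `detWt N` with its root, `N!` and the determinant of `gramU`
  -- occur in both factors and cancel.
  rw [gaussNorm_eq hC' hσ hy, thetaNorm_eq hC' hσ hc, det_gramH, div_pow, mul_pow (2 * π) c]
  generalize √(detWt N) = w at hsw ⊢
  generalize √(2 * π * σ ^ 2) ^ N = q
  have h2 : (2 * π) ^ N ≠ 0 := pow_ne_zero _ (by positivity)
  have h3 : c ^ N ≠ 0 := pow_ne_zero _ hc.ne'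
  generalize (2 * π) ^ N = P at h2 ⊢
  generalize c ^ N = c' at h3 ⊢
  field_simp

end ThetaDual

end

theorem mainTheorem6 (N : ℕ) (hN : 1 ≤ N) (σ : ℝ) (hσ : 0 < σ) :
    -- `f_*` is real and positive
    (∀ xbar x : UN N,
      thetaDet N √(2 * π * σ ^ 2) σ xbar x = (thetaProfile N √(2 * π * σ ^ 2) σ xbar x : ℂ) ∧
      0 < thetaProfile N √(2 * π * σ ^ 2) σ xbar x) ∧
    -- `Z_{M*}` is a finite positive number, which does not depend on `x̄`
    (∀ xbar : UN N,
      Integrable (thetaProfile N √(2 * π * σ ^ 2) σ xbar) (volU N) ∧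
      0 < thetaNorm N √(2 * π * σ ^ 2) σ xbar ∧
      thetaNorm N √(2 * π * σ ^ 2) σ xbar = thetaNorm N √(2 * π * σ ^ 2) σ 1 ∧
      IsProbabilityMeasure (thetaDistribution N √(2 * π * σ ^ 2) σ xbar)) ∧
    -- the ratio of the normalising factors
    (∀ (ybar : Mat N), ybar.PosDef → ∀ xbar : UN N,
      Integrable (gaussProfile N σ ybar) (volH N) ∧
      gaussNorm N σ ybar / thetaNorm N √(2 * π * σ ^ 2) σ xbar =
        (2 * π) ^ (-(N : ℤ)) * Real.exp (((N : ℝ) ^ 3 - N) / 6 * σ ^ 2) ∧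
      gaussNorm N σ ybar / thetaNorm N (√(2 * π * σ ^ 2) / (2 * π)) σ xbar =
        Real.exp (((N : ℝ) ^ 3 - N) / 6 * σ ^ 2)) := by
  have hc : 0 < √(2 * π * σ ^ 2) := Real.sqrt_pos.2 (by positivity)
  have hp : 0 < 2 * π := by positivity
  refine ⟨thetaDet_eq hσ hc, fun xbar => ⟨integrable_thetaProfile hσ hc xbar,
    thetaNorm_pos hσ hc xbar, ?_, isProbabilityMeasure_thetaDistribution hσ hc xbar⟩,
    fun ybar hy xbar => ⟨integrable_gaussProfile hσ hy, ?_, ?_⟩⟩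
  · rw [thetaNorm_eq_toReal hσ hc xbar, thetaNorm_eq_toReal hσ hc 1]
  -- For `c = √(2πσ²)` the base of the `N`-th power is `1 / (2π)`; after dividing `c` by `2π` it is
  -- 1.
  · rw [gaussNorm_div_thetaNorm hσ hc hy, div_mul_cancel_right₀ hc.ne',
      inv_pow, zpow_neg, zpow_natCast]
  · rw [gaussNorm_div_thetaNorm hσ (div_pos hc hp) hy, mul_div_cancel₀ _ hp.ne', div_self hc.ne',
      one_pow, one_mul]
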